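/- Let $G_n$ be the path graph with vertex set $\{0,1/n,2/n,\dots,1\}$ and edges $\{(j-1)/n,j/n\}$, $1\le j\le n$. For $\mathcal{B}_n\in\mathbb{R}$ and $\theta_0,\theta_1\in(-\pi,\pi]$, consider the XY model on $G_n$ with Dirichlet boundary condition $(\theta_0,\theta_1)$ and inverse temperature $\mathcal{B}_n$: the probability measure $$Z_{G_n}^{-1}(\theta_0,\theta_1)\,\exp\Big(\mathcal{B}_n\sum_{j=1}^{n}\cos\big(\theta^n_{j/n}-\theta^n_{(j-1)/n}\big)\Big)\prod_{j=1}^{n-1}d\theta^n_{j/n}\;\delta(\theta^n_0=\theta_0)\,\delta(\theta^n_1=\theta_1)$$ on families of angles in $(-\pi,\pi]$, where $Z_{G_n}(\theta_0,\theta_1)$ is the normalizing constant. Write $S^n_j=e^{i\theta^n_{j/n}}$ for $0\le j\le n$. Suppose that $\mathcal{B}_n/n\to b\in(0,\infty)$ as $n\to\infty$. (1) For all $\theta_0,\theta_1\in(-\pi,\pi]$, the process $(S^n_{\lfloor nt\rfloor})_{0\le t\le 1}$ converges in distribution, in the space of càdlàg paths $[0,1]\to\mathbb{S}^1$ with the Skorokhod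 ($J_1$) metric, to $S(t)=e^{iB(t)/\sqrt b}$, where $B$ is a standard one-dimensional Brownian motion started from a point $B(0)$ with $e^{iB(0)/\sqrt b}=e^{i\theta_0}$ and conditioned on $e^{iB(1)/\sqrt b}=e^{i\theta_1}$. The conditional law of $S$ is understood as the weak limit, as $\varepsilon\downarrow0$, of the laws of $(e^{iB(t)/\sqrt b})_{0\le t\le1}$ given the events $\{|e^{iB(1)/\sqrt b}-e^{i\theta_1}|<\varepsilon\}$, and part of the claim is that this limit exists. (2) For all $\theta_0,\theta_1,\theta_0',\theta_1'\in(-\pi,\pi]$, as $n\to\infty$, $$\frac{Z_{G_n}(\theta_0,\theta_1)}{Z_{G_n}(\theta_0',\theta_1')}\longrightarrow\frac{\sum_{m\in\mathbb{Z}}\exp\left(-\frac{b}{2}(\theta_1-\theta_0+2\pi m)^2\right)}{\sum_{m\in\mathbb{Z}}\exp\left(-\frac{b}{2}(\theta_1'-\theta_0'+2\pi m)^2\right)}.$$ -/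

import Mathlib

open MeasureTheory ProbabilityTheory Filter Topology

noncomputable section

namespace XYChain

/-! ### The Skorokhod space of càdlàg paths -/

/-- A path on `[0,1]` is càdlàg if it is right-continuous and has left limits. -/
def IsCadlag {E : Type*} [TopologicalSpace E] (f : unitInterval → E) : Prop :=
  ∀ t, ContinuousWithinAt f (Set.Ici t) t ∧ ∃ l, Tendsto f (𝓝[<] t) (𝓝 l)

/-- The space `D([0,1], E)` of càdlàg paths. -/
def SkorokhodSpace (E : Type*) [TopologicalSpace E] : Type _ :=
  {f : unitInterval → E // IsCadlag f}

instance {E : Type*} [TopologicalSpace E] :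
    CoeFun (SkorokhodSpace E) (fun _ => unitInterval → E) := ⟨Subtype.val⟩

/-- The Skorokhod (J1) distance
`inf_λ max (sup_t |λ t - t|) (sup_t d(x t, y (λ t)))`, the infimum being over all increasing
bijections `λ` of `[0,1]`. -/
instance {E : Type*} [PseudoEMetricSpace E] : PseudoEMetricSpace (SkorokhodSpace E) where
  edist x y := ⨅ l : unitInterval ≃o unitInterval,
    max (⨆ t, edist (l t) t) (⨆ t, edist (x t) (y (l t)))
  edist_self x := by
    refine le_antisymm (iInf_le_of_le (OrderIso.refl _) ?_) zero_le
    simp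
  edist_comm x y := by
    have key : ∀ x y : SkorokhodSpace E,
        (⨅ l : unitInterval ≃o unitInterval,
          max (⨆ t, edist (l t) t) (⨆ t, edist (x t) (y (l t)))) ≤
        ⨅ l : unitInterval ≃o unitInterval,
          max (⨆ t, edist (l t) t) (⨆ t, edist (y t) (x (l t))) := by
      intro x y
      refine le_iInf fun l => iInf_le_of_le l.symm (max_le_max ?_ ?_)
      · refine iSup_le fun t => le_iSup_of_le (l.symm t) ?_
        rw [OrderIso.apply_symm_apply, edist_comm]
      · refine iSup_le fun t => le_iSup_of_le (l.symm t) ?_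
        rw [OrderIso.apply_symm_apply, edist_comm]
    exact le_antisymm (key x y) (key y x)
  edist_triangle x y z := by
    simp only [ENNReal.iInf_add, ENNReal.add_iInf]
    refine le_iInf fun m => le_iInf fun l => iInf_le_of_le (l.trans m) (max_le ?_ ?_)
    · refine iSup_le fun t => ?_
      calc edist ((l.trans m) t) t ≤ edist (m (l t)) (l t) + edist (l t) t := edist_triangle _ _ _
        _ = edist (l t) t + edist (m (l t)) (l t) := add_comm _ _
        _ ≤ max (⨆ t, edist (l t) t) (⨆ t, edist (x t) (y (l t))) +
            max (⨆ t, edist (m t) t) (⨆ t, edist (y t) (z (m t))) :=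
          add_le_add ((le_iSup (fun t => edist (l t) t) t).trans (le_max_left _ _))
            ((le_iSup (fun t => edist (m t) t) (l t)).trans (le_max_left _ _))
    · refine iSup_le fun t => ?_
      calc edist (x t) (z ((l.trans m) t))
          ≤ edist (x t) (y (l t)) + edist (y (l t)) (z (m (l t))) := edist_triangle _ _ _
        _ ≤ _ := add_le_add
            ((le_iSup (fun t => edist (x t) (y (l t))) t).trans (le_max_right _ _))
            ((le_iSup (fun t => edist (y t) (z (m t))) (l t)).trans (le_max_right _ _))

instance {E : Type*} [PseudoEMetricSpace E] : MeasurableSpace (SkorokhodSpace E) := borel _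

instance {E : Type*} [PseudoEMetricSpace E] : BorelSpace (SkorokhodSpace E) := ⟨rfl⟩

/-! ### The XY chain with Dirichlet boundary condition

The vertex `j / n` of the chain with `n` edges is indexed by `j : Fin (n + 1)`. -/

/-- The Hamiltonian of the chain, as a function of the angles of the spins. -/
def hamiltonian (n : ℕ) (θ : Fin (n + 1) → ℝ) : ℝ :=
  -∑ j : Fin n, Real.cos (θ j.castSucc - θ j.succ)

/-- The reference measure at a vertex: a point mass at the two ends, Lebesgue measure on
`(-π, π]` at the interior vertices. -/
def siteMeasure (n : ℕ) (θ₀ θ₁ : ℝ) (j : Fin (n + 1)) : Measure ℝ :=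
  if j = 0 then Measure.dirac θ₀
  else if j = Fin.last n then Measure.dirac θ₁
  else volume.restrict (Set.Ioc (-Real.pi) Real.pi)

instance (n : ℕ) (θ₀ θ₁ : ℝ) (j : Fin (n + 1)) : IsFiniteMeasure (siteMeasure n θ₀ θ₁ j) := by
  unfold siteMeasure
  split_ifs <;> infer_instance

/-- The product reference measure `∏ dθ_i δ(θ_0 = θ₀) δ(θ_n = θ₁)`. -/
def referenceMeasure (n : ℕ) (θ₀ θ₁ : ℝ) : Measure (Fin (n + 1) → ℝ) :=
  Measure.pi (siteMeasure n θ₀ θ₁)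

/-- The partition function at inverse temperature `β`. -/
def partitionFunction (n : ℕ) (β θ₀ θ₁ : ℝ) : ℝ :=
  ∫ θ, Real.exp (-β * hamiltonian n θ) ∂referenceMeasure n θ₀ θ₁

/-- The Gibbs measure of the chain at inverse temperature `β`. -/
def gibbsMeasure (n : ℕ) (β θ₀ θ₁ : ℝ) : Measure (Fin (n + 1) → ℝ) :=
  (referenceMeasure n θ₀ θ₁).withDensity fun θ =>
    ENNReal.ofReal (Real.exp (-β * hamiltonian n θ) / partitionFunction n β θ₀ θ₁)

instance (n : ℕ) (θ₀ θ₁ : ℝ) : IsFiniteMeasure (referenceMeasure n θ₀ θ₁) := by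
  unfold referenceMeasure
  infer_instance

lemma siteMeasure_ne_zero (n : ℕ) (θ₀ θ₁ : ℝ) (j : Fin (n + 1)) :
    siteMeasure n θ₀ θ₁ j ≠ 0 := by
  unfold siteMeasure
  split_ifs
  · exact NeZero.ne _
  · exact NeZero.ne _
  · rw [Ne, Measure.restrict_eq_zero, Real.volume_Ioc, ENNReal.ofReal_eq_zero, not_le]
    linarith [Real.pi_pos]

instance (n : ℕ) (θ₀ θ₁ : ℝ) : NeZero (referenceMeasure n θ₀ θ₁) := by
  refine ⟨fun h => ?_⟩
  have h1 : referenceMeasure n θ₀ θ₁ Set.univ = 0 := by rw [h]; rfl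
  rw [referenceMeasure, Measure.pi_univ, Finset.prod_eq_zero_iff] at h1
  obtain ⟨j, -, hj⟩ := h1
  exact siteMeasure_ne_zero n θ₀ θ₁ j (Measure.measure_univ_eq_zero.1 hj)

lemma integrable_exp_hamiltonian (n : ℕ) (β θ₀ θ₁ : ℝ) :
    Integrable (fun θ => Real.exp (-β * hamiltonian n θ)) (referenceMeasure n θ₀ θ₁) := by
  refine Integrable.of_bound (C := Real.exp (|β| * n)) ?_ (ae_of_all _ fun θ => ?_)
  · refine Continuous.aestronglyMeasurable ?_
    unfold hamiltonian
    fun_prop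
  · rw [Real.norm_eq_abs, Real.abs_exp, Real.exp_le_exp]
    refine (le_abs_self _).trans ?_
    rw [abs_mul, abs_neg]
    refine mul_le_mul_of_nonneg_left ?_ (abs_nonneg _)
    rw [hamiltonian, abs_neg]
    refine (Finset.abs_sum_le_sum_abs _ _).trans ?_
    refine (Finset.sum_le_sum fun j _ => Real.abs_cos_le_one _).trans ?_
    simp

instance (n : ℕ) (β θ₀ θ₁ : ℝ) : IsProbabilityMeasure (gibbsMeasure n β θ₀ θ₁) :=
  isProbabilityMeasure_tilted (integrable_exp_hamiltonian n β θ₀ θ₁)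

lemma floor_lt (n : ℕ) (t : unitInterval) : ⌊(n : ℝ) * t⌋₊ < n + 1 := by
  rw [Nat.lt_succ_iff]
  exact Nat.floor_le_of_le (mul_le_of_le_one_right (Nat.cast_nonneg n) t.2.2)

lemma isCadlag_step {E : Type*} [TopologicalSpace E] (n : ℕ) (g : Fin (n + 1) → E) :
    IsCadlag fun t : unitInterval => g ⟨⌊(n : ℝ) * t⌋₊, floor_lt n t⟩ := by
  intro t
  have hc : Continuous fun s : unitInterval => (n : ℝ) * (s : ℝ) := by fun_prop
  have hn : (0 : ℝ) ≤ n := Nat.cast_nonneg n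
  refine ⟨?_, ?_⟩
  · refine Tendsto.congr' ?_ tendsto_const_nhds
    have h1 : ∀ᶠ s : unitInterval in 𝓝[≥] t, (n : ℝ) * s < ⌊(n : ℝ) * t⌋₊ + 1 :=
      (hc.continuousAt.eventually_lt continuousAt_const
        (Nat.lt_floor_add_one _)).filter_mono nhdsWithin_le_nhds
    filter_upwards [h1, self_mem_nhdsWithin] with s hs hst
    congr 2
    refine ((Nat.floor_eq_iff (mul_nonneg hn s.2.1)).2 ⟨?_, hs⟩).symm
    exact (Nat.floor_le (mul_nonneg hn t.2.1)).trans (mul_le_mul_of_nonneg_left hst hn)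
  · refine ⟨g ⟨⌈(n : ℝ) * t⌉₊ - 1, ?_⟩, Tendsto.congr' ?_ tendsto_const_nhds⟩
    · have : ⌈(n : ℝ) * t⌉₊ ≤ n := Nat.ceil_le.2 (mul_le_of_le_one_right hn t.2.2)
      omega
    · have h1 : ∀ᶠ s : unitInterval in 𝓝[<] t, (⌈(n : ℝ) * t⌉₊ : ℝ) - 1 < n * s := by
        refine (continuousAt_const.eventually_lt hc.continuousAt ?_).filter_mono
          nhdsWithin_le_nhds
        linarith [Nat.ceil_lt_add_one (mul_nonneg hn t.2.1)]
      filter_upwards [h1, self_mem_nhdsWithin] with s hs hst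
      have hst' : (s : ℝ) < t := hst
      congr 2
      refine ((Nat.floor_eq_iff (mul_nonneg hn s.2.1)).2 ?_).symm
      rcases Nat.eq_zero_or_pos n with rfl | hpos
      · simp
      · have h2 : (n : ℝ) * s < n * t := mul_lt_mul_of_pos_left hst' (Nat.cast_pos.2 hpos)
        have h3 : 0 < ⌈(n : ℝ) * t⌉₊ :=
          Nat.ceil_pos.2 ((mul_nonneg hn s.2.1).trans_lt h2)
        rw [Nat.cast_sub h3, Nat.cast_one]
        refine ⟨hs.le, ?_⟩
        linarith [Nat.le_ceil ((n : ℝ) * t)]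

/-- The rescaled path `t ↦ S_{[nt]}` of the chain, where the spin at a vertex with angle `θ_j`
is `exp (i θ_j)`. -/
def spinPath (n : ℕ) (θ : Fin (n + 1) → ℝ) : SkorokhodSpace Circle :=
  ⟨fun t => Circle.exp (θ ⟨⌊(n : ℝ) * t⌋₊, floor_lt n t⟩),
    isCadlag_step n fun j => Circle.exp (θ j)⟩

/-! ### Conditioning on the value of a random variable -/

/-- `ν` is the law of `X` conditioned on `Y = y` (an event that may have probability zero): the
weak limit, as `ε ↓ 0`, of the conditional laws of `X` given the events `dist Y y < ε`, which
are required to have positive probability. -/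
def IsConditionalLaw {Ω E F : Type*} [MeasurableSpace Ω] [TopologicalSpace E] [MeasurableSpace E]
    [PseudoMetricSpace F] (P : Measure Ω) (X : Ω → E) (Y : Ω → F) (y : F)
    (ν : ProbabilityMeasure E) : Prop :=
  AEMeasurable X P ∧
  (∀ ε > (0 : ℝ), P {ω | dist (Y ω) y < ε} ≠ 0) ∧
  ∀ f : BoundedContinuousFunction E ℝ,
    Tendsto (fun ε : ℝ => ∫ ω, f (X ω) ∂(P[|{ω | dist (Y ω) y < ε}])) (𝓝[>] 0)
      (𝓝 (∫ x, f x ∂(ν : Measure E)))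

end XYChain

end

/-!
Under the Gibbs measure the angles form a random walk whose steps have the von Mises law, with
density proportional to `exp (β cos x)`, pinned at both ends modulo `2π`; the partition function is
the density of the walk at the second end. The characters of the circle diagonalise the transition
operators. Integrating by parts, the Fourier coefficients `φ k` of a step satisfy
`(φ k) ^ 2 ≤ 1 / (1 + k ^ 2 / β)` and `β (1 - φ k) → k ^ 2 / 2`, so that, when `l / β` tends to `s`,
the density after `l` steps converges uniformly to the heat kernel of the circle at time `s`. By
Poisson summation this gives the ratios of partition functions, and with the Markov property also
the convergence of the finite-dimensional distributions to those of a Brownian motion on the circle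
pinned at its endpoint.

The limit is realised as a path `θ + w t + r t`, where `r` is a Brownian bridge, independent of the
Gaussian variable `w`. Conditioning the endpoint on the circle only affects `w`, whose conditional
law converges to a Gaussian restricted to the points with the prescribed value modulo `2π`.

For the convergence of paths, `stepPath m` of the chain observed at the times `j / m` is a
continuous function of finitely many spins. Its distance to the chain has a fourth moment at most
`C / m` for large `n`: the fourth moment of an increment over `l` steps is at most
`C (l / n) ^ 2`, and a maximal inequality of chaining type controls the oscillation over a whole
block.
-/

noncomputable section

namespace XYChain

open scoped Real

/-! ### Averaging operators on the circle -/

lemma topologicalClosure_span_eq_top_of_separatesPoints {X : Type*} [TopologicalSpace X]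
    [CompactSpace X] (S : Submonoid C(X, ℂ)) (star_mem : ∀ f ∈ S, star f ∈ S)
    (separates : ∀ x y, x ≠ y → ∃ f ∈ S, f x ≠ f y) :
    (Submodule.span ℂ (S : Set C(X, ℂ))).topologicalClosure = ⊤ := by
  have hadjoin : Subalgebra.toSubmodule (StarAlgebra.adjoin ℂ (S : Set C(X, ℂ))).toSubalgebra =
      Submodule.span ℂ S := by
    have hstar : star (S : Set C(X, ℂ)) ⊆ S := fun f hf => star_star f ▸ star_mem _ hf
    rw [StarAlgebra.adjoin_toSubalgebra, Set.union_eq_self_of_subset_right hstar,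
      Algebra.adjoin_eq_span, Submonoid.closure_eq]
  have hsep : (StarAlgebra.adjoin ℂ (S : Set C(X, ℂ))).SeparatesPoints := fun x y hxy =>
    let ⟨f, hf, hne⟩ := separates x y hxy
    ⟨f, ⟨f, StarAlgebra.subset_adjoin ℂ _ hf, rfl⟩, hne⟩
  rw [← hadjoin]
  exact congr_arg (Subalgebra.toSubmodule <| StarSubalgebra.toSubalgebra ·)
    (ContinuousMap.starSubalgebra_topologicalClosure_eq_top_of_separatesPoints _ hsep)

lemma tendsto_clm_apply_of_topologicalClosure_span_eq_top {𝕜 E F ι : Type*}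
    [NontriviallyNormedField 𝕜] [NormedAddCommGroup E] [NormedSpace 𝕜 E] [NormedAddCommGroup F]
    [NormedSpace 𝕜 F] {l : Filter ι} {T : ι → E →L[𝕜] F} {T₀ : E →L[𝕜] F} {C : ℝ}
    (hT : ∀ i, ‖T i‖ ≤ C) {s : Set E} (hs : (Submodule.span 𝕜 s).topologicalClosure = ⊤)
    (h : ∀ x ∈ s, Tendsto (fun i => T i x) l (𝓝 (T₀ x))) {f : ι → E} {g : E}
    (hf : Tendsto f l (𝓝 g)) : Tendsto (fun i => T i (f i)) l (𝓝 (T₀ g)) := by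
  have hequi : Equicontinuous ((↑) ∘ T) :=
    ((NormedSpace.equicontinuous_TFAE T).out 1 5 rfl rfl).2 ⟨C, hT⟩
  have hspan : (Submodule.span 𝕜 s : Set E) ⊆ {x | Tendsto (fun i => T i x) l (𝓝 (T₀ x))} := by
    intro x hx
    induction hx using Submodule.span_induction with
    | mem x hx => exact h x hx
    | zero => simp [tendsto_const_nhds]
    | add x y _ _ hx hy => simpa using hx.add hy
    | smul c x _ hx => simpa using hx.const_smul c
  have hg : Tendsto (fun i => T i g) l (𝓝 (T₀ g)) :=
    closure_minimal hspan (hequi.isClosed_setOfPred_tendsto T₀.continuous)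
      (hs ▸ Submodule.mem_top : g ∈ (Submodule.span 𝕜 s).topologicalClosure)
  have hsub : Tendsto (fun i => T i (f i - g)) l (𝓝 0) := by
    refine squeeze_zero_norm (fun i => (T i).le_of_opNorm_le (hT i) (f i - g)) ?_
    simpa using (tendsto_iff_norm_sub_tendsto_zero.1 hf).const_mul C
  simpa using hsub.add hg

/-- The character `z ↦ z ^ k` of the circle. -/
def circleMonomial (k : ℤ) : C(Circle, ℂ) where
  toFun z := ((z ^ k : Circle) : ℂ)
  continuous_toFun := continuous_subtype_val.comp (continuous_zpow k)

@[simp] lemma circleMonomial_apply (k : ℤ) (z : Circle) :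
    circleMonomial k z = ((z ^ k : Circle) : ℂ) := rfl

lemma norm_circleMonomial (k : ℤ) : ‖circleMonomial k‖ = 1 := by
  refine le_antisymm ((ContinuousMap.norm_le _ zero_le_one).2 fun z => (Circle.norm_coe _).le) ?_
  simpa using (circleMonomial k).norm_coe_le_norm 1

lemma circleMonomial_exp (k : ℤ) (x : ℝ) :
    circleMonomial k (Circle.exp x) = Complex.exp (k * x * Complex.I) := by
  simp [← Complex.exp_int_mul, mul_assoc]

lemma integral_circleMonomial_exp (μ : Measure ℝ) (k : ℤ) :
    ∫ u, circleMonomial k (Circle.exp u) ∂μ = charFun μ k := by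
  simp only [circleMonomial_exp, charFun_apply_real, Complex.ofReal_intCast]

lemma circleMonomial_mul_apply (k : ℤ) (z w : Circle) :
    circleMonomial k (z * w) = circleMonomial k z * circleMonomial k w := by
  simp [mul_zpow]

lemma circleMonomial_neg_mul_self (k : ℤ) (z : Circle) :
    circleMonomial (-k) z * circleMonomial k z = 1 := by
  rw [circleMonomial_apply, circleMonomial_apply, ← Circle.coe_mul, zpow_neg, inv_mul_cancel,
    Circle.coe_one]

lemma topologicalClosure_span_range_circleMonomial :
    (Submodule.span ℂ (Set.range circleMonomial)).topologicalClosure = ⊤ := by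
  let S : Submonoid C(Circle, ℂ) :=
    { carrier := Set.range circleMonomial
      one_mem' := ⟨0, by ext z; simp⟩
      mul_mem' := by
        rintro _ _ ⟨k, rfl⟩ ⟨l, rfl⟩
        exact ⟨k + l, by ext z; simp [zpow_add]⟩ }
  refine topologicalClosure_span_eq_top_of_separatesPoints S ?_ fun x y hxy =>
    ⟨_, ⟨1, rfl⟩, by simpa using fun h => hxy (Circle.ext h)⟩
  rintro _ ⟨k, rfl⟩
  exact ⟨-k, by ext z; simp [← Circle.coe_inv_eq_conj]⟩

lemma integrable_circle_exp_mul (f : C(Circle, ℂ)) (μ : Measure ℝ) [IsFiniteMeasure μ]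
    (z : Circle) : Integrable (fun u => f (z * Circle.exp u)) μ :=
  .of_bound (C := ‖f‖) (Continuous.aestronglyMeasurable (by fun_prop))
    (ae_of_all _ fun _ => f.norm_coe_le_norm _)

/-- Averaging a function on the circle over random rotations: `rotAvg μ f z = E f (z e^{iU})`,
where `U` has law `μ`. These are the transfer operators of the chain and of Brownian motion. -/
def rotAvg (μ : Measure ℝ) [IsProbabilityMeasure μ] : C(Circle, ℂ) →L[ℂ] C(Circle, ℂ) :=
  LinearMap.mkContinuous
    { toFun := fun f =>
        { toFun := fun z => ∫ u, f (z * Circle.exp u) ∂μ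
          continuous_toFun := continuous_of_dominated (bound := fun _ => ‖f‖)
            (fun z => (integrable_circle_exp_mul f μ z).1)
            (fun _ => ae_of_all _ fun _ => f.norm_coe_le_norm _) (integrable_const _)
            (ae_of_all _ fun u => by fun_prop) }
      map_add' := fun f g => ContinuousMap.ext fun z =>
        integral_add (integrable_circle_exp_mul f μ z) (integrable_circle_exp_mul g μ z)
      map_smul' := fun a f => ContinuousMap.ext fun z => integral_const_mul a _ } 1 fun f => by
    rw [one_mul]
    refine (ContinuousMap.norm_le _ (norm_nonneg _)).2 fun z => ?_
    exact (norm_integral_le_of_norm_le_const (C := ‖f‖)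
      (ae_of_all _ fun u => f.norm_coe_le_norm _)).trans (by simp)

section rotAvg
variable (μ ν : Measure ℝ) [IsProbabilityMeasure μ] [IsProbabilityMeasure ν]

lemma rotAvg_apply (f : C(Circle, ℂ)) (z : Circle) :
    rotAvg μ f z = ∫ u, f (z * Circle.exp u) ∂μ := rfl

lemma opNorm_rotAvg_le : ‖rotAvg μ‖ ≤ 1 := LinearMap.mkContinuous_norm_le _ zero_le_one _

lemma norm_rotAvg_le (f : C(Circle, ℂ)) : ‖rotAvg μ f‖ ≤ ‖f‖ := by
  simpa using (rotAvg μ).le_of_opNorm_le (opNorm_rotAvg_le μ) f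

lemma rotAvg_circleMonomial (k : ℤ) :
    rotAvg μ (circleMonomial k) = charFun μ k • circleMonomial k := by
  ext z
  simp only [rotAvg_apply, circleMonomial_mul_apply, integral_const_mul,
    integral_circleMonomial_exp, ContinuousMap.smul_apply, smul_eq_mul, mul_comm]

lemma rotAvg_conv (f : C(Circle, ℂ)) : rotAvg (μ ∗ ν) f = rotAvg μ (rotAvg ν f) := by
  ext z
  simp only [rotAvg_apply, integral_conv (integrable_circle_exp_mul f _ z), Circle.exp_add,
    mul_assoc]

lemma rotAvg_dirac_zero (f : C(Circle, ℂ)) : rotAvg (Measure.dirac 0) f = f := by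
  ext z
  simp [rotAvg_apply]

lemma tendsto_rotAvg {ι : Type*} {l : Filter ι} {μ : ι → Measure ℝ}
    [∀ i, IsProbabilityMeasure (μ i)]
    (h : ∀ k : ℤ, Tendsto (fun i => charFun (μ i) k) l (𝓝 (charFun ν k)))
    {f : ι → C(Circle, ℂ)} {g : C(Circle, ℂ)} (hf : Tendsto f l (𝓝 g)) :
    Tendsto (fun i => rotAvg (μ i) (f i)) l (𝓝 (rotAvg ν g)) := by
  refine tendsto_clm_apply_of_topologicalClosure_span_eq_top (fun i => opNorm_rotAvg_le (μ i))
    topologicalClosure_span_range_circleMonomial ?_ hf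
  rintro _ ⟨k, rfl⟩
  simpa only [rotAvg_circleMonomial] using (h k).smul_const _

end rotAvg

/-- The `n`-fold convolution power of a measure on the line, i.e. the law of a random walk after
`n` steps. -/
def convPow (μ : Measure ℝ) : ℕ → Measure ℝ
  | 0 => Measure.dirac 0
  | n + 1 => μ ∗ convPow μ n

section convPow
variable (μ : Measure ℝ) [IsProbabilityMeasure μ]

instance (n : ℕ) : IsProbabilityMeasure (convPow μ n) := by
  induction n with
  | zero => exact inferInstanceAs (IsProbabilityMeasure (Measure.dirac _))
  | succ n ih => exact inferInstanceAs (IsProbabilityMeasure (μ ∗ convPow μ n))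

lemma charFun_convPow (n : ℕ) (t : ℝ) : charFun (convPow μ n) t = charFun μ t ^ n := by
  induction n with
  | zero => simp [convPow]
  | succ n ih => rw [convPow, charFun_conv, ih, pow_succ']

lemma rotAvg_convPow_zero (f : C(Circle, ℂ)) : rotAvg (convPow μ 0) f = f := rotAvg_dirac_zero f

lemma rotAvg_convPow_succ (n : ℕ) (f : C(Circle, ℂ)) :
    rotAvg (convPow μ (n + 1)) f = rotAvg μ (rotAvg (convPow μ n) f) := rotAvg_conv _ _ f

lemma rotAvg_convPow_add (m n : ℕ) (f : C(Circle, ℂ)) :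
    rotAvg (convPow μ (m + n)) f = rotAvg (convPow μ m) (rotAvg (convPow μ n) f) := by
  induction m with
  | zero => rw [zero_add, rotAvg_convPow_zero]
  | succ m ih => rw [Nat.succ_add, rotAvg_convPow_succ, ih, rotAvg_convPow_succ]

end convPow

/-! ### Fourier series on the circle -/

instance : Fact (0 < 2 * π) := ⟨Real.two_pi_pos⟩

/-- Lebesgue measure on the period `(-π, π]` of the angle. -/
abbrev angleMeasure : Measure ℝ := volume.restrict (Set.Ioc (-π) π)

instance : NeZero angleMeasure := by
  refine ⟨?_⟩
  rw [Ne, Measure.restrict_eq_zero, Real.volume_Ioc, ENNReal.ofReal_eq_zero, not_le]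
  linarith [Real.pi_pos]

section angleMeasure
variable {E : Type*} [NormedAddCommGroup E]

lemma integrable_angleMeasure {g : ℝ → E} (hg : Continuous g) : Integrable g angleMeasure :=
  (hg.integrableOn_Icc (a := -π) (b := π)).mono_set Set.Ioc_subset_Icc_self

variable [NormedSpace ℝ E]

lemma integral_angleMeasure (g : ℝ → E) : ∫ x, g x ∂angleMeasure = ∫ x in -π..π, g x :=
  (intervalIntegral.integral_of_le (by linarith [Real.pi_pos])).symm

lemma integral_neg_angleMeasure (g : ℝ → E) :
    ∫ x, g (-x) ∂angleMeasure = ∫ x, g x ∂angleMeasure := by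
  simp only [integral_angleMeasure, intervalIntegral.integral_comp_neg, neg_neg]

lemma integral_add_angleMeasure {g : ℝ → E} (hg : g.Periodic (2 * π)) (u : ℝ) :
    ∫ x, g (x + u) ∂angleMeasure = ∫ x, g x ∂angleMeasure := by
  simp only [integral_angleMeasure, intervalIntegral.integral_comp_add_right]
  convert! hg.intervalIntegral_add_eq (-π + u) (-π) using 2 <;> ring

end angleMeasure

/-- The Fourier coefficients, without the factor `1 / 2π`, of a function of the angle. -/
def angleCoeff (f : ℝ → ℂ) (k : ℤ) : ℂ :=
  ∫ x, circleMonomial (-k) (Circle.exp x) * f x ∂angleMeasure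

lemma angleCoeff_rotAvg (μ : Measure ℝ) [IsProbabilityMeasure μ] (f : C(Circle, ℂ)) (k : ℤ) :
    angleCoeff (fun x => rotAvg μ f (Circle.exp x)) k =
      charFun μ k * angleCoeff (fun x => f (Circle.exp x)) k := by
  set g : C(Circle, ℂ) := circleMonomial (-k) * f
  have hrotate (x u : ℝ) : circleMonomial (-k) (Circle.exp x) * f (Circle.exp x * Circle.exp u) =
      circleMonomial k (Circle.exp u) * g (Circle.exp (x + u)) := by
    rw [Circle.exp_add, ContinuousMap.mul_apply, circleMonomial_mul_apply]
    linear_combination (-circleMonomial (-k) (Circle.exp x) * f (Circle.exp x * Circle.exp u)) *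
      circleMonomial_neg_mul_self k (Circle.exp u)
  have hshift (u : ℝ) :
      ∫ x, g (Circle.exp (x + u)) ∂angleMeasure = ∫ x, g (Circle.exp x) ∂angleMeasure :=
    integral_add_angleMeasure (g := fun x => g (Circle.exp x))
      (fun x => by simp only [Circle.periodic_exp x]) u
  have hswap : Integrable (Function.uncurry fun x u : ℝ =>
      circleMonomial k (Circle.exp u) * g (Circle.exp (x + u))) (angleMeasure.prod μ) :=
    .of_bound (C := ‖circleMonomial k‖ * ‖g‖) (Continuous.aestronglyMeasurable (by fun_prop))
      (ae_of_all _ fun p => norm_mul_le_of_le ((circleMonomial k).norm_coe_le_norm _)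
        (g.norm_coe_le_norm _))
  simp only [angleCoeff, rotAvg_apply, ← integral_const_mul, hrotate]
  rw [integral_integral_swap hswap]
  simp only [integral_const_mul, hshift, integral_mul_const, integral_circleMonomial_exp]
  rfl

/-- The continuous function on the circle with given absolutely summable Fourier coefficients (and
the junk value `0` if they are not summable). -/
def circleSeries (a : ℤ → ℂ) : C(Circle, ℂ) :=
  ∑' k : ℤ, ((2 * π : ℂ)⁻¹ * a k) • circleMonomial k

lemma hasSum_circleSeries {a : ℤ → ℂ} (ha : Summable a) :
    HasSum (fun k : ℤ => ((2 * π : ℂ)⁻¹ * a k) • circleMonomial k) (circleSeries a) := by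
  refine (Summable.of_norm ?_).hasSum
  simpa only [norm_smul, norm_circleMonomial, mul_one] using (ha.mul_left _).norm

lemma fourier_coe_two_pi (k : ℤ) (x : ℝ) :
    fourier k (x : AddCircle (2 * π)) = circleMonomial k (Circle.exp x) := by
  rw [fourier_coe_apply, circleMonomial_exp]
  congr 1
  push_cast
  field_simp

lemma fourierCoeff_lift_eq_angleCoeff {f : ℝ → ℂ} (hp : f.Periodic (2 * π)) (k : ℤ) :
    fourierCoeff hp.lift k = (2 * π : ℂ)⁻¹ * angleCoeff f k := by
  rw [fourierCoeff_eq_intervalIntegral _ k (-π), angleCoeff, integral_angleMeasure,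
    show -π + 2 * π = π by ring, Complex.real_smul]
  simp only [fourier_coe_two_pi, hp.lift_coe, smul_eq_mul, one_div]
  push_cast
  rfl

lemma circleSeries_angleCoeff_exp {f : ℝ → ℂ} (hf : Continuous f) (hp : f.Periodic (2 * π))
    (hs : Summable (angleCoeff f)) (x : ℝ) : circleSeries (angleCoeff f) (Circle.exp x) = f x := by
  let g : C(AddCircle (2 * π), ℂ) := ⟨hp.lift, continuous_coinduced_dom.2 hf⟩
  have hcoeff : fourierCoeff g = fun k => (2 * π : ℂ)⁻¹ * angleCoeff f k :=
    funext (fourierCoeff_lift_eq_angleCoeff hp)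
  have hfourier := has_pointwise_sum_fourier_series_of_summable
    (show Summable (fourierCoeff g) from hcoeff ▸ hs.mul_left _) (x : AddCircle (2 * π))
  have hseries := ContinuousMap.hasSum_apply (hasSum_circleSeries hs) (Circle.exp x)
  simp only [hcoeff, fourier_coe_two_pi] at hfourier
  exact hseries.unique hfourier

lemma circleSeries_angleCoeff (f : C(Circle, ℂ))
    (hs : Summable (angleCoeff fun x => f (Circle.exp x))) :
    circleSeries (angleCoeff fun x => f (Circle.exp x)) = f := by
  ext z
  obtain ⟨x, rfl⟩ := Circle.exp_surjective z
  exact circleSeries_angleCoeff_exp (by fun_prop) (fun x => by simp only [Circle.periodic_exp x])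
    hs x

lemma tendsto_circleSeries {ι : Type*} {l : Filter ι} {a : ι → ℤ → ℂ} {a₀ : ℤ → ℂ} {b : ℤ → ℝ}
    (hb : Summable b) (h : ∀ k, Tendsto (fun i => a i k) l (𝓝 (a₀ k)))
    (hab : ∀ᶠ i in l, ∀ k, ‖a i k‖ ≤ b k) :
    Tendsto (fun i => circleSeries (a i)) l (𝓝 (circleSeries a₀)) := by
  refine tendsto_tsum_of_dominated_convergence (bound := fun k => ‖(2 * π : ℂ)⁻¹‖ * b k)
    (hb.mul_left _) (fun k => ((h k).const_mul _).smul_const _) ?_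
  filter_upwards [hab] with i hi k
  rw [norm_smul, norm_circleMonomial, mul_one, norm_mul]
  exact mul_le_mul_of_nonneg_left (hi k) (norm_nonneg _)

/-! ### The law of one step of the chain -/

/-- The total mass of the weight `exp (β cos x)` on a period. -/
def stepMass (β : ℝ) : ℝ := ∫ x, Real.exp (β * Real.cos x) ∂angleMeasure

/-- The von Mises law on `(-π, π]`, with density proportional to `exp (β cos x)`: the law of the
angle between two neighbouring spins of the free chain. -/
def stepLaw (β : ℝ) : Measure ℝ := angleMeasure.tilted fun x => β * Real.cos x

section stepLaw
variable (β : ℝ)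

instance : IsProbabilityMeasure (stepLaw β) :=
  isProbabilityMeasure_tilted (integrable_angleMeasure (by fun_prop))

lemma integral_stepLaw {E : Type*} [NormedAddCommGroup E] [NormedSpace ℝ E] (g : ℝ → E) :
    ∫ x, g x ∂stepLaw β =
      (stepMass β)⁻¹ • ∫ x, Real.exp (β * Real.cos x) • g x ∂angleMeasure := by
  rw [stepLaw, integral_tilted, ← integral_smul]
  simp only [smul_smul, div_eq_inv_mul, stepMass]

lemma stepMass_pos : 0 < stepMass β := integral_exp_pos (integrable_angleMeasure (by fun_prop))

lemma integral_neg_stepLaw {E : Type*} [NormedAddCommGroup E] [NormedSpace ℝ E] (g : ℝ → E) :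
    ∫ x, g (-x) ∂stepLaw β = ∫ x, g x ∂stepLaw β := by
  simpa only [integral_stepLaw, Real.cos_neg] using congrArg ((stepMass β)⁻¹ • ·)
    (integral_neg_angleMeasure fun x => Real.exp (β * Real.cos x) • g x)

lemma memLp_stepLaw {E : Type*} [NormedAddCommGroup E] [SecondCountableTopology E] {g : ℝ → E}
    (hg : Continuous g) (p : ENNReal) : MemLp g p (stepLaw β) := by
  obtain ⟨C, hC⟩ := (isCompact_Icc (a := -π) (b := π)).exists_bound_of_continuousOn hg.continuousOn
  refine MemLp.of_bound hg.aestronglyMeasurable C ((tilted_absolutelyContinuous _ _).ae_le ?_)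
  filter_upwards [ae_restrict_mem measurableSet_Ioc] with x hx using hC x ⟨hx.1.le, hx.2⟩

lemma integrable_stepLaw {E : Type*} [NormedAddCommGroup E] [SecondCountableTopology E] {g : ℝ → E}
    (hg : Continuous g) : Integrable g (stepLaw β) :=
  memLp_one_iff_integrable.1 (memLp_stepLaw β hg 1)

end stepLaw

lemma stepMass_half_le (β : ℝ) (hβ : 0 ≤ β) :
    Real.exp (β / 2) * stepMass (β / 2) ≤ 2 * stepMass β := by
  -- On a period `1 - cos x ≥ 2 (1 - cos (x / 2))`, and then one substitutes `y = x / 2`.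
  have hcos {x : ℝ} (hx : x ∈ Set.Ioc (-π) π) :
      β / 2 + β / 2 * Real.cos x ≤ β * Real.cos (x / 2) := by
    have h0 : 0 ≤ Real.cos (x / 2) :=
      Real.cos_nonneg_of_mem_Icc ⟨by linarith [hx.1], by linarith [hx.2]⟩
    have hsq : Real.cos x = 2 * Real.cos (x / 2) ^ 2 - 1 := by rw [← Real.cos_two_mul]; ring_nf
    nlinarith [mul_nonneg hβ (mul_nonneg h0 (sub_nonneg.2 (Real.cos_le_one (x / 2))))]
  calc Real.exp (β / 2) * stepMass (β / 2)
      = ∫ x, Real.exp (β / 2 + β / 2 * Real.cos x) ∂angleMeasure := by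
        simp only [stepMass, Real.exp_add, integral_const_mul]
    _ ≤ ∫ x, Real.exp (β * Real.cos (x / 2)) ∂angleMeasure :=
        setIntegral_mono_on (integrable_angleMeasure (by fun_prop))
          (integrable_angleMeasure (by fun_prop)) measurableSet_Ioc
          fun x hx => Real.exp_le_exp.2 (hcos hx)
    _ = 2 * ∫ y in Set.Ioc (-π / 2) (π / 2), Real.exp (β * Real.cos y) := by
        rw [integral_angleMeasure, intervalIntegral.integral_comp_div
          (fun y => Real.exp (β * Real.cos y)) two_ne_zero,
          intervalIntegral.integral_of_le (by linarith [Real.pi_pos]), smul_eq_mul]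
    _ ≤ 2 * stepMass β := by
        refine mul_le_mul_of_nonneg_left (setIntegral_mono_set
          (integrable_angleMeasure (by fun_prop)) (ae_of_all _ fun _ => (Real.exp_pos _).le)
          (Set.Ioc_subset_Ioc ?_ ?_).eventuallyLE) zero_le_two <;> linarith [Real.pi_pos]

lemma integral_one_sub_cos_sq_le {β : ℝ} (hβ : 0 < β) :
    ∫ x, (1 - Real.cos x) ^ 2 ∂stepLaw β ≤ 16 / β ^ 2 := by
  have hpoint (x : ℝ) : Real.exp (β * Real.cos x) * (1 - Real.cos x) ^ 2 ≤
      8 / β ^ 2 * (Real.exp (β / 2) * Real.exp (β / 2 * Real.cos x)) := by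
    set t := β / 2 * (1 - Real.cos x) with ht
    have ht0 : 0 ≤ t := mul_nonneg (by positivity) (sub_nonneg.2 (Real.cos_le_one x))
    calc Real.exp (β * Real.cos x) * (1 - Real.cos x) ^ 2
        = 4 / β ^ 2 * t ^ 2 * Real.exp (β * Real.cos x) := by rw [ht]; field_simp; ring
      _ ≤ 4 / β ^ 2 * (2 * Real.exp t) * Real.exp (β * Real.cos x) := by
        gcongr
        linarith [Real.quadratic_le_exp_of_nonneg ht0]
      _ = 8 / β ^ 2 * (Real.exp (β / 2) * Real.exp (β / 2 * Real.cos x)) := by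
        rw [show 4 / β ^ 2 * (2 * Real.exp t) * Real.exp (β * Real.cos x) =
          8 / β ^ 2 * (Real.exp t * Real.exp (β * Real.cos x)) by ring, ← Real.exp_add,
          ← Real.exp_add, ht]
        ring_nf
  rw [integral_stepLaw, smul_eq_mul, inv_mul_le_iff₀ (stepMass_pos β)]
  calc ∫ x, Real.exp (β * Real.cos x) • (1 - Real.cos x) ^ 2 ∂angleMeasure
      ≤ ∫ x, 8 / β ^ 2 * (Real.exp (β / 2) * Real.exp (β / 2 * Real.cos x)) ∂angleMeasure :=
        integral_mono (integrable_angleMeasure (by fun_prop))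
          (integrable_angleMeasure (by fun_prop)) hpoint
    _ = 8 / β ^ 2 * (Real.exp (β / 2) * stepMass (β / 2)) := by
        simp only [integral_const_mul, stepMass]
    _ ≤ 8 / β ^ 2 * (2 * stepMass β) :=
        mul_le_mul_of_nonneg_left (stepMass_half_le β hβ.le) (by positivity)
    _ = stepMass β * (16 / β ^ 2) := by ring

/-! ### Characteristic function of a step -/

/-- The Fourier coefficients of the law of a step. -/
def stepCoeff (β : ℝ) (k : ℤ) : ℝ := ∫ x, Real.cos (k * x) ∂stepLaw β

lemma charFun_stepLaw (β : ℝ) (k : ℤ) : charFun (stepLaw β) k = stepCoeff β k := by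
  have hsum : charFun (stepLaw β) k + charFun (stepLaw β) k = 2 * stepCoeff β k := by
    calc charFun (stepLaw β) k + charFun (stepLaw β) k
        = ∫ x : ℝ, (Complex.exp (k * x * Complex.I) + Complex.exp (k * (-x) * Complex.I))
            ∂stepLaw β := by
          rw [integral_add (integrable_stepLaw β (by fun_prop))
            (integrable_stepLaw β (by fun_prop))]
          have hneg := integral_neg_stepLaw β fun x : ℝ => Complex.exp (k * x * Complex.I)
          push_cast at hneg
          rw [hneg, charFun_apply_real]
          push_cast
          rfl
      _ = ∫ x : ℝ, 2 * ((Real.cos (k * x) : ℝ) : ℂ) ∂stepLaw β := by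
          push_cast
          simp only [Complex.two_cos, mul_neg, neg_mul]
      _ = 2 * stepCoeff β k := by rw [integral_const_mul, integral_complex_ofReal, stepCoeff]
  linear_combination hsum / 2

lemma abs_stepCoeff_le_one (β : ℝ) (k : ℤ) : |stepCoeff β k| ≤ 1 := by
  simpa [stepCoeff] using norm_integral_le_of_norm_le_const (μ := stepLaw β) (C := 1)
    (f := fun x => Real.cos (k * x)) (ae_of_all _ fun x => Real.abs_cos_le_one (k * x))

lemma one_sub_stepCoeff (β : ℝ) (k : ℤ) :
    1 - stepCoeff β k = ∫ x, (1 - Real.cos (k * x)) ∂stepLaw β := by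
  rw [integral_sub (integrable_const _) (integrable_stepLaw β (by fun_prop))]
  simp [stepCoeff]

-- Integration by parts against the weight `exp (β cos x)`, whose logarithmic derivative is
-- `-β sin x`; the boundary terms vanish because `k` is an integer.
lemma mul_stepCoeff (β : ℝ) (k : ℤ) :
    k * stepCoeff β k = β * ∫ x, Real.sin x * Real.sin (k * x) ∂stepLaw β := by
  have hderiv (x : ℝ) : HasDerivAt (fun x => Real.sin (k * x) * Real.exp (β * Real.cos x))
      (k * (Real.exp (β * Real.cos x) * Real.cos (k * x)) -
        β * (Real.exp (β * Real.cos x) * (Real.sin x * Real.sin (k * x)))) x := by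
    refine (((hasDerivAt_id x).const_mul (k : ℝ)).sin.mul
      ((Real.hasDerivAt_cos x).const_mul β).exp).congr_deriv ?_
    simp only [id, mul_one]
    ring
  have hparts := intervalIntegral.integral_eq_sub_of_hasDerivAt (fun x _ => hderiv x)
    (Continuous.intervalIntegrable (by fun_prop) (-π) π)
  rw [intervalIntegral.integral_sub (Continuous.intervalIntegrable (by fun_prop) _ _)
    (Continuous.intervalIntegrable (by fun_prop) _ _), intervalIntegral.integral_const_mul,
    intervalIntegral.integral_const_mul, ← integral_angleMeasure, ← integral_angleMeasure] at hparts
  simp only [mul_neg, Real.sin_neg, Real.sin_int_mul_pi, neg_zero, zero_mul, sub_zero] at hparts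
  simp only [stepCoeff, integral_stepLaw, smul_eq_mul]
  linear_combination (stepMass β)⁻¹ * hparts

lemma stepCoeff_one (β : ℝ) : stepCoeff β 1 = β * ∫ x, Real.sin x ^ 2 ∂stepLaw β := by
  simpa [sq] using mul_stepCoeff β 1

lemma sq_integral_mul_le {α : Type*} [MeasurableSpace α] {μ : Measure α} {f g : α → ℝ}
    (hf : MemLp f 2 μ) (hg : MemLp g 2 μ) :
    (∫ x, f x * g x ∂μ) ^ 2 ≤ (∫ x, f x ^ 2 ∂μ) * ∫ x, g x ^ 2 ∂μ := by
  have hquad (t : ℝ) : 0 ≤ (∫ x, g x ^ 2 ∂μ) * (t * t) + 2 * (∫ x, f x * g x ∂μ) * t +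
      ∫ x, f x ^ 2 ∂μ := by
    have hInt : ∫ x, (f x + t * g x) ^ 2 ∂μ = (∫ x, g x ^ 2 ∂μ) * (t * t) +
        2 * (∫ x, f x * g x ∂μ) * t + ∫ x, f x ^ 2 ∂μ := by
      have hfg : Integrable (fun x => f x * g x) μ := hf.integrable_mul hg
      rw [← integral_mul_const, ← integral_const_mul, ← integral_mul_const,
        ← integral_add (hg.integrable_sq.mul_const _) ((hfg.const_mul 2).mul_const _)]
      refine Eq.trans ?_ (integral_add ((hg.integrable_sq.mul_const _).add
        ((hfg.const_mul 2).mul_const _)) hf.integrable_sq)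
      congr with x
      ring
    exact hInt ▸ integral_nonneg fun x => sq_nonneg _
  have := discrim_le_zero hquad
  rw [discrim] at this
  linarith

lemma sq_stepCoeff_le (β : ℝ) (k : ℤ) :
    stepCoeff β k ^ 2 ≤ ∫ x, Real.cos (k * x) ^ 2 ∂stepLaw β := by
  simpa [stepCoeff] using sq_integral_mul_le
    (memLp_stepLaw β (g := fun x => Real.cos (k * x)) (by fun_prop) 2) (memLp_const (1 : ℝ))

lemma sq_mul_sq_stepCoeff_le {β : ℝ} (hβ : 0 ≤ β) (k : ℤ) :
    k ^ 2 * stepCoeff β k ^ 2 ≤ β * (1 - stepCoeff β k ^ 2) := by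
  have hcauchy := sq_integral_mul_le (memLp_stepLaw β Real.continuous_sin 2)
    (memLp_stepLaw β (g := fun x => Real.sin (k * x)) (by fun_prop) 2)
  have hsin : ∫ x, Real.sin (k * x) ^ 2 ∂stepLaw β ≤ 1 - stepCoeff β k ^ 2 := by
    simp only [Real.sin_sq]
    rw [integral_sub (integrable_const _) (integrable_stepLaw β (by fun_prop))]
    rw [integral_const, probReal_univ, one_smul]
    exact sub_le_sub_left (sq_stepCoeff_le β k) 1
  calc (k : ℝ) ^ 2 * stepCoeff β k ^ 2
      = β ^ 2 * (∫ x, Real.sin x * Real.sin (k * x) ∂stepLaw β) ^ 2 := by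
        rw [← mul_pow, mul_stepCoeff, mul_pow]
    _ ≤ β ^ 2 * ((∫ x, Real.sin x ^ 2 ∂stepLaw β) * ∫ x, Real.sin (k * x) ^ 2 ∂stepLaw β) := by
        gcongr
    _ = β * (stepCoeff β 1 * ∫ x, Real.sin (k * x) ^ 2 ∂stepLaw β) := by rw [stepCoeff_one]; ring
    _ ≤ β * (1 * (1 - stepCoeff β k ^ 2)) :=
        mul_le_mul_of_nonneg_left (mul_le_mul (abs_le.1 (abs_stepCoeff_le_one β 1)).2 hsin
          (integral_nonneg fun _ => sq_nonneg _) zero_le_one) hβ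
    _ = β * (1 - stepCoeff β k ^ 2) := by rw [one_mul]

lemma abs_stepCoeff_pow_le {β : ℝ} (hβ : 0 < β) (k : ℤ) (l : ℕ) :
    |stepCoeff β k ^ l| ≤ (1 + (l / 2 : ℕ) / β * k ^ 2)⁻¹ := by
  have hsq : stepCoeff β k ^ 2 ≤ (1 + k ^ 2 / β)⁻¹ := by
    rw [← one_div, le_div_iff₀ (by positivity)]
    have := sq_mul_sq_stepCoeff_le hβ.le k
    field_simp
    linarith
  calc |stepCoeff β k ^ l| = |stepCoeff β k| ^ l := abs_pow _ _
    _ ≤ |stepCoeff β k| ^ (2 * (l / 2)) :=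
        pow_le_pow_of_le_one (abs_nonneg _) (abs_stepCoeff_le_one β k) (Nat.mul_div_le l 2)
    _ = (stepCoeff β k ^ 2) ^ (l / 2) := by rw [pow_mul, sq_abs]
    _ ≤ ((1 + k ^ 2 / β)⁻¹) ^ (l / 2) := by gcongr
    _ ≤ (1 + (l / 2 : ℕ) / β * k ^ 2)⁻¹ := by
        rw [inv_pow]
        refine inv_anti₀ (by positivity) ((le_of_eq ?_).trans
          (one_add_mul_le_pow (a := k ^ 2 / β) ?_ (l / 2)))
        · ring
        · linarith [show (0 : ℝ) ≤ k ^ 2 / β by positivity]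

lemma one_sub_cos_int_mul_le (k : ℤ) (x : ℝ) :
    1 - Real.cos (k * x) ≤ k ^ 2 * (1 - Real.cos x) := by
  have hsin (y : ℝ) : 1 - Real.cos y = 2 * Real.sin (y / 2) ^ 2 := by
    rw [Real.sin_sq_eq_half_sub]; ring_nf
  have hnat (n : ℕ) (y : ℝ) : |Real.sin (n * y)| ≤ n * |Real.sin y| := by
    induction n with
    | zero => simp
    | succ n ih =>
      calc |Real.sin ((n + 1 : ℕ) * y)|
          = |Real.sin (n * y) * Real.cos y + Real.cos (n * y) * Real.sin y| := by
            rw [← Real.sin_add]; push_cast; ring_nf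
        _ ≤ |Real.sin (n * y)| * |Real.cos y| + |Real.cos (n * y)| * |Real.sin y| := by
            rw [← abs_mul, ← abs_mul]; exact abs_add_le _ _
        _ ≤ |Real.sin (n * y)| * 1 + 1 * |Real.sin y| := by
            gcongr <;> exact Real.abs_cos_le_one _
        _ ≤ (n + 1 : ℕ) * |Real.sin y| := by push_cast; linarith
  have hInt : |Real.sin (k * (x / 2))| ≤ |(k : ℝ)| * |Real.sin (x / 2)| := by
    obtain ⟨n, rfl | rfl⟩ := k.eq_nat_or_neg <;> simpa using hnat n (x / 2)
  rw [hsin, hsin, mul_div_assoc]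
  have := pow_le_pow_left₀ (abs_nonneg _) hInt 2
  rw [mul_pow, sq_abs, sq_abs, sq_abs] at this
  linarith

lemma mul_one_sub_stepCoeff_le {β : ℝ} (hβ : 0 < β) (k : ℤ) :
    β * (1 - stepCoeff β k) ≤ k ^ 2 * (1 / 2 + 8 / β) := by
  have hone : β * (1 - stepCoeff β 1) ≤ 1 / 2 + 8 / β := by
    have hsin : ∫ x, Real.sin x ^ 2 ∂stepLaw β =
        2 * (1 - stepCoeff β 1) - ∫ x, (1 - Real.cos x) ^ 2 ∂stepLaw β := by
      rw [one_sub_stepCoeff, ← integral_const_mul, ← integral_sub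
        (integrable_stepLaw β (by fun_prop)) (integrable_stepLaw β (by fun_prop))]
      congr with x
      rw [Real.sin_sq, Int.cast_one, one_mul]
      ring
    have hfourth : β * ∫ x, (1 - Real.cos x) ^ 2 ∂stepLaw β ≤ 16 / β := by
      refine (mul_le_mul_of_nonneg_left (integral_one_sub_cos_sq_le hβ) hβ.le).trans_eq ?_
      field_simp
    have heq := stepCoeff_one β
    rw [hsin, mul_sub] at heq
    have : 16 / β = 2 * (8 / β) := by ring
    linarith [(abs_le.1 (abs_stepCoeff_le_one β 1)).2]
  calc β * (1 - stepCoeff β k) ≤ β * (k ^ 2 * (1 - stepCoeff β 1)) := by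
        gcongr
        rw [one_sub_stepCoeff, one_sub_stepCoeff, ← integral_const_mul]
        refine integral_mono (integrable_stepLaw β (by fun_prop))
          (integrable_stepLaw β (by fun_prop)) fun x => ?_
        simpa using one_sub_cos_int_mul_le k x
    _ = k ^ 2 * (β * (1 - stepCoeff β 1)) := by ring
    _ ≤ k ^ 2 * (1 / 2 + 8 / β) := by gcongr

lemma tendsto_stepCoeff (k : ℤ) : Tendsto (stepCoeff · k) atTop (𝓝 1) := by
  have hlow : Tendsto (fun β : ℝ => 1 - k ^ 2 * (1 / 2 + 8 / β) / β) atTop (𝓝 1) := by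
    have := ((tendsto_const_nhds (x := (1 / 2 : ℝ)).add
      (tendsto_const_nhds (x := (8 : ℝ)).div_atTop tendsto_id)).const_mul
      ((k : ℝ) ^ 2)).div_atTop tendsto_id
    simpa using tendsto_const_nhds (x := (1 : ℝ)).sub this
  refine tendsto_of_tendsto_of_tendsto_of_le_of_le' hlow tendsto_const_nhds ?_
    (Eventually.of_forall fun β => (abs_le.1 (abs_stepCoeff_le_one β k)).2)
  filter_upwards [eventually_gt_atTop 0] with β hβ
  rw [sub_le_comm, le_div_iff₀ hβ]
  linarith [mul_one_sub_stepCoeff_le hβ k]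

lemma tendsto_mul_one_sub_stepCoeff (k : ℤ) :
    Tendsto (fun β => β * (1 - stepCoeff β k)) atTop (𝓝 (k ^ 2 / 2)) := by
  have hcoeff := tendsto_stepCoeff k
  have hlow : Tendsto (fun β => k ^ 2 * stepCoeff β k ^ 2 / (1 + stepCoeff β k)) atTop
      (𝓝 ((k : ℝ) ^ 2 / 2)) := by
    simpa [one_add_one_eq_two, Pi.div_def] using
      ((hcoeff.pow 2).const_mul ((k : ℝ) ^ 2)).div (hcoeff.const_add 1) (by norm_num)
  have hhigh : Tendsto (fun β : ℝ => (k : ℝ) ^ 2 * (1 / 2 + 8 / β)) atTop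
      (𝓝 ((k : ℝ) ^ 2 / 2)) := by
    simpa only [id, one_div, add_zero, div_eq_mul_inv, one_mul] using
      ((tendsto_const_nhds (x := (8 : ℝ)).div_atTop tendsto_id).const_add (1 / 2 : ℝ)).const_mul
        ((k : ℝ) ^ 2)
  refine tendsto_of_tendsto_of_tendsto_of_le_of_le' hlow hhigh ?_ ?_
  · filter_upwards [eventually_gt_atTop 0, hcoeff.eventually_const_lt one_half_lt_one] with β hβ h
    rw [div_le_iff₀ (by linarith)]
    linarith [sq_mul_sq_stepCoeff_le hβ.le k]
  · filter_upwards [eventually_gt_atTop 0] with β hβ using mul_one_sub_stepCoeff_le hβ k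

section limits
variable {ι : Type*} {𝓕 : Filter ι}

lemma tendsto_one_sub_pow {x : ι → ℝ} {l : ι → ℕ} {c : ℝ} (hx : Tendsto x 𝓕 (𝓝 0))
    (hl : Tendsto (fun i => l i * x i) 𝓕 (𝓝 c)) :
    Tendsto (fun i => (1 - x i) ^ l i) 𝓕 (𝓝 (Real.exp (-c))) := by
  have hlow : Tendsto (fun i => Real.exp (-(l i * x i / (1 - x i)))) 𝓕 (𝓝 (Real.exp (-c))) := by
    refine (Real.continuous_exp.tendsto _).comp ?_
    simpa using (hl.div (tendsto_const_nhds.sub hx) (by norm_num : (1 : ℝ) - 0 ≠ 0)).neg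
  refine tendsto_of_tendsto_of_tendsto_of_le_of_le' hlow
    ((Real.continuous_exp.tendsto _).comp hl.neg) ?_ ?_
  all_goals
    filter_upwards [hx.eventually_lt_const zero_lt_one] with i hi
    have hpos : 0 < 1 - x i := by linarith
  · have hexp : Real.exp (-(x i / (1 - x i))) ≤ 1 - x i := by
      rw [Real.exp_neg, inv_le_comm₀ (Real.exp_pos _) hpos]
      refine (le_of_eq ?_).trans (Real.add_one_le_exp _)
      field_simp
      ring
    calc Real.exp (-(l i * x i / (1 - x i))) = Real.exp (-(x i / (1 - x i))) ^ l i := by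
          rw [← Real.exp_nat_mul]; ring_nf
      _ ≤ (1 - x i) ^ l i := by gcongr
  · calc (1 - x i) ^ l i ≤ Real.exp (-x i) ^ l i := by
          gcongr
          exact Real.one_sub_le_exp_neg _
      _ = Real.exp (-(l i * x i)) := by rw [← Real.exp_nat_mul]; ring_nf

variable {β : ι → ℝ} {l : ι → ℕ} {s : ℝ}

lemma tendsto_stepCoeff_pow (hβ : Tendsto β 𝓕 atTop)
    (hl : Tendsto (fun i => l i / β i) 𝓕 (𝓝 s)) (k : ℤ) :
    Tendsto (fun i => stepCoeff (β i) k ^ l i) 𝓕 (𝓝 (Real.exp (-(k ^ 2 * s / 2)))) := by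
  have hx : Tendsto (fun i => 1 - stepCoeff (β i) k) 𝓕 (𝓝 0) := by
    simpa using ((tendsto_stepCoeff k).comp hβ).const_sub 1
  have hlx : Tendsto (fun i => l i * (1 - stepCoeff (β i) k)) 𝓕 (𝓝 (k ^ 2 * s / 2)) := by
    rw [show (k : ℝ) ^ 2 * s / 2 = s * (k ^ 2 / 2) by ring]
    refine (hl.mul ((tendsto_mul_one_sub_stepCoeff k).comp hβ)).congr' ?_
    filter_upwards [hβ.eventually_gt_atTop 0] with i hi
    simp only [Function.comp]
    field_simp
  simpa using tendsto_one_sub_pow hx hlx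

end limits

/-! ### The local limit theorem -/

lemma summable_inv_one_add_sq {c : ℝ} (hc : 0 < c) :
    Summable fun k : ℤ => (1 + c * (k : ℝ) ^ 2)⁻¹ := by
  refine .of_norm_bounded_eventually ((Real.summable_one_div_int_pow.2 one_lt_two).mul_left c⁻¹) ?_
  filter_upwards [(Set.finite_singleton (0 : ℤ)).compl_mem_cofinite] with k hk
  have hk0 : (k : ℝ) ≠ 0 := by exact_mod_cast hk
  rw [Real.norm_of_nonneg (by positivity), one_div, ← mul_inv]
  exact inv_anti₀ (by positivity) (by linarith)

/-- The density of a step, as a function on the circle. -/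
def stepDensity (β : ℝ) : C(Circle, ℂ) where
  toFun z := ((Real.exp (β * (z : ℂ).re) / stepMass β : ℝ) : ℂ)
  continuous_toFun := by fun_prop

/-- The density of the position on the circle of the walk with step law `stepLaw β` after `l ≥ 1`
steps. The value at `l = 0` is the junk value `stepDensity β`. -/
def chainKernel (β : ℝ) (l : ℕ) : C(Circle, ℂ) :=
  rotAvg (convPow (stepLaw β) (l - 1)) (stepDensity β)

lemma rotAvg_chainKernel (β : ℝ) (d : ℕ) {l : ℕ} (hl : 1 ≤ l) :
    rotAvg (convPow (stepLaw β) d) (chainKernel β l) = chainKernel β (d + l) := by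
  obtain ⟨l, rfl⟩ := Nat.exists_eq_add_of_le' hl
  exact (rotAvg_convPow_add (stepLaw β) d l (stepDensity β)).symm

lemma norm_chainKernel_anti (β : ℝ) {l m : ℕ} (hl : 1 ≤ l) (hm : l ≤ m) :
    ‖chainKernel β m‖ ≤ ‖chainKernel β l‖ := by
  obtain ⟨d, rfl⟩ := Nat.exists_eq_add_of_le' hm
  rw [← rotAvg_chainKernel β d hl]
  exact norm_rotAvg_le _ _

lemma angleCoeff_stepDensity (β : ℝ) (k : ℤ) :
    angleCoeff (fun x => stepDensity β (Circle.exp x)) k = stepCoeff β k := by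
  have hneg : stepCoeff β k = stepCoeff β (-k) := by simp [stepCoeff]
  rw [hneg, ← charFun_stepLaw, ← integral_circleMonomial_exp, integral_stepLaw, angleCoeff,
    ← integral_smul]
  congr with x
  simp only [stepDensity, ContinuousMap.coe_mk, Circle.coe_exp, Complex.exp_ofReal_mul_I_re,
    Complex.real_smul]
  push_cast
  ring

lemma angleCoeff_chainKernel (β : ℝ) {l : ℕ} (hl : 1 ≤ l) :
    angleCoeff (fun x => chainKernel β l (Circle.exp x)) =
      fun k => ((stepCoeff β k ^ l : ℝ) : ℂ) := by
  ext k
  rw [chainKernel, angleCoeff_rotAvg, charFun_convPow, charFun_stepLaw, angleCoeff_stepDensity,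
    ← pow_succ, Nat.sub_add_cancel hl, Complex.ofReal_pow]

/-- The heat kernel on the circle, i.e. the density of a Gaussian of variance `s` modulo `2π`. -/
def heatKernel (s : ℝ) : C(Circle, ℂ) :=
  circleSeries fun k => (Real.exp (-(k ^ 2 * s / 2)) : ℂ)

lemma summable_heat {s : ℝ} (hs : 0 < s) :
    Summable fun k : ℤ => (Real.exp (-((k : ℝ) ^ 2 * s / 2)) : ℂ) := by
  refine Complex.summable_ofReal.2 (.of_nonneg_of_le (fun k => (Real.exp_pos _).le) (fun k => ?_)
    (summable_inv_one_add_sq (half_pos hs)))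
  rw [Real.exp_neg]
  refine inv_anti₀ (by positivity) ?_
  linarith [Real.add_one_le_exp ((k : ℝ) ^ 2 * s / 2)]

section limits
variable {ι : Type*} {𝓕 : Filter ι} {β : ι → ℝ} {l : ι → ℕ} {s : ℝ}

lemma eventually_lt_half_div (hβ : Tendsto β 𝓕 atTop) (hs : 0 < s)
    (hl : Tendsto (fun i => l i / β i) 𝓕 (𝓝 s)) :
    ∀ᶠ i in 𝓕, 0 < β i ∧ 1 ≤ l i ∧ s / 4 ≤ (l i / 2 : ℕ) / β i := by
  filter_upwards [hβ.eventually_gt_atTop 0, hβ.eventually_ge_atTop (4 / s),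
    hl.eventually_const_lt (show 3 / 4 * s < s by linarith)] with i hpos hlarge hlt
  rw [lt_div_iff₀ hpos] at hlt
  rw [div_le_iff₀ hs] at hlarge
  have hl2 : (l i : ℝ) ≤ 2 * (l i / 2 : ℕ) + 1 := by
    have : l i ≤ 2 * (l i / 2) + 1 := by lia
    exact_mod_cast this
  refine ⟨hpos, ?_, ?_⟩
  · have : (0 : ℝ) < l i := by nlinarith
    exact_mod_cast this
  · rw [le_div_iff₀ hpos]
    nlinarith

theorem tendsto_chainKernel (hβ : Tendsto β 𝓕 atTop) (hs : 0 < s)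
    (hl : Tendsto (fun i => l i / β i) 𝓕 (𝓝 s)) :
    Tendsto (fun i => chainKernel (β i) (l i)) 𝓕 (𝓝 (heatKernel s)) := by
  have hsum := summable_inv_one_add_sq (show 0 < s / 4 by positivity)
  have hbound : ∀ᶠ i in 𝓕, ∀ k : ℤ,
      ‖((stepCoeff (β i) k ^ l i : ℝ) : ℂ)‖ ≤ (1 + s / 4 * (k : ℝ) ^ 2)⁻¹ := by
    filter_upwards [eventually_lt_half_div hβ hs hl] with i ⟨hpos, _, hle⟩ k
    rw [Complex.norm_real]
    refine (abs_stepCoeff_pow_le hpos k (l i)).trans (inv_anti₀ (by positivity) ?_)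
    gcongr
  refine (tendsto_circleSeries hsum (fun k => (Complex.continuous_ofReal.tendsto _).comp
    (tendsto_stepCoeff_pow hβ hl k)) hbound).congr' ?_
  filter_upwards [eventually_lt_half_div hβ hs hl, hbound] with i ⟨_, hone, _⟩ hb
  simp only [Function.comp]
  rw [← angleCoeff_chainKernel (β i) hone]
  refine circleSeries_angleCoeff _ ?_
  rw [angleCoeff_chainKernel (β i) hone]
  exact .of_norm_bounded hsum hb

end limits

/-! ### The Markov property of the chain -/

@[fun_prop]
lemma continuous_fin_cons {X : Type*} [TopologicalSpace X] {n : ℕ} :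
    Continuous fun p : X × (Fin n → X) => (Fin.cons p.1 p.2 : Fin (n + 1) → X) :=
  continuous_pi fun i => i.cases (by simpa using continuous_fst) fun i => by
    simp only [Fin.cons_succ]; fun_prop

lemma continuous_fin_cons_left {X : Type*} [TopologicalSpace X] {n : ℕ} (x : X) :
    Continuous fun θ : Fin n → X => (Fin.cons x θ : Fin (n + 1) → X) :=
  continuous_fin_cons.comp (by fun_prop : Continuous fun θ => (x, θ))

lemma pi_eq_map_cons {X : Type*} [MeasurableSpace X] {n : ℕ} (μ : Fin (n + 1) → Measure X)
    [∀ i, SigmaFinite (μ i)] :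
    Measure.pi μ = ((μ 0).prod (Measure.pi fun j : Fin n => μ j.succ)).map
      fun p => (Fin.cons p.1 p.2 : Fin (n + 1) → X) := by
  rw [← (measurePreserving_piFinSuccAbove μ 0).symm.map_eq]
  congr 1
  ext p i
  cases i using Fin.cases <;> simp

/-- The reference measure without the site at the left end. -/
def tailMeasure (n : ℕ) (y : ℝ) : Measure (Fin (n + 1) → ℝ) :=
  Measure.pi fun j => siteMeasure (n + 1) 0 y j.succ

instance (n : ℕ) (y : ℝ) : IsFiniteMeasure (tailMeasure n y) := by
  unfold tailMeasure
  infer_instance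

lemma referenceMeasure_succ (n : ℕ) (x y : ℝ) :
    referenceMeasure (n + 1) x y =
      (tailMeasure n y).map fun θ => (Fin.cons x θ : Fin (n + 2) → ℝ) := by
  have hleft : siteMeasure (n + 1) x y 0 = Measure.dirac x := if_pos rfl
  have htail (j : Fin (n + 1)) : siteMeasure (n + 1) x y j.succ = siteMeasure (n + 1) 0 y j.succ :=
    by simp only [siteMeasure, Fin.succ_ne_zero, if_false]
  rw [referenceMeasure, pi_eq_map_cons, hleft, Measure.dirac_prod, tailMeasure, ← funext htail,
    Measure.map_map continuous_fin_cons.measurable (by fun_prop)]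
  rfl

lemma tailMeasure_zero (y : ℝ) : tailMeasure 0 y = Measure.dirac fun _ => y := by
  have hsite (j : Fin 1) : siteMeasure 1 0 y j.succ = Measure.dirac y := by
    rw [siteMeasure, if_neg (Fin.succ_ne_zero j), if_pos (Fin.ext (by simp))]
  rw [tailMeasure, funext hsite, pi_eq_map_cons, Measure.pi_of_empty, Measure.dirac_prod_dirac,
    Measure.map_dirac' continuous_fin_cons.measurable]
  congr 1
  ext i
  fin_cases i
  rfl

lemma tailMeasure_succ (n : ℕ) (y : ℝ) :
    tailMeasure (n + 1) y =
      (angleMeasure.prod (tailMeasure n y)).map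
        fun p => (Fin.cons p.1 p.2 : Fin (n + 2) → ℝ) := by
  have hlast (j : Fin (n + 1)) : j.succ.succ = Fin.last (n + 2) ↔ j.succ = Fin.last (n + 1) := by
    simp [Fin.ext_iff]
  have hfirst : (0 : Fin (n + 2)).succ ≠ Fin.last (n + 2) := by simp [Fin.ext_iff]
  rw [tailMeasure, pi_eq_map_cons, tailMeasure]
  simp only [siteMeasure, Fin.succ_ne_zero, if_false, hfirst, hlast]

lemma integral_referenceMeasure_succ (n : ℕ) (x y : ℝ) {E : Type*} [NormedAddCommGroup E]
    [NormedSpace ℝ E] {F : (Fin (n + 3) → ℝ) → E} (hF : Continuous F)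
    (hInt : Integrable F (referenceMeasure (n + 2) x y)) :
    ∫ θ, F θ ∂referenceMeasure (n + 2) x y =
      ∫ u, ∫ θ, F (Fin.cons x θ) ∂referenceMeasure (n + 1) u y ∂angleMeasure := by
  have hFx : Continuous fun θ => F (Fin.cons x θ : Fin (n + 3) → ℝ) :=
    hF.comp (continuous_fin_cons_left x)
  rw [referenceMeasure_succ, tailMeasure_succ] at hInt ⊢
  rw [integrable_map_measure hF.aestronglyMeasurable (by fun_prop)] at hInt
  rw [integral_map (by fun_prop) hF.aestronglyMeasurable]
  change Integrable (fun θ => F (Fin.cons x θ : Fin (n + 3) → ℝ)) _ at hInt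
  rw [integrable_map_measure hFx.aestronglyMeasurable (by fun_prop)] at hInt
  rw [integral_map (by fun_prop) hFx.aestronglyMeasurable]
  refine (integral_prod _ hInt).trans ?_
  congr with u
  rw [referenceMeasure_succ, integral_map (by fun_prop) hFx.aestronglyMeasurable]
  rfl

lemma ae_referenceMeasure_zero_eq (n : ℕ) (x y : ℝ) :
    ∀ᵐ θ ∂referenceMeasure (n + 1) x y, θ 0 = x := by
  rw [referenceMeasure_succ, ae_map_iff (continuous_fin_cons_left x).measurable.aemeasurable
    (measurableSet_eq_fun (by fun_prop) (by fun_prop))]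
  exact ae_of_all _ fun θ => rfl

lemma hamiltonian_cons (n : ℕ) (x : ℝ) (θ : Fin (n + 1) → ℝ) :
    hamiltonian (n + 1) (Fin.cons x θ) = -Real.cos (x - θ 0) + hamiltonian n θ := by
  rw [hamiltonian, Fin.sum_univ_succ, hamiltonian]
  simp only [Fin.castSucc_zero, Fin.cons_zero, Fin.cons_succ, ← Fin.succ_castSucc]
  ring

@[fun_prop]
lemma continuous_hamiltonian (n : ℕ) : Continuous (hamiltonian n) := by
  unfold hamiltonian
  fun_prop

/-- The spins of a configuration, as a sequence with the value `1` after the last vertex. -/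
def spins (n : ℕ) (θ : Fin (n + 1) → ℝ) (j : ℕ) : Circle :=
  if h : j < n + 1 then Circle.exp (θ ⟨j, h⟩) else 1

@[fun_prop]
lemma continuous_spins (n : ℕ) : Continuous (spins n) := by
  refine continuous_pi fun j => ?_
  unfold spins
  split_ifs <;> fun_prop

/-- Prepends a term to a sequence. -/
def consSeq {X : Type*} (z : X) (s : ℕ → X) : ℕ → X
  | 0 => z
  | j + 1 => s j

lemma spins_cons (n : ℕ) (x : ℝ) (θ : Fin (n + 1) → ℝ) :
    spins (n + 1) (Fin.cons x θ) = consSeq (Circle.exp x) (spins n θ) := by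
  funext j
  cases j with
  | zero => simp [spins, consSeq]
  | succ j =>
    simp only [spins, consSeq, Nat.add_lt_add_iff_right]
    split_ifs <;> rfl

/-- The integral of a function of the spins against the unnormalised Gibbs weight of the chain with
`n + 1` edges and boundary values `x`, `y`. -/
def chainInt (n : ℕ) (β x y : ℝ) (G : (ℕ → Circle) → ℂ) : ℂ :=
  ∫ θ, (Real.exp (-β * hamiltonian (n + 1) θ) : ℂ) * G (spins (n + 1) θ)
    ∂referenceMeasure (n + 1) x y

section chainInt
variable (n : ℕ) (β x y : ℝ) {G : (ℕ → Circle) → ℂ}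

lemma integrable_exp_hamiltonian_mul_spins (hG : Continuous G) :
    Integrable (fun θ => (Real.exp (-β * hamiltonian n θ) : ℂ) * G (spins n θ))
      (referenceMeasure n x y) := by
  obtain ⟨C, hC⟩ := isCompact_univ.exists_bound_of_continuousOn hG.continuousOn
  exact (integrable_exp_hamiltonian n β x y).ofReal.mul_bdd
    (hG.comp (continuous_spins n)).aestronglyMeasurable (ae_of_all _ fun θ => hC _ trivial)

lemma chainInt_succ (hG : Continuous G) :
    chainInt (n + 1) β x y G = ∫ u, (Real.exp (β * Real.cos (x - u)) : ℂ) *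
      chainInt n β u y (fun s => G (consSeq (Circle.exp x) s)) ∂angleMeasure := by
  rw [chainInt, integral_referenceMeasure_succ _ _ _ (by fun_prop)
    (integrable_exp_hamiltonian_mul_spins _ _ _ _ hG)]
  congr with u
  rw [chainInt, ← integral_const_mul]
  refine integral_congr_ae ?_
  filter_upwards [ae_referenceMeasure_zero_eq n u y] with θ hθ
  rw [spins_cons, hamiltonian_cons, hθ, ← mul_assoc, ← Complex.ofReal_mul, ← Real.exp_add]
  ring_nf

lemma chainInt_congr {G' : (ℕ → Circle) → ℂ} (h : ∀ s, s 0 = Circle.exp x → G s = G' s) :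
    chainInt n β x y G = chainInt n β x y G' := by
  refine integral_congr_ae ?_
  filter_upwards [ae_referenceMeasure_zero_eq n x y] with θ hθ
  rw [h]
  rw [← hθ]
  rfl

lemma chainInt_const_mul (a : ℂ) (G : (ℕ → Circle) → ℂ) :
    chainInt n β x y (fun s => a * G s) = a * chainInt n β x y G := by
  simp only [chainInt, ← integral_const_mul, mul_left_comm]

lemma integral_exp_mul_cos_sub (f : C(Circle, ℂ)) :
    ∫ u, (Real.exp (β * Real.cos (x - u)) : ℂ) * f (Circle.exp u) ∂angleMeasure =
      stepMass β * rotAvg (stepLaw β) f (Circle.exp x) := by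
  have hper : Function.Periodic
      (fun u => (Real.exp (β * Real.cos (x - u)) : ℂ) * f (Circle.exp u)) (2 * π) := fun u => by
    simp only [Circle.periodic_exp u, ← sub_sub, Real.cos_sub_two_pi]
  rw [← integral_add_angleMeasure hper x, rotAvg_apply, integral_stepLaw, Complex.real_smul,
    ← mul_assoc, ← Complex.ofReal_mul, mul_inv_cancel₀ (stepMass_pos β).ne', Complex.ofReal_one,
    one_mul]
  congr with u
  rw [Complex.real_smul, sub_add_cancel_right, Real.cos_neg, add_comm, Circle.exp_add]

lemma chainInt_shift (hG : Continuous G) {f : C(Circle, ℂ)}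
    (hf : ∀ u, chainInt n β u y G = stepMass β ^ (n + 1) * f (Circle.exp u)) (d : ℕ) :
    chainInt (n + d) β x y (fun s => G fun j => s (d + j)) =
      stepMass β ^ (n + d + 1) * rotAvg (convPow (stepLaw β) d) f (Circle.exp x) := by
  induction d generalizing x with
  | zero => simpa [rotAvg_convPow_zero] using hf x
  | succ d ih =>
    have htail (s : ℕ → Circle) :
        (fun j => consSeq (Circle.exp x) s (d + 1 + j)) = fun j => s (d + j) := by
      funext j
      rw [add_right_comm]
      rfl
    rw [← add_assoc, chainInt_succ _ _ _ _ (by fun_prop)]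
    simp only [htail, ih]
    rw [rotAvg_convPow_succ, pow_succ _ (n + d + 1), mul_assoc, ← integral_exp_mul_cos_sub,
      ← integral_const_mul]
    simp only [mul_left_comm]

end chainInt

/-- The rotation of a function on the circle by `w`. -/
def translate (w : Circle) (f : C(Circle, ℂ)) : C(Circle, ℂ) :=
  f.comp ⟨fun z => z * w⁻¹, by fun_prop⟩

@[simp]
lemma translate_apply (w : Circle) (f : C(Circle, ℂ)) (z : Circle) :
    translate w f z = f (z * w⁻¹) := rfl

lemma rotAvg_translate (μ : Measure ℝ) [IsProbabilityMeasure μ] (w : Circle) (f : C(Circle, ℂ)) :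
    rotAvg μ (translate w f) = translate w (rotAvg μ f) := by
  ext z
  simp only [rotAvg_apply, translate_apply, mul_right_comm]

lemma continuous_translate (w : Circle) : Continuous (translate w) :=
  ContinuousMap.continuous_precomp _

lemma norm_translate_le (w : Circle) (f : C(Circle, ℂ)) : ‖translate w f‖ ≤ ‖f‖ :=
  (ContinuousMap.norm_le _ (norm_nonneg _)).2 fun _ => f.norm_coe_le_norm _

section gibbs
variable (β x y : ℝ)

lemma chainInt_zero_one :
    chainInt 0 β x y (fun _ => 1) =
      stepMass β * translate (Circle.exp y) (chainKernel β 1) (Circle.exp x) := by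
  have henergy : hamiltonian 1 (Fin.cons x fun _ : Fin 1 => y) = -Real.cos (x - y) := by
    simp [hamiltonian]
  have hkernel : translate (Circle.exp y) (chainKernel β 1) (Circle.exp x) =
      ((Real.exp (β * Real.cos (x - y)) / stepMass β : ℝ) : ℂ) := by
    rw [translate_apply, chainKernel, rotAvg_convPow_zero, ← Circle.exp_neg, ← Circle.exp_add,
      ← sub_eq_add_neg, stepDensity]
    simp only [ContinuousMap.coe_mk, Circle.coe_exp, Complex.exp_ofReal_mul_I_re]
  rw [chainInt, referenceMeasure_succ, integral_map (by fun_prop)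
    (Continuous.aestronglyMeasurable (by fun_prop)), tailMeasure_zero, integral_dirac, henergy,
    hkernel, ← Complex.ofReal_mul, mul_div_cancel₀ _ (stepMass_pos β).ne', neg_mul_neg, mul_one]

lemma chainInt_one (n : ℕ) :
    chainInt n β x y (fun _ => 1) =
      stepMass β ^ (n + 1) * translate (Circle.exp y) (chainKernel β (n + 1)) (Circle.exp x) := by
  rw [← rotAvg_chainKernel β n le_rfl, ← rotAvg_translate]
  simpa using chainInt_shift 0 β x y (G := fun _ => 1) (by fun_prop)
    (fun u => by rw [chainInt_zero_one, zero_add, pow_one]) n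

lemma ofReal_partitionFunction_succ (n : ℕ) :
    (partitionFunction (n + 1) β x y : ℂ) =
      stepMass β ^ (n + 1) * translate (Circle.exp y) (chainKernel β (n + 1)) (Circle.exp x) := by
  rw [← chainInt_one, partitionFunction, chainInt]
  simp only [mul_one]
  exact integral_ofReal.symm

lemma integral_gibbsMeasure_spins (n : ℕ) (G : (ℕ → Circle) → ℂ) :
    ∫ θ, G (spins (n + 1) θ) ∂gibbsMeasure (n + 1) β x y =
      chainInt n β x y G / partitionFunction (n + 1) β x y := by
  refine (integral_tilted (fun θ => -β * hamiltonian (n + 1) θ) _).trans ?_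
  rw [chainInt, ← integral_div]
  congr with θ
  rw [Complex.real_smul, Complex.ofReal_div, div_mul_eq_mul_div]
  rfl

end gibbs

/-! ### Finite-dimensional distributions

A list of pairs `(d, H)` encodes an increasing sequence of times, the `d` being its increments,
together with a test function for each of these times. -/

section listVal
variable {T : Type*}

/-- The product of the test functions of a list, evaluated at the values of a path at the times of
the list. -/
def listVal [Add T] : List (T × C(Circle, ℂ)) → (T → Circle) → ℂ
  | [], _ => 1
  | (d, H) :: L, s => H (s d) * listVal L fun t => s (d + t)

/-- The alternating composition of the operators `A` and of the multiplications by the test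
functions. For a Markov process with transition operators `A` it sends a terminal weight to the
weighted expectation of `listVal`, as a function of the starting point. -/
def transfer (A : T → C(Circle, ℂ) →L[ℂ] C(Circle, ℂ)) :
    List (T × C(Circle, ℂ)) → C(Circle, ℂ) →L[ℂ] C(Circle, ℂ)
  | [] => .id ℂ _
  | (d, H) :: L => A d ∘L ContinuousLinearMap.mul ℂ _ H ∘L transfer A L

@[simp]
lemma transfer_nil (A : T → C(Circle, ℂ) →L[ℂ] C(Circle, ℂ)) (g : C(Circle, ℂ)) :
    transfer A [] g = g := rfl

lemma transfer_cons (A : T → C(Circle, ℂ) →L[ℂ] C(Circle, ℂ)) (d : T) (H : C(Circle, ℂ))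
    (L : List (T × C(Circle, ℂ))) (g : C(Circle, ℂ)) :
    transfer A ((d, H) :: L) g = A d (H * transfer A L g) := rfl

/-- The last time of a list. -/
def listTime [AddMonoid T] (L : List (T × C(Circle, ℂ))) : T := (L.map Prod.fst).sum

@[simp]
lemma listTime_nil [AddMonoid T] : listTime ([] : List (T × C(Circle, ℂ))) = 0 := rfl

@[simp]
lemma listTime_cons [AddMonoid T] (d : T) (H : C(Circle, ℂ)) (L : List (T × C(Circle, ℂ))) :
    listTime ((d, H) :: L) = d + listTime L := rfl

@[fun_prop]
lemma continuous_listVal [Add T] (L : List (T × C(Circle, ℂ))) : Continuous (listVal L) := by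
  induction L with
  | nil => exact continuous_const
  | cons p L ih =>
    simp only [listVal]
    fun_prop

end listVal

lemma chainInt_listVal (n : ℕ) (β x y : ℝ) (L : List (ℕ × C(Circle, ℂ))) :
    chainInt (n + listTime L) β x y (listVal L) =
      stepMass β ^ (n + listTime L + 1) *
        transfer (fun d => rotAvg (convPow (stepLaw β) d)) L
          (translate (Circle.exp y) (chainKernel β (n + 1))) (Circle.exp x) := by
  induction L generalizing x with
  | nil => exact chainInt_one β x y n
  | cons p L ih =>
    obtain ⟨d, H⟩ := p
    rw [listTime_cons, add_comm d, ← add_assoc]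
    refine chainInt_shift (n + listTime L) β x y (G := fun s => H (s 0) * listVal L s)
      (by fun_prop) (f := H * transfer (fun d => rotAvg (convPow (stepLaw β) d)) L
        (translate (Circle.exp y) (chainKernel β (n + 1)))) (fun u => ?_) d
    rw [chainInt_congr _ _ _ _ (G' := fun s => H (Circle.exp u) * listVal L s)
      (fun s hs => by rw [hs]), chainInt_const_mul, ih, ContinuousMap.mul_apply]
    ring

theorem integral_listVal_gibbsMeasure {N : ℕ} (β x y : ℝ) (L : List (ℕ × C(Circle, ℂ)))
    (hN : listTime L < N) :
    ∫ θ, listVal L (spins N θ) ∂gibbsMeasure N β x y =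
      transfer (fun d => rotAvg (convPow (stepLaw β) d)) L
          (translate (Circle.exp y) (chainKernel β (N - listTime L))) (Circle.exp x) /
        translate (Circle.exp y) (chainKernel β N) (Circle.exp x) := by
  obtain ⟨n, rfl⟩ := Nat.exists_eq_add_of_lt hN
  have hrest : listTime L + n + 1 - listTime L = n + 1 := by lia
  have hmass : (stepMass β : ℂ) ≠ 0 := by exact_mod_cast (stepMass_pos β).ne'
  rw [integral_gibbsMeasure_spins, ofReal_partitionFunction_succ, hrest, add_comm (listTime L) n,
    chainInt_listVal, mul_div_mul_left _ _ (pow_ne_zero _ hmass)]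

/-! ### Increments of the chain -/

section weightedAvg
variable (μ : Measure ℝ) (ψ f : C(Circle, ℂ))

/-- The average of the rotations of `f` by random angles of law `μ`, weighted by the values of `ψ`
at these angles. -/
def weightedAvg : C(Circle, ℂ) := ∫ v, ψ (Circle.exp v) • translate (Circle.exp (-v)) f ∂μ

lemma norm_smul_translate_le (v : ℝ) :
    ‖ψ (Circle.exp v) • translate (Circle.exp (-v)) f‖ ≤ ‖ψ (Circle.exp v)‖ * ‖f‖ := by
  rw [norm_smul]
  exact mul_le_mul_of_nonneg_left (norm_translate_le _ f) (norm_nonneg _)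

variable [IsFiniteMeasure μ]

lemma integrable_smul_translate :
    Integrable (fun v => ψ (Circle.exp v) • translate (Circle.exp (-v)) f) μ := by
  have hcont : Continuous fun v => translate (Circle.exp (-v)) f :=
    ContinuousMap.continuous_of_continuous_uncurry _ (by
      simp only [Function.uncurry_def, translate_apply]; fun_prop)
  refine Integrable.of_bound (Continuous.aestronglyMeasurable (by fun_prop)) (‖ψ‖ * ‖f‖)
    (ae_of_all _ fun v => (norm_smul_translate_le ψ f v).trans ?_)
  gcongr
  exact ψ.norm_coe_le_norm _

lemma weightedAvg_apply (z : Circle) :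
    weightedAvg μ ψ f z = ∫ v, ψ (Circle.exp v) * f (z * Circle.exp v) ∂μ := by
  rw [weightedAvg, ContinuousMap.integral_apply (integrable_smul_translate μ ψ f)]
  simp [Circle.exp_neg]

lemma rotAvg_weightedAvg (ν : Measure ℝ) [IsProbabilityMeasure ν] :
    rotAvg ν (weightedAvg μ ψ f) = weightedAvg μ ψ (rotAvg ν f) := by
  rw [weightedAvg, ← ContinuousLinearMap.integral_comp_comm _ (integrable_smul_translate μ ψ f)]
  simp only [map_smul, rotAvg_translate, weightedAvg]

lemma norm_weightedAvg_le :
    ‖weightedAvg μ ψ f‖ ≤ (∫ v, ‖ψ (Circle.exp v)‖ ∂μ) * ‖f‖ := by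
  rw [← integral_mul_const]
  exact norm_integral_le_of_norm_le
    ((integrable_circle_exp_mul ψ μ 1).norm.mul_const ‖f‖ |>.congr (by simp))
    (ae_of_all _ (norm_smul_translate_le ψ f))

end weightedAvg

lemma chainInt_increment (n e : ℕ) (β x y : ℝ) (ψ : C(Circle, ℂ)) :
    chainInt (n + e) β x y (fun s => ψ (s e * (s 0)⁻¹)) =
      stepMass β ^ (n + e + 1) * weightedAvg (convPow (stepLaw β) e) ψ
        (translate (Circle.exp y) (chainKernel β (n + 1))) (Circle.exp x) := by
  have hstart (w : ℝ) : chainInt n β w y (fun s => ψ (s 0 * (Circle.exp x)⁻¹)) =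
      stepMass β ^ (n + 1) * (translate (Circle.exp x) ψ *
        translate (Circle.exp y) (chainKernel β (n + 1))) (Circle.exp w) := by
    rw [chainInt_congr n β w y (G' := fun _ => ψ (Circle.exp w * (Circle.exp x)⁻¹) * 1)
      (fun s hs => by rw [hs, mul_one]), chainInt_const_mul, chainInt_one, ContinuousMap.mul_apply,
      translate_apply (Circle.exp x)]
    ring
  rw [chainInt_congr (n + e) β x y (G' := fun s => ψ (s e * (Circle.exp x)⁻¹))
    (fun s hs => by rw [hs])]
  refine (chainInt_shift n β x y (by fun_prop) hstart e).trans ?_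
  simp only [rotAvg_apply, weightedAvg_apply, ContinuousMap.mul_apply, translate_apply,
    mul_comm (Circle.exp x), mul_inv_cancel_right]

theorem norm_integral_increment_gibbsMeasure_le {N d e : ℕ} (β x y : ℝ) (ψ : C(Circle, ℂ))
    (hN : d + e < N) :
    ‖∫ θ, ψ (spins N θ (d + e) * (spins N θ d)⁻¹) ∂gibbsMeasure N β x y‖ ≤
      (∫ v, ‖ψ (Circle.exp v)‖ ∂convPow (stepLaw β) e) * ‖chainKernel β (N - e)‖ /
        ‖translate (Circle.exp y) (chainKernel β N) (Circle.exp x)‖ := by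
  obtain ⟨n, rfl⟩ : ∃ n, N = n + e + d + 1 := ⟨N - (d + e) - 1, by lia⟩
  have hmass : (stepMass β : ℂ) ≠ 0 := by exact_mod_cast (stepMass_pos β).ne'
  have hshift := chainInt_shift (n + e) β x y (G := fun s => ψ (s e * (s 0)⁻¹)) (by fun_prop)
    (fun u => chainInt_increment n e β u y ψ) d
  simp only [add_zero] at hshift
  rw [integral_gibbsMeasure_spins (n := n + e + d) (G := fun s => ψ (s (d + e) * (s d)⁻¹)), hshift,
    ofReal_partitionFunction_succ, mul_div_mul_left _ _ (pow_ne_zero _ hmass), norm_div,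
    rotAvg_weightedAvg, rotAvg_translate, rotAvg_chainKernel β d (by lia),
    show n + e + d + 1 - e = d + (n + 1) by lia]
  gcongr
  exact (ContinuousMap.norm_coe_le_norm _ _).trans ((norm_weightedAvg_le _ _ _).trans
    (mul_le_mul_of_nonneg_left (norm_translate_le _ _) (integral_nonneg fun _ => norm_nonneg _)))

/-- The function `z ↦ |z - 1| ^ 4` on the circle. -/
def chordPow : C(Circle, ℂ) where
  toFun z := ((‖(z : ℂ) - 1‖ ^ 4 : ℝ) : ℂ)
  continuous_toFun := by fun_prop

lemma norm_chordPow_exp (v : ℝ) : ‖chordPow (Circle.exp v)‖ = 4 * (1 - Real.cos v) ^ 2 := by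
  have hsq : ‖(Circle.exp v : ℂ) - 1‖ ^ 2 = 2 - 2 * Real.cos v := by
    rw [← Complex.normSq_eq_norm_sq, Complex.normSq_apply, Circle.coe_exp]
    simp only [Complex.sub_re, Complex.sub_im, Complex.exp_ofReal_mul_I_re,
      Complex.exp_ofReal_mul_I_im, Complex.one_re, Complex.one_im]
    linarith [Real.sin_sq_add_cos_sq v]
  have hpow : ‖(Circle.exp v : ℂ) - 1‖ ^ 4 = (2 - 2 * Real.cos v) ^ 2 := by rw [← hsq]; ring
  rw [chordPow, ContinuousMap.coe_mk, hpow, Complex.norm_real, Real.norm_of_nonneg (sq_nonneg _)]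
  ring

section fourthMoment
variable (β : ℝ) (e : ℕ)

lemma integral_cos_convPow (k : ℤ) :
    ∫ v, Real.cos (k * v) ∂convPow (stepLaw β) e = stepCoeff β k ^ e := by
  have hInt : Integrable (fun v : ℝ => Complex.exp ((k : ℝ) * v * Complex.I))
      (convPow (stepLaw β) e) := by
    refine .of_bound (C := 1) (Continuous.aestronglyMeasurable (by fun_prop))
      (ae_of_all _ fun v => ?_)
    rw [← Complex.ofReal_mul, Complex.norm_exp_ofReal_mul_I]
  calc ∫ v, Real.cos (k * v) ∂convPow (stepLaw β) e
      = ∫ v : ℝ, RCLike.re (Complex.exp ((k : ℝ) * v * Complex.I)) ∂convPow (stepLaw β) e := by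
        simp only [← Complex.ofReal_mul, RCLike.re_eq_complex_re, Complex.exp_ofReal_mul_I_re]
    _ = (charFun (convPow (stepLaw β) e) k).re := by rw [integral_re hInt, charFun_apply_real]; rfl
    _ = stepCoeff β k ^ e := by
        rw [charFun_convPow, charFun_stepLaw, ← Complex.ofReal_pow, Complex.ofReal_re]

lemma integral_chordPow_convPow :
    ∫ v, ‖chordPow (Circle.exp v)‖ ∂convPow (stepLaw β) e =
      6 - 8 * stepCoeff β 1 ^ e + 2 * stepCoeff β 2 ^ e := by
  have hcos (c : ℝ) : Integrable (fun v : ℝ => Real.cos (c * v)) (convPow (stepLaw β) e) :=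
    .of_bound (C := 1) (Continuous.aestronglyMeasurable (by fun_prop))
      (ae_of_all _ fun v => Real.abs_cos_le_one _)
  have hsub : Integrable (fun v : ℝ => 6 - 8 * Real.cos ((1 : ℤ) * v)) (convPow (stepLaw β) e) :=
    (integrable_const _).sub ((hcos _).const_mul _)
  calc ∫ v, ‖chordPow (Circle.exp v)‖ ∂convPow (stepLaw β) e
      = ∫ v, (6 - 8 * Real.cos ((1 : ℤ) * v) + 2 * Real.cos ((2 : ℤ) * v))
          ∂convPow (stepLaw β) e := by
        congr with v
        rw [norm_chordPow_exp, Int.cast_one, one_mul, Int.cast_two, Real.cos_two_mul]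
        ring
    _ = 6 - 8 * stepCoeff β 1 ^ e + 2 * stepCoeff β 2 ^ e := by
        rw [integral_add hsub ((hcos _).const_mul _),
          integral_sub (integrable_const _) ((hcos _).const_mul _), integral_const_mul,
          integral_const_mul, integral_cos_convPow, integral_cos_convPow, integral_const,
          probReal_univ, one_smul]

end fourthMoment

lemma one_sub_pow_le {x : ℝ} (h0 : 0 ≤ x) (h2 : x ≤ 2) (l : ℕ) :
    (1 - x) ^ l ≤ 1 - l * x + l ^ 2 * x ^ 2 / 2 := by
  induction l with
  | zero => simp
  | succ l ih =>
    have hbernoulli := one_add_mul_le_pow (show -2 ≤ -x by linarith) l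
    have := mul_le_mul_of_nonneg_left hbernoulli h0
    rw [← sub_eq_add_neg] at this
    rw [pow_succ]
    push_cast
    linarith [sq_nonneg x]

lemma one_sub_stepCoeff_two_le (β : ℝ) : 1 - stepCoeff β 2 ≤ 4 * (1 - stepCoeff β 1) := by
  rw [one_sub_stepCoeff, one_sub_stepCoeff, ← integral_const_mul]
  refine integral_mono (integrable_stepLaw β (by fun_prop)) (integrable_stepLaw β (by fun_prop))
    fun v => (one_sub_cos_int_mul_le 2 v).trans_eq ?_
  norm_num

lemma sq_one_sub_stepCoeff_one_le {β : ℝ} (hβ : 0 < β) :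
    (1 - stepCoeff β 1) ^ 2 ≤ 16 / β ^ 2 := by
  rw [one_sub_stepCoeff]
  refine le_trans ?_ (integral_one_sub_cos_sq_le hβ)
  simpa using sq_integral_mul_le (memLp_stepLaw β (g := fun v => 1 - Real.cos v) (by fun_prop) 2)
    (memLp_const (1 : ℝ))

lemma stepCoeff_defect_le {β : ℝ} (hβ : 0 < β) :
    8 * (1 - stepCoeff β 1) - 2 * (1 - stepCoeff β 2) ≤ 64 / β ^ 2 := by
  have hone := integral_chordPow_convPow β 1
  rw [convPow, convPow, Measure.conv_dirac_zero] at hone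
  simp only [norm_chordPow_exp, integral_const_mul, pow_one] at hone
  linarith [integral_one_sub_cos_sq_le hβ, show 64 / β ^ 2 = 4 * (16 / β ^ 2) by ring]

lemma integral_chordPow_convPow_le {β : ℝ} (hβ : 0 < β) (e : ℕ) :
    ∫ v, ‖chordPow (Circle.exp v)‖ ∂convPow (stepLaw β) e ≤ 320 * (e / β) ^ 2 := by
  set δ := 1 - stepCoeff β 1 with hδ
  set x := 1 - stepCoeff β 2 with hx
  have hdefect : 8 * δ - 2 * x ≤ 64 / β ^ 2 := stepCoeff_defect_le hβ
  have hδ2 : δ ^ 2 ≤ 16 / β ^ 2 := sq_one_sub_stepCoeff_one_le hβ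
  have hx0 : 0 ≤ x := by linarith [(abs_le.1 (abs_stepCoeff_le_one β 2)).2]
  have hxδ : x ≤ 4 * δ := one_sub_stepCoeff_two_le β
  have hx2 : x ^ 2 ≤ 16 * (16 / β ^ 2) := by nlinarith
  have hpow1 : 1 - e * δ ≤ stepCoeff β 1 ^ e := by
    have hbernoulli := one_add_mul_le_pow
      (show -2 ≤ -δ by linarith [(abs_le.1 (abs_stepCoeff_le_one β 1)).1]) e
    rw [show 1 + -δ = stepCoeff β 1 by rw [hδ]; ring] at hbernoulli
    linarith
  have hpow2 : stepCoeff β 2 ^ e ≤ 1 - e * x + e ^ 2 * x ^ 2 / 2 := by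
    simpa [hx] using one_sub_pow_le hx0 (by linarith [(abs_le.1 (abs_stepCoeff_le_one β 2)).1]) e
  have he : (e : ℝ) ≤ (e : ℝ) ^ 2 := by exact_mod_cast Nat.le_self_pow two_ne_zero e
  calc ∫ v, ‖chordPow (Circle.exp v)‖ ∂convPow (stepLaw β) e
      ≤ e * (8 * δ - 2 * x) + e ^ 2 * x ^ 2 := by rw [integral_chordPow_convPow]; linarith
    _ ≤ e * (64 / β ^ 2) + e ^ 2 * (16 * (16 / β ^ 2)) :=
        add_le_add (mul_le_mul_of_nonneg_left hdefect e.cast_nonneg)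
          (mul_le_mul_of_nonneg_left hx2 (sq_nonneg _))
    _ ≤ e ^ 2 * (64 / β ^ 2) + e ^ 2 * (16 * (16 / β ^ 2)) := by
        linarith [mul_le_mul_of_nonneg_right he (show 0 ≤ 64 / β ^ 2 by positivity)]
    _ = 320 * (e / β) ^ 2 := by field_simp; ring

/-! ### Gaussian densities modulo `2π` -/

/-- The periodisation of the product of a Gaussian density and a function: the density, at the
angle `u`, of the law of a centred Gaussian modulo `2π` weighted by `G`. -/
def wrap (v : NNReal) (G : ℝ → ℂ) (u : ℝ) : ℂ :=
  ∑' m : ℤ, (gaussianPDFReal 0 v (u + 2 * π * m) : ℂ) * G (u + 2 * π * m)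

@[fun_prop]
lemma continuous_gaussianPDFReal (μ : ℝ) (v : NNReal) : Continuous (gaussianPDFReal μ v) := by
  unfold gaussianPDFReal
  fun_prop

section wrap
variable {v : NNReal} {G : ℝ → ℂ} {C : ℝ}

lemma gaussianPDFReal_add_le (hv : v ≠ 0) {R u : ℝ} (hu : |u| ≤ R) (m : ℤ) :
    gaussianPDFReal 0 v (u + 2 * π * m) ≤
      (√(2 * π * v))⁻¹ * Real.exp (R ^ 2 / (2 * v)) * (1 + π ^ 2 / v * (m : ℝ) ^ 2)⁻¹ := by
  have : (0 : ℝ) < v := NNReal.coe_pos.2 (pos_iff_ne_zero.2 hv)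
  have hsq : u ^ 2 ≤ R ^ 2 := sq_le_sq' (abs_le.1 hu).1 (abs_le.1 hu).2
  have hexp : -(u + 2 * π * m - 0) ^ 2 / (2 * v) ≤
      R ^ 2 / (2 * v) + -(π ^ 2 / v * (m : ℝ) ^ 2) := by
    rw [show R ^ 2 / (2 * v) + -(π ^ 2 / v * (m : ℝ) ^ 2) =
      (R ^ 2 - 2 * π ^ 2 * m ^ 2) / (2 * v) by field_simp; ring]
    refine div_le_div_of_nonneg_right ?_ (by positivity)
    nlinarith [sq_nonneg (2 * u + 2 * π * m)]
  rw [gaussianPDFReal, mul_assoc (√(2 * π * v))⁻¹]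
  refine mul_le_mul_of_nonneg_left ?_ (by positivity)
  calc Real.exp (-(u + 2 * π * m - 0) ^ 2 / (2 * v))
      ≤ Real.exp (R ^ 2 / (2 * v) + -(π ^ 2 / v * (m : ℝ) ^ 2)) := Real.exp_le_exp.2 hexp
    _ = Real.exp (R ^ 2 / (2 * v)) * (Real.exp (π ^ 2 / v * (m : ℝ) ^ 2))⁻¹ := by
        rw [Real.exp_add, Real.exp_neg]
    _ ≤ Real.exp (R ^ 2 / (2 * v)) * (1 + π ^ 2 / v * (m : ℝ) ^ 2)⁻¹ := by
        refine mul_le_mul_of_nonneg_left (inv_anti₀ (by positivity) ?_) (Real.exp_pos _).le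
        linarith [Real.add_one_le_exp (π ^ 2 / v * (m : ℝ) ^ 2)]

lemma norm_wrap_term_le (hv : v ≠ 0) (hC : ∀ y, ‖G y‖ ≤ C) {R u : ℝ} (hu : |u| ≤ R) (m : ℤ) :
    ‖(gaussianPDFReal 0 v (u + 2 * π * m) : ℂ) * G (u + 2 * π * m)‖ ≤
      (√(2 * π * v))⁻¹ * Real.exp (R ^ 2 / (2 * v)) * (1 + π ^ 2 / v * (m : ℝ) ^ 2)⁻¹ * C := by
  rw [norm_mul, Complex.norm_real, Real.norm_of_nonneg (gaussianPDFReal_nonneg _ _ _)]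
  exact mul_le_mul (gaussianPDFReal_add_le hv hu m) (hC _) (norm_nonneg _) (by positivity)

lemma summable_wrap_bound (hv : v ≠ 0) (R C : ℝ) :
    Summable fun m : ℤ =>
      (√(2 * π * v))⁻¹ * Real.exp (R ^ 2 / (2 * v)) * (1 + π ^ 2 / v * (m : ℝ) ^ 2)⁻¹ * C := by
  have : (0 : ℝ) < v := NNReal.coe_pos.2 (pos_iff_ne_zero.2 hv)
  exact ((summable_inv_one_add_sq (by positivity)).mul_left _).mul_right _

lemma summable_wrap (hv : v ≠ 0) (hC : ∀ y, ‖G y‖ ≤ C) (u : ℝ) :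
    Summable fun m : ℤ => (gaussianPDFReal 0 v (u + 2 * π * m) : ℂ) * G (u + 2 * π * m) :=
  .of_norm_bounded (summable_wrap_bound hv |u| C) (norm_wrap_term_le hv hC le_rfl)

lemma continuous_wrap (hv : v ≠ 0) (hG : Continuous G) (hC : ∀ y, ‖G y‖ ≤ C) :
    Continuous (wrap v G) := by
  refine continuous_iff_continuousAt.2 fun u => ?_
  have hball : ContinuousOn (wrap v G) (Metric.closedBall 0 (|u| + 1)) := by
    refine continuousOn_tsum (fun m => Continuous.continuousOn (by fun_prop))
      (summable_wrap_bound hv (|u| + 1) C) (fun m x hx => norm_wrap_term_le hv hC ?_ m)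
    simpa using hx
  refine hball.continuousAt (mem_of_superset (Metric.ball_mem_nhds u one_pos) fun x hx => ?_)
  rw [Metric.mem_ball, Real.dist_eq] at hx
  rw [mem_closedBall_zero_iff, Real.norm_eq_abs]
  linarith [abs_sub_abs_le_abs_sub x u]

lemma periodic_wrap : (wrap v G).Periodic (2 * π) := by
  intro u
  rw [wrap, wrap, ← (Equiv.addRight (1 : ℤ)).tsum_eq (fun m : ℤ =>
    (gaussianPDFReal 0 v (u + 2 * π * m) : ℂ) * G (u + 2 * π * m))]
  congr with m
  simp only [Equiv.coe_addRight, Int.cast_add, Int.cast_one]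
  ring_nf

lemma setIntegral_Ioc_zsmul {E : Type*} [NormedAddCommGroup E] [NormedSpace ℝ E] (g : ℝ → E)
    (m : ℤ) :
    ∫ u in Set.Ioc (-π + m • (2 * π)) (-π + (m + 1) • (2 * π)), g u =
      ∫ u, g (u + 2 * π * m) ∂angleMeasure := by
  have hleft : -π + m • (2 * π) = -π + 2 * π * m := by rw [zsmul_eq_mul]; ring
  have hright : -π + (m + 1) • (2 * π) = π + 2 * π * m := by rw [zsmul_eq_mul]; push_cast; ring
  rw [hleft, hright, ← intervalIntegral.integral_of_le (by linarith [Real.pi_pos]),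
    integral_angleMeasure, intervalIntegral.integral_comp_add_right]

lemma hasSum_integral_add_two_pi_mul {E : Type*} [NormedAddCommGroup E] [NormedSpace ℝ E]
    {g : ℝ → E} (hg : Integrable g) :
    HasSum (fun m : ℤ => ∫ u, g (u + 2 * π * m) ∂angleMeasure) (∫ y, g y) := by
  have hsum := hasSum_integral_iUnion (fun m : ℤ => measurableSet_Ioc)
    (Set.pairwise_disjoint_Ioc_add_zsmul (-π) (2 * π)) hg.integrableOn
  rw [iUnion_Ioc_add_zsmul Real.two_pi_pos, setIntegral_univ] at hsum
  simpa only [setIntegral_Ioc_zsmul] using hsum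

lemma integral_eq_integral_tsum {g : ℝ → ℂ} (hg : Integrable g) :
    ∫ y, g y = ∫ u, ∑' m : ℤ, g (u + 2 * π * m) ∂angleMeasure := by
  rw [← (hasSum_integral_add_two_pi_mul hg).tsum_eq, integral_tsum_of_summable_integral_norm
    (fun m => (hg.comp_add_right _).integrableOn) (hasSum_integral_add_two_pi_mul hg.norm).summable]

lemma integral_gaussianReal_eq_wrap (hv : v ≠ 0) (hG : Continuous G) (hC : ∀ y, ‖G y‖ ≤ C)
    {h : ℝ → ℂ} (hm : Measurable h) {C' : ℝ} (hC' : ∀ y, ‖h y‖ ≤ C') (hp : h.Periodic (2 * π)) :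
    ∫ y, h y * G y ∂gaussianReal 0 v = ∫ u, h u * wrap v G u ∂angleMeasure := by
  have hInt : Integrable fun y => (gaussianPDFReal 0 v y : ℂ) * (h y * G y) := by
    refine (integrable_gaussianPDFReal 0 v).ofReal.mul_bdd
      (hm.mul hG.measurable).aestronglyMeasurable (c := C' * C) (ae_of_all _ fun y => ?_)
    rw [norm_mul]
    exact mul_le_mul (hC' y) (hC y) (norm_nonneg _) ((norm_nonneg _).trans (hC' y))
  have hper (u : ℝ) (m : ℤ) : h (u + 2 * π * m) = h u := by
    simpa only [mul_comm (m : ℝ)] using hp.int_mul m u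
  rw [integral_gaussianReal_eq_integral_smul hv]
  refine (integral_eq_integral_tsum hInt).trans ?_
  congr with u
  rw [wrap, ← tsum_mul_left]
  congr with m
  rw [hper]
  ring

lemma angleCoeff_wrap (hv : v ≠ 0) (hG : Continuous G) (hC : ∀ y, ‖G y‖ ≤ C) (k : ℤ) :
    angleCoeff (wrap v G) k = ∫ y, circleMonomial (-k) (Circle.exp y) * G y ∂gaussianReal 0 v :=
  (integral_gaussianReal_eq_wrap hv hG hC (h := fun y => circleMonomial (-k) (Circle.exp y))
    (Continuous.measurable (by fun_prop)) (C' := 1) (fun _ => (Circle.norm_coe _).le)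
    (fun y => by simp only [Circle.periodic_exp y])).symm

lemma charFun_gaussianReal_int (v : NNReal) (k : ℤ) :
    charFun (gaussianReal 0 v) k = (Real.exp (-((k : ℝ) ^ 2 * v / 2)) : ℂ) := by
  rw [charFun_gaussianReal]
  push_cast
  congr 1
  ring

lemma heatKernel_exp (hv : v ≠ 0) (u : ℝ) :
    heatKernel v (Circle.exp u) = wrap v (fun _ => 1) u := by
  have hbound (_ : ℝ) : ‖(1 : ℂ)‖ ≤ 1 := norm_one.le
  have hcoeff : angleCoeff (wrap v fun _ => 1) =
      fun k : ℤ => (Real.exp (-((k : ℝ) ^ 2 * v / 2)) : ℂ) := by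
    funext k
    simp only [angleCoeff_wrap hv continuous_const hbound, mul_one, integral_circleMonomial_exp]
    rw [charFun_gaussianReal_int, Int.cast_neg, neg_sq]
  rw [heatKernel, ← hcoeff]
  refine circleSeries_angleCoeff_exp (continuous_wrap hv continuous_const hbound) periodic_wrap ?_ u
  rw [hcoeff]
  exact summable_heat (NNReal.coe_pos.2 (pos_iff_ne_zero.2 hv))

lemma wrap_one (v : NNReal) (u : ℝ) :
    wrap v (fun _ => 1) u = ((∑' m : ℤ, gaussianPDFReal 0 v (u + 2 * π * m) : ℝ) : ℂ) := by
  rw [wrap, Complex.ofReal_tsum]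
  simp

lemma summable_gaussianPDFReal_wrap (hv : v ≠ 0) (u : ℝ) :
    Summable fun m : ℤ => gaussianPDFReal 0 v (u + 2 * π * m) := by
  have hsum := summable_wrap hv (G := fun _ => 1) (fun _ => norm_one.le) u
  simp only [mul_one] at hsum
  exact Complex.summable_ofReal.1 hsum

lemma tsum_gaussianPDFReal_wrap_pos (hv : v ≠ 0) (u : ℝ) :
    0 < ∑' m : ℤ, gaussianPDFReal 0 v (u + 2 * π * m) :=
  (summable_gaussianPDFReal_wrap hv u).tsum_pos (fun _ => gaussianPDFReal_nonneg _ _ _) 0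
    (gaussianPDFReal_pos _ _ _ hv)

lemma heatKernel_ne_zero (hv : v ≠ 0) (z : Circle) : heatKernel v z ≠ 0 := by
  obtain ⟨u, rfl⟩ := Circle.exp_surjective z
  rw [heatKernel_exp hv, wrap_one]
  exact_mod_cast (tsum_gaussianPDFReal_wrap_pos hv u).ne'

end wrap

lemma tsum_gaussianPDFReal_sub {b : ℝ} {v : NNReal} (hvb : (v : ℝ) = 1 / b) (x y : ℝ) :
    ∑' m : ℤ, gaussianPDFReal 0 v (x - y + 2 * π * m) = (√(2 * π * v))⁻¹ *
      ∑' m : ℤ, Real.exp (-(b / 2) * (y - x + 2 * π * m) ^ 2) := by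
  rw [← tsum_mul_left, ← (Equiv.neg ℤ).tsum_eq]
  congr with m
  have hexp : -(x - y + 2 * π * (-m) - 0) ^ 2 / (2 * (v : ℝ)) =
      -(b / 2) * (y - x + 2 * π * m) ^ 2 := by
    rw [hvb, mul_one_div, div_div_eq_mul_div]
    ring
  rw [gaussianPDFReal, Equiv.neg_apply, Int.cast_neg, hexp]

/-! ### Ratios of partition functions -/

lemma ofReal_partitionFunction_div (γ x y x' y' : ℝ) {n : ℕ} (hn : n ≠ 0) :
    ((partitionFunction n γ x y / partitionFunction n γ x' y' : ℝ) : ℂ) =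
      chainKernel γ n (Circle.exp (x - y)) / chainKernel γ n (Circle.exp (x' - y')) := by
  obtain ⟨n, rfl⟩ := Nat.exists_eq_succ_of_ne_zero hn
  rw [Complex.ofReal_div, ofReal_partitionFunction_succ, ofReal_partitionFunction_succ,
    mul_div_mul_left _ _ (pow_ne_zero _ (by exact_mod_cast (stepMass_pos _).ne'))]
  simp only [translate_apply, Circle.exp_sub, div_eq_mul_inv]

section scaling
variable {b : ℝ} {β : ℕ → ℝ} (hb : 0 < b) (hβ : Tendsto (fun n : ℕ => β n / n) atTop (𝓝 b))
include hb hβ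

lemma tendsto_atTop_of_ratio : Tendsto β atTop atTop := by
  refine (hβ.pos_mul_atTop hb tendsto_natCast_atTop_atTop).congr' ?_
  filter_upwards [eventually_gt_atTop 0] with n hn
  field_simp

lemma tendsto_ratio {l : ℕ → ℕ} {t : ℝ} (hl : Tendsto (fun n : ℕ => (l n : ℝ) / n) atTop (𝓝 t)) :
    Tendsto (fun n => l n / β n) atTop (𝓝 (t / b)) := by
  refine (hl.div hβ hb.ne').congr' ?_
  filter_upwards [eventually_gt_atTop 0] with n hn
  exact div_div_div_cancel_right₀ (by exact_mod_cast hn.ne') _ _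

lemma tendsto_chainKernel_of_ratio {l : ℕ → ℕ} {t : ℝ} (ht : 0 < t)
    (hl : Tendsto (fun n : ℕ => (l n : ℝ) / n) atTop (𝓝 t)) :
    Tendsto (fun n => chainKernel (β n) (l n)) atTop (𝓝 (heatKernel (t / b))) :=
  tendsto_chainKernel (tendsto_atTop_of_ratio hb hβ) (div_pos ht hb) (tendsto_ratio hb hβ hl)

lemma tendsto_chainKernel_self :
    Tendsto (fun n => chainKernel (β n) n) atTop (𝓝 (heatKernel (1 / b))) := by
  refine tendsto_chainKernel_of_ratio hb hβ one_pos (tendsto_const_nhds.congr' ?_)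
  filter_upwards [eventually_gt_atTop 0] with n hn
  rw [div_self (by exact_mod_cast hn.ne')]

theorem tendsto_partitionFunction_ratio (θ₀ θ₁ θ₀' θ₁' : ℝ) :
    Tendsto (fun n : ℕ => partitionFunction n (β n) θ₀ θ₁ / partitionFunction n (β n) θ₀' θ₁')
      atTop (𝓝 ((∑' m : ℤ, Real.exp (-(b / 2) * (θ₁ - θ₀ + 2 * π * m) ^ 2)) /
        ∑' m : ℤ, Real.exp (-(b / 2) * (θ₁' - θ₀' + 2 * π * m) ^ 2))) := by
  obtain ⟨v, hvb⟩ : ∃ v : NNReal, (v : ℝ) = 1 / b := ⟨⟨1 / b, by positivity⟩, rfl⟩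
  have hv : v ≠ 0 := by
    rw [← NNReal.coe_ne_zero, hvb]
    positivity
  have hval (x y : ℝ) : heatKernel (1 / b) (Circle.exp (x - y)) =
      (((√(2 * π * v))⁻¹ *
        ∑' m : ℤ, Real.exp (-(b / 2) * (y - x + 2 * π * m) ^ 2) : ℝ) : ℂ) := by
    rw [← hvb, heatKernel_exp hv, wrap_one, tsum_gaussianPDFReal_sub hvb]
  have hlim (z : Circle) :
      Tendsto (fun n => chainKernel (β n) n z) atTop (𝓝 (heatKernel (1 / b) z)) :=
    ((continuous_eval_const (F := C(Circle, ℂ)) z).tendsto _).comp (tendsto_chainKernel_self hb hβ)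
  have hratio := (hlim (Circle.exp (θ₀ - θ₁))).div (hlim (Circle.exp (θ₀' - θ₁')))
    (hvb ▸ heatKernel_ne_zero hv _)
  rw [hval, hval, ← Complex.ofReal_div, mul_div_mul_left _ _ (by rw [hvb]; positivity)] at hratio
  rw [← Complex.ofReal_re (_ / _)]
  refine ((Complex.continuous_re.tendsto _).comp hratio).congr' ?_
  filter_upwards [eventually_ne_atTop 0] with n hn
  simp only [Function.comp_apply, Pi.div_apply, ← ofReal_partitionFunction_div _ _ _ _ _ hn,
    Complex.ofReal_re]

end scaling

/-! ### A maximal inequality for fourth moments of increments -/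

lemma two_mul_add_pow_four_le (x y : ENNReal) :
    2 * (x + y) ^ 4 ≤ 2 * 11 ^ 4 * x ^ 4 + 3 * y ^ 4 := by
  rcases le_total y (10 * x) with h | h
  · calc 2 * (x + y) ^ 4 ≤ 2 * (x + 10 * x) ^ 4 := by gcongr
      _ = 2 * 11 ^ 4 * x ^ 4 := by ring
      _ ≤ 2 * 11 ^ 4 * x ^ 4 + 3 * y ^ 4 := le_self_add
  · have hten : 10 * (x + y) ≤ 11 * y := by
      calc 10 * (x + y) = 10 * x + 10 * y := by ring
        _ ≤ y + 10 * y := by gcongr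
        _ = 11 * y := by ring
    have hscaled : 10 ^ 4 * (2 * (x + y) ^ 4) ≤ 10 ^ 4 * (3 * y ^ 4) := by
      calc 10 ^ 4 * (2 * (x + y) ^ 4) = 2 * (10 * (x + y)) ^ 4 := by ring
        _ ≤ 2 * (11 * y) ^ 4 := mul_le_mul_right (pow_le_pow_left' hten 4) 2
        _ = (2 * 11 ^ 4) * y ^ 4 := by ring
        _ ≤ (10 ^ 4 * 3) * y ^ 4 := by gcongr ?_ * _; norm_num
        _ = 10 ^ 4 * (3 * y ^ 4) := by ring
    rw [ENNReal.mul_le_mul_iff_right (by positivity) (by finiteness)] at hscaled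
    exact hscaled.trans le_add_self

section maximal
variable {Ω E : Type*} [MeasurableSpace Ω] [PseudoEMetricSpace E] {μ : Measure Ω}

/-- The largest fourth power of an increment, over the first `L` steps from time `a`, of a
sequence. -/
def maxIncrement (Y : ℕ → E) (a L : ℕ) : ENNReal :=
  (Finset.range (L + 1)).sup fun k => edist (Y a) (Y (a + k)) ^ 4

lemma le_maxIncrement (Y : ℕ → E) (a : ℕ) {k L : ℕ} (h : k ≤ L) :
    edist (Y a) (Y (a + k)) ^ 4 ≤ maxIncrement Y a L :=
  Finset.le_sup (f := fun k => edist (Y a) (Y (a + k)) ^ 4)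
    (Finset.mem_range.2 (Nat.lt_succ_of_le h))

lemma maxIncrement_le_of_lt_two (Y : ℕ → E) (a : ℕ) {L : ℕ} (hL : L < 2) :
    maxIncrement Y a L ≤ edist (Y a) (Y (a + L)) ^ 4 := by
  refine Finset.sup_le fun k hk => ?_
  rcases Nat.eq_zero_or_pos k with rfl | hk0
  · simp
  · rw [show k = L by rw [Finset.mem_range] at hk; lia]

lemma two_mul_maxIncrement_add_le (Y : ℕ → E) (a h k : ℕ) :
    2 * maxIncrement Y a (h + k) ≤ 2 * maxIncrement Y a h +
      (2 * 11 ^ 4 * edist (Y a) (Y (a + h)) ^ 4 + 3 * maxIncrement Y (a + h) k) := by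
  obtain ⟨i, hi, hmax⟩ := Finset.exists_mem_eq_sup (Finset.range (h + k + 1))
    Finset.nonempty_range_add_one fun k => edist (Y a) (Y (a + k)) ^ 4
  rw [maxIncrement, hmax]
  rcases le_total i h with hih | hih
  · exact (mul_le_mul_right (le_maxIncrement Y a hih) 2).trans le_self_add
  · obtain ⟨j, rfl⟩ := Nat.exists_eq_add_of_le hih
    refine le_trans ?_ le_add_self
    calc 2 * edist (Y a) (Y (a + (h + j))) ^ 4
        ≤ 2 * (edist (Y a) (Y (a + h)) + edist (Y (a + h)) (Y (a + h + j))) ^ 4 := by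
          rw [add_assoc]
          gcongr
          exact edist_triangle _ _ _
      _ ≤ 2 * 11 ^ 4 * edist (Y a) (Y (a + h)) ^ 4 +
            3 * edist (Y (a + h)) (Y (a + h + j)) ^ 4 := two_mul_add_pow_four_le _ _
      _ ≤ _ := by
          gcongr
          exact le_maxIncrement Y (a + h) (by rw [Finset.mem_range] at hi; lia)

lemma measurable_maxIncrement {Y : Ω → ℕ → E}
    (hY : ∀ i j, Measurable fun ω => edist (Y ω i) (Y ω j)) (a L : ℕ) :
    Measurable fun ω => maxIncrement (Y ω) a L := by
  unfold maxIncrement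
  simp only [← Finset.sup'_eq_sup Finset.nonempty_range_add_one]
  exact Finset.measurable_range_sup'' fun k _ => (hY a (a + k)).pow_const 4

lemma exists_add_eq_four_mul_sq_add_le {L : ℕ} (hL : 2 ≤ L) :
    ∃ h k, L = h + k ∧ h < L ∧ k < L ∧ 4 * h ^ 2 + 3 * k ^ 2 ≤ 2 * (h + k) ^ 2 := by
  refine ⟨L / 2, L - L / 2, by lia, by lia, by lia, ?_⟩
  obtain ⟨r, hr | hr⟩ : ∃ r, L = 2 * r ∨ L = 2 * r + 1 := ⟨L / 2, by lia⟩
  · rw [show L / 2 = r by lia, show L - r = r by lia]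
    nlinarith
  · rw [show L / 2 = r by lia, show L - r = r + 1 by lia]
    nlinarith [show 1 ≤ r by lia]

theorem lintegral_maxIncrement_le {Y : Ω → ℕ → E}
    (hY : ∀ i j, Measurable fun ω => edist (Y ω i) (Y ω j)) {A : ENNReal}
    (hA : ∀ a e : ℕ, ∫⁻ ω, edist (Y ω a) (Y ω (a + e)) ^ 4 ∂μ ≤ A * e ^ 2) (L a : ℕ) :
    ∫⁻ ω, maxIncrement (Y ω) a L ∂μ ≤ 11 ^ 4 * A * L ^ 2 := by
  induction L using Nat.strong_induction_on generalizing a with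
  | _ L ih =>
  rcases Nat.lt_or_ge L 2 with hL | hL
  · refine (lintegral_mono fun ω => maxIncrement_le_of_lt_two (Y ω) a hL).trans ((hA a L).trans ?_)
    gcongr
    exact le_mul_of_one_le_left' (by norm_num)
  · obtain ⟨h, k, rfl, hh, hk, hhk⟩ := exists_add_eq_four_mul_sq_add_le hL
    have hmax := measurable_maxIncrement hY
    rw [← ENNReal.mul_le_mul_iff_right two_ne_zero (by finiteness)]
    calc 2 * ∫⁻ ω, maxIncrement (Y ω) a (h + k) ∂μ
        ≤ 2 * ∫⁻ ω, maxIncrement (Y ω) a h ∂μ +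
            (2 * 11 ^ 4 * ∫⁻ ω, edist (Y ω a) (Y ω (a + h)) ^ 4 ∂μ +
              3 * ∫⁻ ω, maxIncrement (Y ω) (a + h) k ∂μ) := by
          rw [← lintegral_const_mul _ (hmax _ _), ← lintegral_const_mul _ (hmax _ _),
            ← lintegral_const_mul _ (hmax _ _),
            ← lintegral_const_mul _ ((hY _ _).pow_const 4),
            ← lintegral_add_left (((hY _ _).pow_const 4).const_mul _),
            ← lintegral_add_left ((hmax _ _).const_mul _)]
          exact lintegral_mono fun ω => two_mul_maxIncrement_add_le (Y ω) a h k
      _ ≤ 2 * (11 ^ 4 * A * h ^ 2) + (2 * 11 ^ 4 * (A * h ^ 2) + 3 * (11 ^ 4 * A * k ^ 2)) := by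
          gcongr
          exacts [ih h hh a, hA a h, ih k hk (a + h)]
      _ = 11 ^ 4 * A * ((4 * h ^ 2 + 3 * k ^ 2 : ℕ) : ENNReal) := by push_cast; ring
      _ ≤ 11 ^ 4 * A * ((2 * (h + k) ^ 2 : ℕ) : ENNReal) :=
          mul_le_mul_right (by exact_mod_cast hhk) _
      _ = 2 * (11 ^ 4 * A * ((h + k : ℕ) : ENNReal) ^ 2) := by push_cast; ring

end maximal

/-! ### Fourth moments of the increments of the chain -/

lemma norm_chordPow_div (z w : Circle) : ‖chordPow (w * z⁻¹)‖ = dist z w ^ 4 := by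
  have hdist : ‖((w * z⁻¹ : Circle) : ℂ) - 1‖ = dist z w := by
    have hfactor : ((w * z⁻¹ : Circle) : ℂ) - 1 = (w - z) * (z : ℂ)⁻¹ := by
      rw [Circle.coe_mul, Circle.coe_inv, sub_mul, mul_inv_cancel₀ z.coe_ne_zero]
    rw [hfactor, norm_mul, norm_inv, Circle.norm_coe, inv_one, mul_one, dist_comm]
    exact (Complex.dist_eq _ _).symm
  simp [chordPow, ← hdist]

lemma norm_chordPow_le (z : Circle) : ‖chordPow z‖ ≤ 16 := by
  obtain ⟨v, rfl⟩ := Circle.exp_surjective z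
  rw [norm_chordPow_exp]
  nlinarith [Real.cos_le_one v, Real.neg_one_le_cos v]

lemma lintegral_edist_spins_pow_four (N : ℕ) (β x y : ℝ) (i j : ℕ) :
    ∫⁻ θ, edist (spins N θ i) (spins N θ j) ^ 4 ∂gibbsMeasure N β x y = ENNReal.ofReal
      ‖∫ θ, chordPow (spins N θ j * (spins N θ i)⁻¹) ∂gibbsMeasure N β x y‖ := by
  have hcont : Continuous fun θ => chordPow (spins N θ j * (spins N θ i)⁻¹) := by fun_prop
  have hreal : ∫ θ, chordPow (spins N θ j * (spins N θ i)⁻¹) ∂gibbsMeasure N β x y =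
      ((∫ θ, ‖chordPow (spins N θ j * (spins N θ i)⁻¹)‖ ∂gibbsMeasure N β x y : ℝ) : ℂ) := by
    refine Eq.trans ?_ integral_ofReal
    congr with θ
    simp [chordPow]
  rw [hreal, Complex.norm_real, Real.norm_of_nonneg (integral_nonneg fun _ => norm_nonneg _),
    ofReal_integral_eq_lintegral_ofReal _ (ae_of_all _ fun _ => norm_nonneg _)]
  · simp only [norm_chordPow_div, ENNReal.ofReal_pow dist_nonneg, edist_dist]
  · refine .of_bound (C := 16) hcont.norm.aestronglyMeasurable (ae_of_all _ fun θ => ?_)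
    rw [norm_norm]
    exact norm_chordPow_le _

lemma tendsto_sub_half_div :
    Tendsto (fun n : ℕ => ((n - n / 2 : ℕ) : ℝ) / n) atTop (𝓝 (1 / 2)) := by
  have hfloor := (tendsto_nat_floor_mul_div_atTop (R := ℝ) one_half_pos.le).comp
    tendsto_natCast_atTop_atTop
  rw [show (𝓝 (1 / 2 : ℝ)) = 𝓝 (1 - 1 / 2) by norm_num]
  refine (hfloor.const_sub 1).congr' ?_
  filter_upwards [eventually_gt_atTop 0] with n hn
  have hhalf : ⌊1 / 2 * (n : ℝ)⌋₊ = n / 2 := by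
    rw [one_div_mul_eq_div]
    exact_mod_cast Nat.floor_div_eq_div (K := ℝ) n 2
  rw [Function.comp_apply, hhalf, Nat.cast_sub (Nat.div_le_self n 2), sub_div,
    div_self (by exact_mod_cast hn.ne')]

section scaling
variable {b : ℝ} {β : ℕ → ℝ} (hb : 0 < b) (hβ : Tendsto (fun n : ℕ => β n / n) atTop (𝓝 b))
include hb hβ

lemma exists_norm_chainKernel_div_le (x y : ℝ) :
    ∃ K : ℝ, ∀ᶠ n : ℕ in atTop, ∀ k ≤ n / 2, ‖chainKernel (β n) (n - k)‖ /
      ‖translate (Circle.exp y) (chainKernel (β n) n) (Circle.exp x)‖ ≤ K := by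
  have hnum := (tendsto_chainKernel_of_ratio hb hβ one_half_pos tendsto_sub_half_div).norm
  have hden : Tendsto (fun n => ‖translate (Circle.exp y) (chainKernel (β n) n) (Circle.exp x)‖)
      atTop (𝓝 ‖heatKernel (1 / b) (Circle.exp x * (Circle.exp y)⁻¹)‖) :=
    (((continuous_eval_const (F := C(Circle, ℂ)) _).tendsto _).comp
      (tendsto_chainKernel_self hb hβ)).norm
  have hne : heatKernel (1 / b) (Circle.exp x * (Circle.exp y)⁻¹) ≠ 0 :=
    heatKernel_ne_zero (v := ⟨1 / b, by positivity⟩) (NNReal.coe_ne_zero.1 (one_div_pos.2 hb).ne') _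
  refine ⟨‖heatKernel (1 / 2 / b)‖ / ‖heatKernel (1 / b) (Circle.exp x * (Circle.exp y)⁻¹)‖ + 1, ?_⟩
  filter_upwards [(hnum.div hden (norm_ne_zero_iff.2 hne)).eventually (ge_mem_nhds (lt_add_one _)),
    eventually_gt_atTop 0] with n hn hn0 k hk
  refine le_trans ?_ hn
  exact div_le_div_of_nonneg_right (norm_chainKernel_anti (β n) (by lia) (by lia)) (norm_nonneg _)

lemma exists_norm_integral_chordPow_le (x y : ℝ) :
    ∃ C : NNReal, ∀ᶠ n : ℕ in atTop, ∀ d k : ℕ, d + k < n →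
      ‖∫ θ, chordPow (spins n θ (d + k) * (spins n θ d)⁻¹) ∂gibbsMeasure n (β n) x y‖ ≤
        C * (k / n : ℝ) ^ 2 := by
  obtain ⟨K, hK⟩ := exists_norm_chainKernel_div_le hb hβ x y
  refine ⟨⟨max 64 (320 * (2 / b) ^ 2 * K), by positivity⟩, ?_⟩
  filter_upwards [hK, hβ.eventually (lt_mem_nhds (half_lt_self hb)), eventually_gt_atTop 0]
    with n hnK hnβ hn d k hdk
  have hn' : (0 : ℝ) < n := Nat.cast_pos.2 hn
  have hβn : b / 2 * n ≤ β n := ((lt_div_iff₀ hn').1 hnβ).le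
  have hβ0 : 0 < β n := lt_of_lt_of_le (by positivity) hβn
  rcases Nat.lt_or_ge (n / 2) k with hk | hk
  · have hhalf : 1 / 2 ≤ (k / n : ℝ) := by
      rw [div_le_div_iff₀ two_pos hn']
      exact_mod_cast (by lia : 1 * n ≤ k * 2)
    calc _ ≤ (16 : ℝ) := (norm_integral_le_of_norm_le_const
            (ae_of_all _ fun _ => norm_chordPow_le _)).trans_eq (by rw [probReal_univ, mul_one])
      _ ≤ 64 * (k / n : ℝ) ^ 2 := by nlinarith
      _ ≤ _ := mul_le_mul_of_nonneg_right (le_max_left _ _) (sq_nonneg _)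
  · have hratio : (k / β n : ℝ) ≤ 2 / b * (k / n) := by
      calc (k / β n : ℝ) ≤ k / (b / 2 * n) := by gcongr
        _ = 2 / b * (k / n) := by field_simp
    have hK0 : 0 ≤ K := le_trans (by positivity) (hnK k hk)
    calc _ ≤ (∫ v, ‖chordPow (Circle.exp v)‖ ∂convPow (stepLaw (β n)) k) *
            (‖chainKernel (β n) (n - k)‖ /
              ‖translate (Circle.exp y) (chainKernel (β n) n) (Circle.exp x)‖) := by
          rw [← mul_div_assoc]
          exact norm_integral_increment_gibbsMeasure_le (β n) x y chordPow hdk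
      _ ≤ (320 * (k / β n) ^ 2) * K := mul_le_mul (integral_chordPow_convPow_le hβ0 k) (hnK k hk)
          (by positivity) (by positivity)
      _ ≤ (320 * (2 / b * (k / n)) ^ 2) * K := by gcongr
      _ = 320 * (2 / b) ^ 2 * K * (k / n : ℝ) ^ 2 := by ring
      _ ≤ _ := mul_le_mul_of_nonneg_right (le_max_right _ _) (sq_nonneg _)

theorem exists_lintegral_increment_le (x y : ℝ) :
    ∃ C : NNReal, ∀ᶠ n : ℕ in atTop, ∀ a e : ℕ,
      ∫⁻ θ, edist (spins n θ (min a (n - 1))) (spins n θ (min (a + e) (n - 1))) ^ 4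
        ∂gibbsMeasure n (β n) x y ≤ C / (n : ENNReal) ^ 2 * e ^ 2 := by
  obtain ⟨C, hC⟩ := exists_norm_integral_chordPow_le hb hβ x y
  refine ⟨C, ?_⟩
  filter_upwards [hC, eventually_gt_atTop 0] with n hnC hn a e
  obtain ⟨k, hk, hke⟩ : ∃ k, min (a + e) (n - 1) = min a (n - 1) + k ∧ k ≤ e :=
    ⟨min (a + e) (n - 1) - min a (n - 1), by lia, by lia⟩
  have : (0 : ℝ) < n := Nat.cast_pos.2 hn
  rw [lintegral_edist_spins_pow_four, hk]
  calc _ ≤ ENNReal.ofReal (C / n ^ 2 * e ^ 2) := by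
        refine ENNReal.ofReal_le_ofReal ((hnC _ k (by lia)).trans ?_)
        rw [div_pow, mul_div_assoc', mul_div_right_comm]
        gcongr
    _ = C / (n : ENNReal) ^ 2 * e ^ 2 := by
        rw [ENNReal.ofReal_mul (by positivity), ENNReal.ofReal_div_of_pos (by positivity),
          ENNReal.ofReal_pow (Nat.cast_nonneg n), ENNReal.ofReal_pow (Nat.cast_nonneg e),
          ENNReal.ofReal_natCast, ENNReal.ofReal_natCast, ENNReal.ofReal_coe_nnreal]

end scaling

/-! ### Discretisation of the paths -/

/-- The path which takes the value `g j` on `[j / m, (j + 1) / m)`. -/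
def stepPath {E : Type*} [TopologicalSpace E] (m : ℕ) (g : Fin (m + 1) → E) : SkorokhodSpace E :=
  ⟨fun t => g ⟨⌊(m : ℝ) * t⌋₊, floor_lt m t⟩, isCadlag_step m g⟩

lemma edist_le_iSup {E : Type*} [PseudoEMetricSpace E] (x y : SkorokhodSpace E) :
    edist x y ≤ ⨆ t, edist (x t) (y t) := by
  refine iInf_le_of_le (OrderIso.refl _) ?_
  simp

lemma floor_mul_mem_Icc {n m : ℕ} (hn : 0 < n) (hm : 0 < m) {t : ℝ} (ht : 0 ≤ t) :
    ⌊n * t⌋₊ ∈ Set.Icc (n * ⌊m * t⌋₊ / m) (n * (⌊m * t⌋₊ + 1) / m) := by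
  have : (0 : ℝ) < n := Nat.cast_pos.2 hn
  have hm' : (0 : ℝ) < m := Nat.cast_pos.2 hm
  have hm1 : (⌊m * t⌋₊ : ℝ) ≤ m * t := Nat.floor_le (by positivity)
  have hm2 : m * t < ⌊m * t⌋₊ + 1 := Nat.lt_floor_add_one _
  have hn1 : (⌊n * t⌋₊ : ℝ) ≤ n * t := Nat.floor_le (by positivity)
  have hn2 : n * t < ⌊n * t⌋₊ + 1 := Nat.lt_floor_add_one _
  constructor
  · rw [← Nat.lt_succ_iff, Nat.div_lt_iff_lt_mul hm]
    have : (n * ⌊m * t⌋₊ : ℝ) < (⌊n * t⌋₊ + 1) * m := by nlinarith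
    exact_mod_cast this
  · rw [Nat.le_div_iff_mul_le hm]
    have : (⌊n * t⌋₊ * m : ℝ) ≤ n * (⌊m * t⌋₊ + 1) := by nlinarith
    exact_mod_cast this

lemma edist_spinPath_stepPath_pow_four_le {n m : ℕ} (hn : 0 < n) (hm : 0 < m)
    (θ : Fin (n + 1) → ℝ) :
    edist (spinPath n θ) (stepPath m fun j => spins n θ (n * j / m)) ^ 4 ≤
      ∑ j ∈ Finset.range m, maxIncrement (fun k => spins n θ (min k (n - 1))) (n * j / m)
        (n * (j + 1) / m - n * j / m) := by
  refine (pow_le_pow_left' (edist_le_iSup _ _) 4).trans ?_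
  rw [ENNReal.iSup_pow]
  refine iSup_le fun t => ?_
  have hspin : spinPath n θ t = spins n θ ⌊(n : ℝ) * t⌋₊ := by
    rw [spins, dif_pos (floor_lt n t)]
    rfl
  rw [hspin, edist_comm]
  change edist (spins n θ (n * ⌊(m : ℝ) * t⌋₊ / m)) _ ^ 4 ≤ _
  rcases eq_or_lt_of_le t.2.2 with h1 | h1
  · rw [h1, mul_one, mul_one, Nat.floor_natCast, Nat.floor_natCast, Nat.mul_div_cancel _ hm,
      edist_self, zero_pow four_ne_zero]
    exact zero_le
  · have hfloor {k : ℕ} (hk : 0 < k) : ⌊(k : ℝ) * t⌋₊ < k :=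
      (Nat.floor_lt (mul_nonneg k.cast_nonneg t.2.1)).2
        (mul_lt_of_lt_one_right (Nat.cast_pos.2 hk) h1)
    obtain ⟨hlow, hupp⟩ := floor_mul_mem_Icc hn hm t.2.1
    have hlt := hfloor hn
    generalize ⌊(n : ℝ) * t⌋₊ = k at *
    obtain ⟨r, rfl⟩ := Nat.exists_eq_add_of_le hlow
    have hmax := le_maxIncrement (fun k => spins n θ (min k (n - 1)))
      (n * ⌊(m : ℝ) * t⌋₊ / m) (Nat.le_sub_of_add_le' hupp)
    beta_reduce at hmax
    rw [min_eq_left (by lia), min_eq_left (by lia)] at hmax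
    exact hmax.trans (Finset.single_le_sum (f := fun j => maxIncrement
      (fun k => spins n θ (min k (n - 1))) (n * j / m) (n * (j + 1) / m - n * j / m))
      (fun _ _ => zero_le) (Finset.mem_range.2 (hfloor hm)))

lemma mul_div_sub_mul_le {n m : ℕ} (hm : 0 < m) (hmn : m ≤ n) (j : ℕ) :
    (n * (j + 1) / m - n * j / m) * m ≤ 2 * n := by
  have hupp : n * (j + 1) / m * m ≤ n * j + n :=
    (Nat.div_mul_le_self (n * (j + 1)) m).trans_eq (mul_add_one n j)
  have hlow := Nat.lt_div_mul_add hm (a := n * j)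
  rw [Nat.sub_mul, tsub_le_iff_right]
  linarith

lemma div_sq_mul_sq_le {n m g : ℕ} (hn : 0 < n) (hm : 0 < m) (h : g * m ≤ 2 * n) (C : ENNReal) :
    C / (n : ENNReal) ^ 2 * (g : ENNReal) ^ 2 ≤ C * 4 / (m : ENNReal) ^ 2 := by
  have hratio : (g : ENNReal) / n ≤ 2 / m := by
    rw [ENNReal.div_le_iff (by exact_mod_cast hn.ne') (ENNReal.natCast_ne_top n),
      ← ENNReal.mul_div_right_comm, ENNReal.le_div_iff_mul_le
        (Or.inl (by exact_mod_cast hm.ne')) (Or.inl (ENNReal.natCast_ne_top m))]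
    exact_mod_cast h
  calc C / (n : ENNReal) ^ 2 * (g : ENNReal) ^ 2 = C * ((g : ENNReal) / n) ^ 2 := by
        rw [div_eq_mul_inv, div_eq_mul_inv, mul_pow, ENNReal.inv_pow]; ring
    _ ≤ C * ((2 : ENNReal) / m) ^ 2 := by gcongr
    _ = C * 4 / (m : ENNReal) ^ 2 := by
        rw [div_eq_mul_inv, div_eq_mul_inv, mul_pow, ENNReal.inv_pow]; ring

theorem exists_lintegral_edist_stepPath_pow_four_le {b : ℝ} {β : ℕ → ℝ} (hb : 0 < b)
    (hβ : Tendsto (fun n : ℕ => β n / n) atTop (𝓝 b)) (x y : ℝ) :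
    ∃ C : NNReal, ∀ m : ℕ, 0 < m → ∀ᶠ n : ℕ in atTop,
      ∫⁻ θ, edist (spinPath n θ) (stepPath m fun j => spins n θ (n * j / m)) ^ 4
        ∂gibbsMeasure n (β n) x y ≤ C / m := by
  obtain ⟨C, hC⟩ := exists_lintegral_increment_le hb hβ x y
  refine ⟨11 ^ 4 * C * 4, fun m hm => ?_⟩
  filter_upwards [hC, eventually_ge_atTop m] with n hn hmn
  have hY (i j : ℕ) : Measurable fun θ : Fin (n + 1) → ℝ =>
      edist (spins n θ (min i (n - 1))) (spins n θ (min j (n - 1))) :=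
    Continuous.measurable (by fun_prop)
  have hn0 : 0 < n := hm.trans_le hmn
  refine (lintegral_mono (edist_spinPath_stepPath_pow_four_le hn0 hm)).trans ?_
  rw [lintegral_finsetSum _ fun j _ => measurable_maxIncrement hY _ _]
  calc _ ≤ ∑ _j ∈ Finset.range m, 11 ^ 4 * (C : ENNReal) * 4 / (m : ENNReal) ^ 2 := by
        refine Finset.sum_le_sum fun j _ => (lintegral_maxIncrement_le hY hn _ _).trans ?_
        rw [← mul_div_assoc]
        exact div_sq_mul_sq_le hn0 hm (mul_div_sub_mul_le hm hmn j) _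
    _ = ((11 ^ 4 * C * 4 : NNReal) : ENNReal) / m := by
        rw [Finset.sum_const, Finset.card_range, nsmul_eq_mul, sq, ← mul_div_assoc,
          ENNReal.mul_div_mul_left _ _ (by exact_mod_cast hm.ne') (ENNReal.natCast_ne_top m)]
        push_cast
        rfl

/-! ### Finite-dimensional distributions of Brownian motion on the circle -/

section brownian

variable {Ω : Type*} [MeasurableSpace Ω] {P : Measure Ω}

lemma measurable_listVal (L : List (NNReal × C(Circle, ℂ))) {S : Type*} [MeasurableSpace S]
    {s : S → NNReal → ℝ} (hs : Measurable s) :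
    Measurable fun x => listVal L fun t => Circle.exp (s x t) := by
  induction L generalizing s with
  | nil => exact measurable_const
  | cons p L ih =>
    have hp : Measurable fun u => p.2 (Circle.exp u) := Continuous.measurable (by fun_prop)
    exact (hp.comp ((measurable_pi_apply p.1).comp hs)).mul
      (ih (measurable_pi_lambda _ fun t => (measurable_pi_apply (p.1 + t)).comp hs))

lemma exists_norm_listVal_le {T : Type*} [Add T] (L : List (T × C(Circle, ℂ))) :
    ∃ C, ∀ s : T → Circle, ‖listVal L s‖ ≤ C := by
  obtain ⟨C, hC⟩ := (isCompact_range (continuous_listVal L)).isBounded.exists_norm_le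
  exact ⟨C, fun s => hC _ ⟨s, rfl⟩⟩

lemma integral_comp_shift [IsProbabilityMeasure P] {W : NNReal → Ω → ℝ}
    (hW : IsPreBrownianReal W P) (hm : ∀ t, Measurable (W t)) (d : NNReal)
    {K : ℝ × (NNReal → ℝ) → ℂ} (hK : Measurable K) {C : ℝ} (hC : ∀ p, ‖K p‖ ≤ C) :
    ∫ ω, K (W d ω, fun t => W (d + t) ω - W d ω) ∂P =
      ∫ a, ∫ ω, K (a, fun t => W (d + t) ω - W d ω) ∂P ∂gaussianReal 0 d := by
  have hinc : Measurable fun ω t => W (d + t) ω - W d ω :=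
    measurable_pi_lambda _ fun t => (hm (d + t)).sub (hm d)
  have heval : Measurable fun x : Set.Iic d → ℝ => x ⟨d, le_refl d⟩ := measurable_pi_apply _
  have hind : IndepFun (W d) (fun ω t => W (d + t) ω - W d ω) P :=
    ((hW.indepFun_shift d).comp measurable_id heval).symm
  have := Measure.isProbabilityMeasure_map (μ := P) hinc.aemeasurable
  rw [← integral_map ((hm d).prodMk hinc).aemeasurable hK.aestronglyMeasurable,
    (indepFun_iff_map_prod_eq_prod_map_map (hm d).aemeasurable hinc.aemeasurable).1 hind,
    (hW.hasLaw_eval d).map_eq,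
    integral_prod _ (Integrable.of_bound hK.aestronglyMeasurable _ (ae_of_all _ hC))]
  congr with a
  exact integral_map hinc.aemeasurable (hK.comp measurable_prodMk_left).aestronglyMeasurable

lemma gaussianReal_zero_mul (d v : NNReal) :
    gaussianReal 0 (d * v) = (gaussianReal 0 d).map fun a => √v * a := by
  rw [gaussianReal_map_const_mul, mul_zero]
  congr 1
  ext
  simp [mul_comm]

lemma integral_listVal_of_measurable (L : List (NNReal × C(Circle, ℂ))) [IsProbabilityMeasure P]
    {v : NNReal} {W : NNReal → Ω → ℝ} (hW : IsPreBrownianReal W P) (hm : ∀ t, Measurable (W t))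
    (z : ℝ) :
    ∫ ω, listVal L (fun t => Circle.exp (z + √v * W t ω)) ∂P =
      transfer (fun d => rotAvg (gaussianReal 0 (d * v))) L 1 (Circle.exp z) := by
  induction L generalizing W z with
  | nil => simp [listVal]
  | cons p L ih =>
    obtain ⟨d, H⟩ := p
    let K : ℝ × (NNReal → ℝ) → ℂ := fun p => H (Circle.exp (z + √v * p.1)) *
      listVal L fun t => Circle.exp (z + √v * p.1 + √v * p.2 t)
    have hK : Measurable K := by
      have hpath : Measurable fun (p : ℝ × (NNReal → ℝ)) t => z + √v * p.1 + √v * p.2 t := by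
        fun_prop
      have hH : Measurable fun a => H (Circle.exp (z + √v * a)) :=
        Continuous.measurable (by fun_prop)
      exact (hH.comp measurable_fst).mul (measurable_listVal L hpath)
    obtain ⟨C, hC⟩ := exists_norm_listVal_le L
    have hKC : ∀ p, ‖K p‖ ≤ ‖H‖ * C := fun p => by
      rw [norm_mul]
      exact mul_le_mul (H.norm_coe_le_norm _) (hC _) (norm_nonneg _) (norm_nonneg _)
    have hsplit : ∀ ω, listVal ((d, H) :: L) (fun t => Circle.exp (z + √v * W t ω)) =
        K (W d ω, fun t => W (d + t) ω - W d ω) := fun ω => by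
      simp only [listVal, K]
      congr 3 with t
      ring_nf
    simp_rw [hsplit]
    rw [integral_comp_shift hW hm d hK hKC, transfer_cons, rotAvg_apply, gaussianReal_zero_mul,
      integral_map (by fun_prop) (Continuous.aestronglyMeasurable (by fun_prop))]
    congr with a
    simp only [K]
    rw [integral_const_mul, ih (hW.shift d) (fun t => (hm (d + t)).sub (hm d)), Circle.exp_add]
    rfl

lemma listVal_ae_congr (L : List (NNReal × C(Circle, ℂ))) {s s' : Ω → NNReal → Circle}
    (h : ∀ t, ∀ᵐ ω ∂P, s ω t = s' ω t) : ∀ᵐ ω ∂P, listVal L (s ω) = listVal L (s' ω) := by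
  induction L generalizing s s' with
  | nil => exact ae_of_all _ fun _ => rfl
  | cons p L ih =>
    filter_upwards [h p.1, ih fun t => h (p.1 + t)] with ω hd hrest
    rw [listVal, listVal, hd, hrest]

theorem integral_listVal_brownian (L : List (NNReal × C(Circle, ℂ))) [IsProbabilityMeasure P]
    {v : NNReal} {W : NNReal → Ω → ℝ} (hW : IsPreBrownianReal W P) (z : ℝ) :
    ∫ ω, listVal L (fun t => Circle.exp (z + √v * W t ω)) ∂P =
      transfer (fun d => rotAvg (gaussianReal 0 (d * v))) L 1 (Circle.exp z) := by
  have h : ∀ t, W t =ᵐ[P] (hW.aemeasurable t).mk := fun t => (hW.aemeasurable t).ae_eq_mk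
  rw [← integral_listVal_of_measurable L (hW.congr h) fun t => (hW.aemeasurable t).measurable_mk]
  refine integral_congr_ae (listVal_ae_congr L fun t => ?_)
  filter_upwards [h t] with ω hω
  rw [hω]

end brownian

/-! ### The Brownian bridge -/

instance : MeasurableSpace C(unitInterval, ℝ) := borel _

instance : BorelSpace C(unitInterval, ℝ) := ⟨rfl⟩

section bridge

variable {Ω : Type*} [MeasurableSpace Ω] {P : Measure Ω}

lemma exists_measurable_path {Z : unitInterval → Ω → ℝ} (hZ : ∀ t, AEMeasurable (Z t) P)
    (hc : ∀ᵐ ω ∂P, Continuous fun t => Z t ω) :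
    ∃ Φ : ((Σ n : ℕ, Fin (n + 1)) → ℝ) → C(unitInterval, ℝ), Measurable Φ ∧
      ∀ᵐ ω ∂P, ∀ t, Φ (fun q => Z (bernstein.z q.2) ω) t = Z t ω := by
  let B : ℕ → ((Σ n : ℕ, Fin (n + 1)) → ℝ) → C(unitInterval, ℝ) := fun n x =>
    ∑ k : Fin (n + 1), x ⟨n, k⟩ • bernstein n k
  have hB : ∀ n, Measurable (B n) := fun n =>
    Finset.measurable_fun_sum _ fun k _ => (measurable_pi_apply _).smul_const _
  have hB_tendsto : ∀ x : C(unitInterval, ℝ),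
      Tendsto (fun n => B n fun q => x (bernstein.z q.2)) atTop (𝓝 x) := by
    intro x
    refine (bernsteinApproximation_uniform x).congr fun n => ?_
    ext t
    simp [B, bernsteinApproximation, mul_comm]
  have hZm : AEMeasurable (fun ω (q : Σ n : ℕ, Fin (n + 1)) => Z (bernstein.z q.2) ω) P :=
    aemeasurable_pi_lambda _ fun q => hZ _
  have hexists : ∀ᵐ ω ∂P, ∃ l,
      Tendsto (fun n => B n fun q => Z (bernstein.z q.2) ω) atTop (𝓝 l) := by
    filter_upwards [hc] with ω hω
    exact ⟨_, hB_tendsto ⟨_, hω⟩⟩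
  obtain ⟨Φ, hΦ, hlim⟩ := measurable_limit_of_tendsto_metrizable_ae
    (μ := P.map fun ω (q : Σ n : ℕ, Fin (n + 1)) => Z (bernstein.z q.2) ω) (f := B) (L := atTop)
    (fun n => (hB n).aemeasurable) ((ae_map_iff hZm (measurableSet_exists_tendsto hB)).2 hexists)
  refine ⟨Φ, hΦ, ?_⟩
  filter_upwards [ae_of_ae_map hZm hlim, hc] with ω hω hcω t
  exact DFunLike.congr_fun (tendsto_nhds_unique hω (hB_tendsto ⟨_, hcω⟩)) t

lemma indepFun_sub_mul_one [IsProbabilityMeasure P] {W : NNReal → Ω → ℝ}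
    (hW : IsPreBrownianReal W P) {S : Type*} (τ : S → unitInterval) :
    IndepFun (fun ω (_ : Unit) => W 1 ω)
      (fun ω s => W (unitInterval.toNNReal (τ s)) ω - τ s * W 1 ω) P := by
  have hWm t := hW.aemeasurable t
  refine IndepFun.symm ?_
  apply IsGaussianProcess.indepFun_of_covariance_eq_zero
  · apply hW.isGaussianProcess.of_isGaussianProcess
    rintro (s | _)
    · exact ⟨{unitInterval.toNNReal (τ s), 1},
        { toFun x := x ⟨unitInterval.toNNReal (τ s), by simp⟩ - τ s * x ⟨1, by simp⟩
          map_add' x y := by simp; ring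
          map_smul' c x := by simp; ring }, by simp⟩
    · exact ⟨{1},
        { toFun x := x ⟨1, by simp⟩
          map_add' x y := by simp
          map_smul' c x := by simp }, by simp⟩
  any_goals fun_prop
  · rintro s _
    have hL2 : ∀ t, MemLp (W t) 2 P := fun t =>
      (hW.isGaussianProcess.hasGaussianLaw_eval t).memLp_two
    rw [covariance_fun_sub_left (hL2 _) ((hL2 _).const_mul _) (hL2 _), hW.covariance_fun_eval,
      covariance_const_mul_left, hW.covariance_fun_eval, min_self,
      min_eq_left (show unitInterval.toNNReal (τ s) ≤ 1 from (τ s).2.2)]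
    simp

lemma exists_bridge [IsProbabilityMeasure P] {W : NNReal → Ω → ℝ} (hW : IsBrownianReal W P) :
    ∃ R : Ω → C(unitInterval, ℝ), AEMeasurable R P ∧
      (∀ᵐ ω ∂P, ∀ t, R ω t = W (unitInterval.toNNReal t) ω - t * W 1 ω) ∧
      IndepFun (W 1) R P := by
  have hm : ∀ t, AEMeasurable (W t) P := hW.toIsPreBrownianReal.aemeasurable
  have hZ : ∀ t : unitInterval,
      AEMeasurable (fun ω => W (unitInterval.toNNReal t) ω - t * W 1 ω) P :=
    fun t => (hm _).sub ((hm _).const_mul _)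
  have hc : ∀ᵐ ω ∂P,
      Continuous fun t : unitInterval => W (unitInterval.toNNReal t) ω - t * W 1 ω := by
    filter_upwards [hW.cont] with ω hω
    have : Continuous fun t : unitInterval => W (unitInterval.toNNReal t) ω :=
      hω.comp (by fun_prop)
    fun_prop
  obtain ⟨Φ, hΦ, hΦZ⟩ := exists_measurable_path hZ hc
  exact ⟨_, hΦ.comp_aemeasurable (aemeasurable_pi_lambda _ fun q => hZ (bernstein.z q.2)), hΦZ,
    (indepFun_sub_mul_one hW.toIsPreBrownianReal
      fun q : Σ n : ℕ, Fin (n + 1) => bernstein.z q.2).comp (measurable_pi_apply ()) hΦ⟩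

/-- The path `t ↦ θ + w t + r t`. When `r` is a Brownian bridge and `w` an independent Gaussian
variable it is a Brownian path, and fixing `w` pins its end point. -/
def tiltPath (θ w : ℝ) (r : C(unitInterval, ℝ)) : C(unitInterval, ℝ) :=
  ⟨fun t => θ + w * t + r t, by fun_prop⟩

@[fun_prop]
lemma continuous_tiltPath (θ : ℝ) :
    Continuous fun p : ℝ × C(unitInterval, ℝ) => tiltPath θ p.1 p.2 := by
  have h : ∀ p : ℝ × C(unitInterval, ℝ), tiltPath θ p.1 p.2 =
      ContinuousMap.const _ θ + p.1 • (⟨fun t => (t : ℝ), by fun_prop⟩ : C(unitInterval, ℝ)) +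
        p.2 := by
    intro p
    ext t
    simp [tiltPath]
  simp only [h]
  fun_prop

lemma continuous_tiltPath_right (θ w : ℝ) : Continuous (tiltPath θ w) :=
  (continuous_tiltPath θ).comp (by fun_prop : Continuous fun r => (w, r))

lemma continuous_tiltPath_left (θ : ℝ) (r : C(unitInterval, ℝ)) :
    Continuous fun w => tiltPath θ w r :=
  (continuous_tiltPath θ).comp (by fun_prop : Continuous fun w => (w, r))

/-- The law of the path `t ↦ θ + w t + r t` when `w` is Gaussian of variance `v` and `r` has law
`lam` independently of `w`. -/
def tiltLaw (lam : Measure C(unitInterval, ℝ)) (θ : ℝ) (v : NNReal) :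
    Measure C(unitInterval, ℝ) :=
  ((gaussianReal 0 v).prod lam).map fun p => tiltPath θ p.1 p.2

theorem exists_map_eq_tiltLaw [IsProbabilityMeasure P] {W : NNReal → Ω → ℝ}
    (hW : IsBrownianReal W P) (θ : ℝ) (v : NNReal) :
    ∃ (lam : Measure C(unitInterval, ℝ)) (V : Ω → C(unitInterval, ℝ)),
      IsProbabilityMeasure lam ∧ (∀ᵐ r ∂lam, r 1 = 0) ∧ AEMeasurable V P ∧
      (∀ᵐ ω ∂P, ∀ t, V ω t = θ + √v * W (unitInterval.toNNReal t) ω) ∧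
      P.map V = tiltLaw lam θ v := by
  have hp := hW.toIsPreBrownianReal
  obtain ⟨R, hR, hRW, hind⟩ := exists_bridge hW
  have hR' : AEMeasurable (fun ω => √(v : ℝ) • R ω) P :=
    (measurable_const_smul √(v : ℝ)).comp_aemeasurable hR
  have hU : AEMeasurable (fun ω => √v * W 1 ω) P := (hp.aemeasurable 1).const_mul _
  have hprod := (indepFun_iff_map_prod_eq_prod_map_map hU hR').1
    (hind.comp (measurable_const_mul √(v : ℝ)) (measurable_const_smul √(v : ℝ)))
  have hlaw : P.map (fun ω => √v * W 1 ω) = gaussianReal 0 v := by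
    rw [← one_mul v, gaussianReal_zero_mul, ← (hp.hasLaw_eval 1).map_eq, one_mul]
    exact (AEMeasurable.map_map_of_aemeasurable (by fun_prop) (hp.aemeasurable 1)).symm
  have hT : Measurable fun p : ℝ × C(unitInterval, ℝ) => tiltPath θ p.1 p.2 :=
    (continuous_tiltPath θ).measurable
  have hend : MeasurableSet {r : C(unitInterval, ℝ) | r 1 = 0} :=
    (isClosed_eq (continuous_eval_const 1) continuous_const).measurableSet
  refine ⟨P.map fun ω => √v • R ω, fun ω => tiltPath θ (√v * W 1 ω) (√v • R ω),
    Measure.isProbabilityMeasure_map hR', (ae_map_iff hR' hend).2 ?_,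
    hT.comp_aemeasurable (hU.prodMk hR'), ?_, ?_⟩
  · filter_upwards [hRW] with ω hω
    have : unitInterval.toNNReal 1 = 1 := rfl
    simp [hω, this]
  · filter_upwards [hRW] with ω hω t
    simp only [tiltPath, ContinuousMap.coe_mk, ContinuousMap.smul_apply, hω, smul_eq_mul]
    ring
  · rw [tiltLaw, ← hlaw, ← hprod]
    exact (AEMeasurable.map_map_of_aemeasurable hT.aemeasurable (hU.prodMk hR')).symm

end bridge

section pinned

variable {lam : Measure C(unitInterval, ℝ)} {θ : ℝ} {v : NNReal} {F : C(unitInterval, ℝ) → ℂ}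
  {C : ℝ}

/-- The average over `r`, of law `lam`, of a function of the path `t ↦ θ + w t + r t`. -/
def pathAvg (lam : Measure C(unitInterval, ℝ)) (θ : ℝ) (F : C(unitInterval, ℝ) → ℂ) (w : ℝ) : ℂ :=
  ∫ r, F (tiltPath θ w r) ∂lam

/-- The law of the path `t ↦ θ + w t + r t`, where `r` has law `lam` and `w` is Gaussian of variance
`v` conditioned on being equal to `u` modulo `2π`. -/
def pinnedLaw (lam : Measure C(unitInterval, ℝ)) (θ : ℝ) (v : NNReal) (u : ℝ) :
    Measure C(unitInterval, ℝ) :=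
  Measure.sum fun m : ℤ => ENNReal.ofReal (gaussianPDFReal 0 v (u + 2 * π * m) /
    ∑' m : ℤ, gaussianPDFReal 0 v (u + 2 * π * m)) • lam.map (tiltPath θ (u + 2 * π * m))

lemma ae_pinnedLaw_exp_one (h1 : ∀ᵐ r ∂lam, r 1 = 0) (θ₁ : ℝ) :
    ∀ᵐ c ∂pinnedLaw lam θ v (θ₁ - θ), Circle.exp (c 1) = Circle.exp θ₁ := by
  rw [pinnedLaw, Measure.ae_sum_iff]
  intro m
  refine Measure.ae_smul_measure ?_ _
  have hend : MeasurableSet {c : C(unitInterval, ℝ) | Circle.exp (c 1) = Circle.exp θ₁} :=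
    (isClosed_eq (by fun_prop) continuous_const).measurableSet
  rw [ae_map_iff (continuous_tiltPath_right _ _).measurable.aemeasurable hend]
  filter_upwards [h1] with r hr
  have : tiltPath θ (θ₁ - θ + 2 * π * m) r 1 = θ₁ + m * (2 * π) := by
    simp only [tiltPath, ContinuousMap.coe_mk, hr, Set.Icc.coe_one]
    ring
  rw [this]
  exact Circle.periodic_exp.int_mul m θ₁

variable [IsProbabilityMeasure lam]

lemma pathAvg_one : pathAvg lam θ (fun _ => 1) = fun _ => 1 := by
  funext w
  simp [pathAvg]

lemma norm_pathAvg_le (hC : ∀ c, ‖F c‖ ≤ C) (w : ℝ) : ‖pathAvg lam θ F w‖ ≤ C :=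
  (norm_integral_le_of_norm_le_const (ae_of_all _ fun r => hC (tiltPath θ w r))).trans_eq
    (by simp)

lemma continuous_pathAvg (hF : Continuous F) (hC : ∀ c, ‖F c‖ ≤ C) :
    Continuous (pathAvg lam θ F) :=
  continuous_of_dominated (bound := fun _ => C)
    (fun w => (hF.comp (continuous_tiltPath_right θ w)).aestronglyMeasurable)
    (fun _ => ae_of_all _ fun _ => hC _) (integrable_const _)
    (ae_of_all _ fun r => hF.comp (continuous_tiltPath_left θ r))

lemma integral_tiltLaw (h1 : ∀ᵐ r ∂lam, r 1 = 0) (hF : Continuous F) (hC : ∀ c, ‖F c‖ ≤ C)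
    {h : ℝ → ℂ} (hh : Measurable h) {C' : ℝ} (hC' : ∀ w, ‖h w‖ ≤ C') :
    ∫ c, h (c 1) * F c ∂tiltLaw lam θ v =
      ∫ w, h (θ + w) * pathAvg lam θ F w ∂gaussianReal 0 v := by
  have hT := (continuous_tiltPath θ).measurable
  have hm : Measurable fun c : C(unitInterval, ℝ) => h (c 1) * F c :=
    (hh.comp (continuous_eval_const 1).measurable).mul hF.measurable
  have hb : ∀ c : C(unitInterval, ℝ), ‖h (c 1) * F c‖ ≤ C' * C := fun c => by
    rw [norm_mul]
    exact mul_le_mul (hC' _) (hC _) (norm_nonneg _) ((norm_nonneg _).trans (hC' (c 1)))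
  have hInt : Integrable (fun p : ℝ × C(unitInterval, ℝ) =>
      h (tiltPath θ p.1 p.2 1) * F (tiltPath θ p.1 p.2)) ((gaussianReal 0 v).prod lam) :=
    Integrable.of_bound (hm.comp hT).aestronglyMeasurable _ (ae_of_all _ fun _ => hb _)
  rw [tiltLaw, integral_map hT.aemeasurable hm.aestronglyMeasurable, integral_prod _ hInt]
  congr with w
  rw [pathAvg, ← integral_const_mul]
  refine integral_congr_ae ?_
  filter_upwards [h1] with r hr
  simp [tiltPath, hr]

lemma isProbabilityMeasure_pinnedLaw (hv : v ≠ 0) (u : ℝ) :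
    IsProbabilityMeasure (pinnedLaw lam θ v u) := by
  have hs := tsum_gaussianPDFReal_wrap_pos hv u
  have : ∀ m : ℤ, IsProbabilityMeasure (lam.map (tiltPath θ (u + 2 * π * m))) := fun m =>
    Measure.isProbabilityMeasure_map (continuous_tiltPath_right _ _).measurable.aemeasurable
  refine ⟨?_⟩
  rw [pinnedLaw, Measure.sum_apply _ MeasurableSet.univ]
  simp only [Measure.smul_apply, measure_univ, smul_eq_mul, mul_one]
  rw [← ENNReal.ofReal_tsum_of_nonneg (fun m => div_nonneg (gaussianPDFReal_nonneg _ _ _) hs.le)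
    ((summable_gaussianPDFReal_wrap hv u).div_const _), tsum_div_const, div_self hs.ne',
    ENNReal.ofReal_one]

lemma integral_pinnedLaw (hv : v ≠ 0) (hF : Continuous F) (hC : ∀ c, ‖F c‖ ≤ C) (u : ℝ) :
    ∫ c, F c ∂pinnedLaw lam θ v u = wrap v (pathAvg lam θ F) u / wrap v (fun _ => 1) u := by
  have hs := tsum_gaussianPDFReal_wrap_pos hv u
  have := isProbabilityMeasure_pinnedLaw (lam := lam) (θ := θ) hv u
  have hi : Integrable F (pinnedLaw lam θ v u) :=
    Integrable.of_bound hF.aestronglyMeasurable C (ae_of_all _ hC)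
  rw [pinnedLaw, integral_sum_measure hi, wrap_one, wrap, ← tsum_div_const]
  congr with m
  rw [integral_smul_measure,
    integral_map (continuous_tiltPath_right _ _).measurable.aemeasurable hF.aestronglyMeasurable,
    ENNReal.toReal_ofReal (div_nonneg (gaussianPDFReal_nonneg _ _ _) hs.le), Complex.real_smul,
    pathAvg]
  push_cast
  ring

end pinned

/-! ### The conditional law of a Brownian path on the circle -/

/-- The image on the circle of a continuous path of angles. -/
def expPath (c : C(unitInterval, ℝ)) : SkorokhodSpace Circle :=
  ⟨fun t => Circle.exp (c t), fun t => by
    have h : Continuous fun t => Circle.exp (c t) := by fun_prop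
    exact ⟨h.continuousWithinAt, _, h.continuousAt.tendsto.mono_left nhdsWithin_le_nhds⟩⟩

lemma edist_exp_le (x y : ℝ) : edist (Circle.exp x) (Circle.exp y) ≤ edist x y := by
  have h : (Circle.exp x : ℂ) - Circle.exp y =
      Circle.exp y * (Complex.exp (Complex.I * (x - y : ℝ)) - 1) := by
    rw [mul_sub_one, mul_comm Complex.I, ← Circle.coe_exp, ← Circle.coe_mul, ← Circle.exp_add,
      add_sub_cancel]
  rw [edist_dist, edist_dist]
  refine ENNReal.ofReal_le_ofReal ?_
  change dist (Circle.exp x : ℂ) (Circle.exp y) ≤ dist x y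
  rw [dist_eq_norm, h, norm_mul, Circle.norm_coe, one_mul, Real.dist_eq]
  exact Real.norm_exp_I_mul_ofReal_sub_one_le

lemma continuous_expPath : Continuous expPath := by
  refine LipschitzWith.continuous (K := 1) fun c c' => ?_
  rw [ENNReal.coe_one, one_mul]
  refine (edist_le_iSup _ _).trans (iSup_le fun t => (edist_exp_le _ _).trans ?_)
  rw [edist_dist, edist_dist]
  exact ENNReal.ofReal_le_ofReal (ContinuousMap.dist_apply_le_dist t)

lemma listVal_append {T : Type*} [AddMonoid T] (L : List (T × C(Circle, ℂ))) (e : T)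
    (H : C(Circle, ℂ)) (s : T → Circle) :
    listVal (L ++ [(e, H)]) s = listVal L s * H (s (listTime L + e)) := by
  induction L generalizing s with
  | nil => simp [listVal]
  | cons p L ih =>
    rw [List.cons_append, listVal, listVal, ih, mul_assoc]
    simp [listTime, add_assoc]

lemma transfer_append {T : Type*} (A : T → C(Circle, ℂ) →L[ℂ] C(Circle, ℂ))
    (L : List (T × C(Circle, ℂ))) (e : T) (H g : C(Circle, ℂ)) :
    transfer A (L ++ [(e, H)]) g = transfer A L (A e (H * g)) := by
  induction L with
  | nil => simp [transfer_cons]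
  | cons p L ih => rw [List.cons_append, transfer_cons, transfer_cons, ih]

lemma listVal_congr_of_le (L : List (NNReal × C(Circle, ℂ))) {s s' : NNReal → Circle}
    (h : ∀ t ≤ listTime L, s t = s' t) : listVal L s = listVal L s' := by
  induction L generalizing s s' with
  | nil => rfl
  | cons p L ih =>
    rw [listTime_cons] at h
    rw [listVal, listVal, h p.1 le_self_add, ih fun t ht => h _ (by gcongr)]

/-- The extension to nonnegative times of a path on the unit interval. -/
def extendPath {E : Type*} (x : unitInterval → E) (t : NNReal) : E :=
  x (Set.projIcc 0 1 zero_le_one (t : ℝ))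

lemma extendPath_apply {E : Type*} (x : unitInterval → E) {t : NNReal} (ht : t ≤ 1) :
    extendPath x t = x ⟨t, t.2, by exact_mod_cast ht⟩ := by
  exact congrArg x (Set.projIcc_of_mem _ ⟨t.2, by exact_mod_cast ht⟩)

lemma continuous_listVal_expPath (L : List (NNReal × C(Circle, ℂ))) :
    Continuous fun c : C(unitInterval, ℝ) => listVal L (extendPath (expPath c)) :=
  (continuous_listVal L).comp (continuous_pi fun _ =>
    Circle.exp.continuous.comp (continuous_eval_const (F := C(unitInterval, ℝ)) _))

lemma integral_listVal_tiltLaw {Ω : Type*} [MeasurableSpace Ω] {P : Measure Ω}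
    [IsProbabilityMeasure P] {W : NNReal → Ω → ℝ} (hW : IsPreBrownianReal W P)
    {V : Ω → C(unitInterval, ℝ)} (hVm : AEMeasurable V P) {lam : Measure C(unitInterval, ℝ)}
    {θ : ℝ} {v : NNReal} (hV : ∀ᵐ ω ∂P, ∀ t, V ω t = θ + √v * W (unitInterval.toNNReal t) ω)
    (hmap : P.map V = tiltLaw lam θ v) {L : List (NNReal × C(Circle, ℂ))} (hL : listTime L ≤ 1) :
    ∫ c, listVal L (extendPath (expPath c)) ∂tiltLaw lam θ v =
      transfer (fun d => rotAvg (gaussianReal 0 (d * v))) L 1 (Circle.exp θ) := by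
  rw [← hmap, integral_map hVm (continuous_listVal_expPath L).aestronglyMeasurable,
    ← integral_listVal_brownian L hW]
  refine integral_congr_ae ?_
  filter_upwards [hV] with ω hω
  refine listVal_congr_of_le L fun t ht => ?_
  rw [extendPath_apply _ (ht.trans hL)]
  exact congrArg Circle.exp (hω _)

lemma hasSum_translate_heatKernel {s : ℝ} (hs : 0 < s) (z : Circle) :
    HasSum (fun k : ℤ => ((2 * π : ℂ)⁻¹ * ((Real.exp (-((k : ℝ) ^ 2 * s / 2)) : ℂ) *
      circleMonomial k z)) • circleMonomial (-k)) (translate z (heatKernel s)) := by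
  have hsum := (Equiv.neg ℤ).hasSum_iff.2 (hasSum_circleSeries (summable_heat hs))
  refine (hsum.map (ContinuousMap.compAddMonoidHom' ⟨fun w => w * z⁻¹, by fun_prop⟩)
    (continuous_translate z)).congr_fun fun k => ?_
  ext w
  simp [circleMonomial_apply, mul_zpow]
  ring

-- Both sides are sums of Fourier series in `u` with the same coefficients.
lemma eq_apply_translate_heatKernel {g : ℝ → ℂ} (hg : Continuous g) (hp : g.Periodic (2 * π))
    (B : C(Circle, ℂ) →L[ℂ] C(Circle, ℂ)) (z : Circle) {s : ℝ} (hs : 0 < s)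
    (hcoeff : ∀ k : ℤ, angleCoeff g k = circleMonomial k z *
      ((Real.exp (-((k : ℝ) ^ 2 * s / 2)) : ℂ) * B (circleMonomial (-k)) z)) (u : ℝ) :
    g u = B (translate (z * Circle.exp u) (heatKernel s)) z := by
  have hsum : Summable (angleCoeff g) := by
    refine Summable.of_norm_bounded ((summable_heat hs).norm.mul_right ‖B‖) fun k => ?_
    rw [hcoeff, norm_mul, norm_mul, circleMonomial_apply, Circle.norm_coe, one_mul]
    gcongr
    refine ((B (circleMonomial (-k))).norm_coe_le_norm _).trans ?_
    simpa [norm_circleMonomial] using B.le_opNorm (circleMonomial (-k))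
  have hseries := ContinuousMap.hasSum_apply (hasSum_circleSeries hsum) (Circle.exp u)
  rw [circleSeries_angleCoeff_exp hg hp hsum] at hseries
  refine hseries.unique ((ContinuousMap.hasSum_apply
    (B.hasSum (hasSum_translate_heatKernel hs (z * Circle.exp u))) z).congr_fun fun k => ?_)
  rw [map_smul, ContinuousMap.smul_apply, ContinuousMap.smul_apply, hcoeff]
  simp only [circleMonomial_apply, smul_eq_mul, mul_zpow, Circle.coe_mul]
  ring

section pinned

variable {lam : Measure C(unitInterval, ℝ)} [IsProbabilityMeasure lam] {θ : ℝ} {v : NNReal}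

lemma angleCoeff_wrap_pathAvg (h1 : ∀ᵐ r ∂lam, r 1 = 0) (hv : v ≠ 0)
    {F : C(unitInterval, ℝ) → ℂ} (hF : Continuous F) {C : ℝ} (hC : ∀ c, ‖F c‖ ≤ C) (k : ℤ) :
    angleCoeff (wrap v (pathAvg lam θ F)) k = circleMonomial k (Circle.exp θ) *
      ∫ c, F c * circleMonomial (-k) (expPath c 1) ∂tiltLaw lam θ v := by
  have hexp (c : C(unitInterval, ℝ)) : expPath c 1 = Circle.exp (c 1) := rfl
  simp only [hexp, mul_comm (F _)]
  rw [angleCoeff_wrap hv (continuous_pathAvg hF hC) (norm_pathAvg_le hC),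
    integral_tiltLaw h1 hF hC (h := fun y => circleMonomial (-k) (Circle.exp y))
      (Continuous.measurable (by fun_prop)) (C' := 1) (fun _ => (Circle.norm_coe _).le),
    ← integral_const_mul]
  congr with w
  rw [Circle.exp_add, circleMonomial_mul_apply]
  simp only [circleMonomial_apply, zpow_neg, Circle.coe_inv]
  have hne := (Circle.exp θ ^ k).coe_ne_zero
  field_simp

theorem wrap_pathAvg_listVal (h1 : ∀ᵐ r ∂lam, r 1 = 0) (hv : v ≠ 0)
    (hfdd : ∀ L : List (NNReal × C(Circle, ℂ)), listTime L ≤ 1 →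
      ∫ c, listVal L (extendPath (expPath c)) ∂tiltLaw lam θ v =
        transfer (fun d => rotAvg (gaussianReal 0 (d * v))) L 1 (Circle.exp θ))
    {L : List (NNReal × C(Circle, ℂ))} (hL : listTime L < 1) (θ₁ : ℝ) :
    wrap v (pathAvg lam θ fun c => listVal L (extendPath (expPath c))) (θ₁ - θ) =
      transfer (fun d => rotAvg (gaussianReal 0 (d * v))) L
        (translate (Circle.exp θ₁) (heatKernel ((1 - listTime L : NNReal) * v)))
        (Circle.exp θ) := by
  obtain ⟨C, hC⟩ := exists_norm_listVal_le L
  have hF := continuous_listVal_expPath L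
  have hC' : ∀ c : C(unitInterval, ℝ), ‖listVal L (extendPath (expPath c))‖ ≤ C := fun c => hC _
  have hs : (0 : ℝ) < (1 - listTime L : NNReal) * v := by
    exact_mod_cast mul_pos (tsub_pos_of_lt hL) (pos_iff_ne_zero.2 hv)
  have hend : listTime L + (1 - listTime L) = 1 := add_tsub_cancel_of_le hL.le
  have hθ₁ : Circle.exp θ * Circle.exp (θ₁ - θ) = Circle.exp θ₁ := by
    rw [← Circle.exp_add, add_sub_cancel]
  rw [← hθ₁]
  refine eq_apply_translate_heatKernel
    (continuous_wrap hv (continuous_pathAvg hF hC') (norm_pathAvg_le hC')) periodic_wrap _ _ hs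
    (fun k => ?_) _
  have hpinned := hfdd (L ++ [(1 - listTime L, circleMonomial (-k))])
    (by simpa [listTime] using hend.le)
  simp only [listVal_append, hend, extendPath_apply _ le_rfl] at hpinned
  have hchar := charFun_gaussianReal_int ((1 - listTime L) * v) (-k)
  rw [NNReal.coe_mul, Int.cast_neg, neg_sq] at hchar
  rw [angleCoeff_wrap_pathAvg h1 hv hF hC', ← hchar]
  refine congrArg _ (hpinned.trans ?_)
  rw [transfer_append, mul_one, rotAvg_circleMonomial, map_smul, Int.cast_neg]
  rfl

end pinned

/-- The angles of the points of the circle at distance less than `ε` from `z`. -/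
def arc (z : Circle) (ε : ℝ) : Set ℝ := {u | dist (Circle.exp u) z < ε}

lemma isOpen_arc (z : Circle) (ε : ℝ) : IsOpen (arc z ε) :=
  isOpen_lt (Circle.exp.continuous.dist continuous_const) continuous_const

lemma add_mem_arc_iff {x y u ε : ℝ} :
    x + u ∈ arc (Circle.exp (x + y)) ε ↔ u ∈ arc (Circle.exp y) ε := by
  have : dist (Circle.exp (x + u)) (Circle.exp (x + y)) = dist (Circle.exp u) (Circle.exp y) := by
    change dist (Circle.exp (x + u) : ℂ) (Circle.exp (x + y)) =
      dist (Circle.exp u : ℂ) (Circle.exp y)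
    simp only [Circle.exp_add, Circle.coe_mul, dist_eq_norm, ← mul_sub, norm_mul, Circle.norm_coe,
      one_mul]
  simp only [arc, Set.mem_ofPred_eq, this]

lemma periodic_indicator_arc {E : Type*} [Zero E] {g : ℝ → E} (hp : g.Periodic (2 * π))
    (z : Circle) (ε : ℝ) : ((arc z ε).indicator g).Periodic (2 * π) := fun u => by
  have : u + 2 * π ∈ arc z ε ↔ u ∈ arc z ε := by
    rw [arc, Set.mem_ofPred_eq, Set.mem_ofPred_eq, Circle.periodic_exp]
  classical
  rw [Set.indicator_apply, Set.indicator_apply, hp, if_congr this rfl rfl]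

lemma angleMeasure_arc_one_ne_zero {ε : ℝ} (hε : 0 < ε) : angleMeasure (arc 1 ε) ≠ 0 := by
  have hpos := ((isOpen_arc 1 ε).inter (isOpen_Ioo (a := -π) (b := π))).measure_pos volume
    ⟨0, by simpa [arc] using hε, by simp [Real.pi_pos]⟩
  rw [Measure.restrict_apply (isOpen_arc 1 ε).measurableSet]
  exact (hpos.trans_le (measure_mono (Set.inter_subset_inter_right _ Set.Ioo_subset_Ioc_self))).ne'

lemma eventually_arc_one_inter_subset {δ : ℝ} (hδ : 0 < δ) :
    ∀ᶠ ε in 𝓝[>] (0 : ℝ), arc 1 ε ∩ Set.Ioc (-π) π ⊆ Metric.ball 0 δ := by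
  have harg : ContinuousAt (fun z : Circle => (z : ℂ).arg) 1 :=
    ContinuousAt.comp (g := Complex.arg) (Complex.continuousAt_arg (by simp))
      continuous_subtype_val.continuousAt
  obtain ⟨ε, hε, hball⟩ := Metric.continuousAt_iff.1 harg δ hδ
  have hlt : ∀ᶠ ε' in 𝓝[>] (0 : ℝ), ε' < ε := mem_nhdsWithin_of_mem_nhds (gt_mem_nhds hε)
  filter_upwards [hlt] with ε' hε' u hu
  have hu' : dist (Circle.exp u : ℂ).arg ((1 : Circle) : ℂ).arg < δ := hball (hu.1.trans hε')
  rw [Circle.arg_exp hu.2.1 hu.2.2] at hu'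
  simpa using hu'

lemma tendsto_setAverage_arc_one {g : ℝ → ℂ} (hg : Continuous g) :
    Tendsto (fun ε => ⨍ u in arc 1 ε, g u ∂angleMeasure) (𝓝[>] 0) (𝓝 (g 0)) := by
  rw [Metric.tendsto_nhds]
  intro η hη
  obtain ⟨δ, hδ, hball⟩ :=
    Metric.continuousAt_iff.1 (hg.continuousAt (x := 0)) (η / 2) (half_pos hη)
  filter_upwards [eventually_arc_one_inter_subset hδ, self_mem_nhdsWithin] with ε hsub hε
  refine (Metric.mem_closedBall.1 ((convex_closedBall (g 0) (η / 2)).set_average_mem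
    Metric.isClosed_closedBall (angleMeasure_arc_one_ne_zero hε) (measure_ne_top _ _) ?_
    (integrable_angleMeasure hg).integrableOn)).trans_lt (half_lt_self hη)
  rw [Measure.restrict_restrict (isOpen_arc 1 ε).measurableSet]
  have harc := (isOpen_arc 1 ε).measurableSet.inter (measurableSet_Ioc (a := -π) (b := π))
  filter_upwards [ae_restrict_mem harc] with u hu
  exact (hball (hsub hu)).le

lemma setIntegral_arc {g : ℝ → ℂ} (hp : g.Periodic (2 * π)) (u₁ ε : ℝ) :
    ∫ u in arc (Circle.exp u₁) ε, g u ∂angleMeasure =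
      ∫ u in arc 1 ε, g (u₁ + u) ∂angleMeasure := by
  have hone (u : ℝ) : u + u₁ ∈ arc (Circle.exp u₁) ε ↔ u ∈ arc 1 ε := by
    simpa [add_comm u₁] using add_mem_arc_iff (x := u₁) (y := 0) (u := u) (ε := ε)
  rw [← integral_indicator (isOpen_arc _ _).measurableSet,
    ← integral_add_angleMeasure (periodic_indicator_arc hp _ ε) u₁,
    ← integral_indicator (isOpen_arc _ _).measurableSet]
  congr with u
  classical
  rw [Set.indicator_apply, Set.indicator_apply, if_congr (hone u) rfl rfl, add_comm]

lemma tendsto_setIntegral_arc_div {g g₁ : ℝ → ℂ} (hg : Continuous g) (hp : g.Periodic (2 * π))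
    (hg₁ : Continuous g₁) (hp₁ : g₁.Periodic (2 * π)) {u : ℝ} (h0 : g₁ u ≠ 0) :
    Tendsto (fun ε => (∫ x in arc (Circle.exp u) ε, g x ∂angleMeasure) /
      ∫ x in arc (Circle.exp u) ε, g₁ x ∂angleMeasure) (𝓝[>] 0) (𝓝 (g u / g₁ u)) := by
  have h := (tendsto_setAverage_arc_one (hg.comp (continuous_const_add u))).div
    (tendsto_setAverage_arc_one (hg₁.comp (continuous_const_add u))) (by simpa using h0)
  simp only [Function.comp_apply, add_zero] at h
  refine h.congr' ?_
  filter_upwards [self_mem_nhdsWithin] with ε hε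
  have hmass : angleMeasure.real (arc 1 ε) ≠ 0 :=
    ENNReal.toReal_ne_zero.2 ⟨angleMeasure_arc_one_ne_zero hε, measure_ne_top _ _⟩
  rw [setIntegral_arc hp, setIntegral_arc hp₁, Pi.div_apply, setAverage_eq, setAverage_eq,
    Complex.real_smul, Complex.real_smul, mul_div_mul_left]
  exact_mod_cast inv_ne_zero hmass

lemma eventually_setIntegral_arc_ne_zero {g : ℝ → ℂ} (hg : Continuous g)
    (hp : g.Periodic (2 * π)) {u : ℝ} (h0 : g u ≠ 0) :
    ∀ᶠ ε in 𝓝[>] 0, ∫ x in arc (Circle.exp u) ε, g x ∂angleMeasure ≠ 0 := by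
  filter_upwards [(tendsto_setIntegral_arc_div hg hp hg hp h0).eventually_ne
    (div_ne_zero h0 h0)] with ε hε
  exact (div_ne_zero_iff.1 hε).1

section conditioning

variable {lam : Measure C(unitInterval, ℝ)} [IsProbabilityMeasure lam] {θ : ℝ} {v : NNReal}

lemma setIntegral_tiltLaw (h1 : ∀ᵐ r ∂lam, r 1 = 0) (hv : v ≠ 0)
    {F : C(unitInterval, ℝ) → ℂ} (hF : Continuous F) {C : ℝ} (hC : ∀ c, ‖F c‖ ≤ C) (θ₁ ε : ℝ) :
    ∫ c in {c | dist (expPath c 1) (Circle.exp θ₁) < ε}, F c ∂tiltLaw lam θ v =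
      ∫ u in arc (Circle.exp (θ₁ - θ)) ε, wrap v (pathAvg lam θ F) u ∂angleMeasure := by
  have hmeas (z : Circle) : MeasurableSet (arc z ε) := (isOpen_arc z ε).measurableSet
  have hind (z : Circle) (u : ℝ) : ‖(arc z ε).indicator (fun _ => (1 : ℂ)) u‖ ≤ 1 :=
    (norm_indicator_le_norm_self _ _).trans_eq norm_one
  have hone : Function.Periodic (fun _ : ℝ => (1 : ℂ)) (2 * π) := fun _ => rfl
  have hshift (u : ℝ) : (arc (Circle.exp θ₁) ε).indicator (fun _ => (1 : ℂ)) (θ + u) =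
      (arc (Circle.exp (θ₁ - θ)) ε).indicator (fun _ => 1) u := by
    have := add_mem_arc_iff (x := θ) (y := θ₁ - θ) (u := u) (ε := ε)
    rw [add_sub_cancel] at this
    classical
    rw [Set.indicator_apply, Set.indicator_apply, if_congr this rfl rfl]
  have hset : MeasurableSet {c : C(unitInterval, ℝ) | dist (expPath c 1) (Circle.exp θ₁) < ε} :=
    (continuous_eval_const (F := C(unitInterval, ℝ)) 1).measurable (hmeas (Circle.exp θ₁))
  have htilt := integral_tiltLaw (v := v) (θ := θ) h1 hF hC
    (measurable_const.indicator (hmeas (Circle.exp θ₁))) (hind (Circle.exp θ₁))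
  simp only [hshift] at htilt
  rw [integral_gaussianReal_eq_wrap hv (continuous_pathAvg hF hC) (norm_pathAvg_le hC)
    (measurable_const.indicator (hmeas _)) (hind _)
    (periodic_indicator_arc hone _ ε)] at htilt
  rw [← integral_indicator hset, ← integral_indicator (hmeas _)]
  classical
  simp only [Set.indicator_apply, ite_mul, one_mul, zero_mul] at htilt ⊢
  exact htilt

end conditioning

lemma IsConditionalLaw.of_map {Ω Ω' E F : Type*} [MeasurableSpace Ω] {P : Measure Ω}
    [MeasurableSpace Ω'] [TopologicalSpace E] [MeasurableSpace E] [OpensMeasurableSpace E]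
    [PseudoMetricSpace F] {X : Ω → E} {Y : Ω → F} {V : Ω → Ω'} {X' : Ω' → E} {Y' : Ω' → F} {y : F}
    {ν : ProbabilityMeasure E} (hV : AEMeasurable V P) (hX : ∀ᵐ ω ∂P, X ω = X' (V ω))
    (hY : ∀ᵐ ω ∂P, Y ω = Y' (V ω)) (hX' : Measurable X')
    (hY' : ∀ ε, MeasurableSet {c | dist (Y' c) y < ε})
    (h : IsConditionalLaw (P.map V) X' Y' y ν) : IsConditionalLaw P X Y y ν := by
  have hset (ε : ℝ) : {ω | dist (Y ω) y < ε} =ᵐ[P] V ⁻¹' {c | dist (Y' c) y < ε} :=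
    hY.mono fun ω hω => congrArg (dist · y < ε) hω
  obtain ⟨-, hpos, hlim⟩ := h
  refine ⟨(hX'.comp_aemeasurable hV).congr (hX.mono fun _ => Eq.symm), fun ε hε h0 => ?_,
    fun f => (hlim f).congr fun ε => ?_⟩
  · rw [measure_congr (hset ε), ← Measure.map_apply_of_aemeasurable hV (hY' ε)] at h0
    exact hpos ε hε h0
  · rw [ProbabilityTheory.cond, ProbabilityTheory.cond, integral_smul_measure,
      integral_smul_measure, Measure.map_apply_of_aemeasurable hV (hY' ε), measure_congr (hset ε),
      Measure.restrict_congr_set (hset ε), Measure.restrict_map_of_aemeasurable hV (hY' ε)]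
    have hm : Measurable fun c => f (X' c) := f.continuous.measurable.comp hX'
    rw [integral_map hV.restrict hm.aestronglyMeasurable]
    refine congrArg _ (integral_congr_ae (ae_restrict_of_ae ?_))
    filter_upwards [hX] with ω hω
    rw [hω]

section conditioning

variable {lam : Measure C(unitInterval, ℝ)} [IsProbabilityMeasure lam] {θ : ℝ} {v : NNReal}

lemma tiltLaw_real_dist_lt (h1 : ∀ᵐ r ∂lam, r 1 = 0) (hv : v ≠ 0) (θ₁ ε : ℝ) :
    ((tiltLaw lam θ v).real {c | dist (expPath c 1) (Circle.exp θ₁) < ε} : ℂ) =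
      ∫ u in arc (Circle.exp (θ₁ - θ)) ε, wrap v (fun _ => 1) u ∂angleMeasure := by
  rw [← pathAvg_one (lam := lam) (θ := θ),
    ← setIntegral_tiltLaw h1 hv continuous_const (C := 1) (fun _ => norm_one.le)]
  simp

lemma continuous_wrap_one (hv : v ≠ 0) : Continuous (wrap v fun _ => 1) :=
  continuous_wrap hv continuous_const (C := 1) fun _ => norm_one.le

lemma wrap_one_ne_zero (hv : v ≠ 0) (u : ℝ) : wrap v (fun _ => 1) u ≠ 0 := by
  rw [← heatKernel_exp hv]
  exact heatKernel_ne_zero hv _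

lemma tiltLaw_dist_lt_ne_zero (h1 : ∀ᵐ r ∂lam, r 1 = 0) (hv : v ≠ 0) (θ₁ : ℝ) {ε : ℝ}
    (hε : 0 < ε) : tiltLaw lam θ v {c | dist (expPath c 1) (Circle.exp θ₁) < ε} ≠ 0 := by
  intro h0
  obtain ⟨δ, hne, hδ⟩ := ((eventually_setIntegral_arc_ne_zero (continuous_wrap_one hv)
    periodic_wrap (wrap_one_ne_zero hv (θ₁ - θ))).and (Ioo_mem_nhdsGT hε)).exists
  have hnull : tiltLaw lam θ v {c | dist (expPath c 1) (Circle.exp θ₁) < δ} = 0 :=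
    measure_mono_null (fun _ hc => lt_trans hc hδ.2) h0
  rw [← tiltLaw_real_dist_lt h1 hv, measureReal_def, hnull] at hne
  exact hne rfl

lemma tendsto_integral_cond_tiltLaw (h1 : ∀ᵐ r ∂lam, r 1 = 0) (hv : v ≠ 0) (θ₁ : ℝ)
    (f : BoundedContinuousFunction C(unitInterval, ℝ) ℝ) :
    Tendsto (fun ε => ∫ c, f c ∂(tiltLaw lam θ v)[|{c | dist (expPath c 1) (Circle.exp θ₁) < ε}])
      (𝓝[>] 0) (𝓝 (∫ c, f c ∂pinnedLaw lam θ v (θ₁ - θ))) := by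
  have hf : Continuous fun c => (f c : ℂ) := Complex.continuous_ofReal.comp f.continuous
  have hC (c : C(unitInterval, ℝ)) : ‖(f c : ℂ)‖ ≤ ‖f‖ := by
    rw [Complex.norm_real]
    exact f.norm_coe_le_norm c
  have hratio := tendsto_setIntegral_arc_div
    (continuous_wrap hv (continuous_pathAvg hf hC) (norm_pathAvg_le (lam := lam) (θ := θ) hC))
    periodic_wrap (continuous_wrap_one hv) periodic_wrap (wrap_one_ne_zero hv (θ₁ - θ))
  rw [← integral_pinnedLaw hv hf hC, integral_complex_ofReal] at hratio
  refine (((Complex.continuous_re.tendsto _).comp hratio).congr fun ε => ?_)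
  rw [Function.comp_apply, ← tiltLaw_real_dist_lt h1 hv, ← setIntegral_tiltLaw h1 hv hf hC,
    integral_complex_ofReal, ← Complex.ofReal_div, Complex.ofReal_re, ProbabilityTheory.cond,
    integral_smul_measure, ENNReal.toReal_inv, smul_eq_mul, div_eq_inv_mul, measureReal_def]

end conditioning

/-- `ρ` has the endpoint and the finite-dimensional distributions of a path of angles whose image
on the circle is a Brownian motion with variance `v` per unit time, started at `z₀` and conditioned
to be at `z₁` at time one. -/
structure IsCircleBridge (v : NNReal) (z₀ z₁ : Circle) (ρ : Measure C(unitInterval, ℝ)) : Prop where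
  ae_expPath_one : ∀ᵐ c ∂ρ, expPath c 1 = z₁
  integral_listVal : ∀ L : List (NNReal × C(Circle, ℂ)), listTime L < 1 →
    ∫ c, listVal L (extendPath (expPath c)) ∂ρ =
      transfer (fun d => rotAvg (gaussianReal 0 (d * v))) L
        (translate z₁ (heatKernel ((1 - listTime L : NNReal) * v))) z₀ /
      translate z₁ (heatKernel v) z₀

lemma isCircleBridge_pinnedLaw {lam : Measure C(unitInterval, ℝ)} [IsProbabilityMeasure lam]
    {θ : ℝ} {v : NNReal} (h1 : ∀ᵐ r ∂lam, r 1 = 0) (hv : v ≠ 0)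
    (hfdd : ∀ L : List (NNReal × C(Circle, ℂ)), listTime L ≤ 1 →
      ∫ c, listVal L (extendPath (expPath c)) ∂tiltLaw lam θ v =
        transfer (fun d => rotAvg (gaussianReal 0 (d * v))) L 1 (Circle.exp θ)) (θ₁ : ℝ) :
    IsCircleBridge v (Circle.exp θ) (Circle.exp θ₁) (pinnedLaw lam θ v (θ₁ - θ)) := by
  have hden : wrap v (fun _ => 1) (θ₁ - θ) =
      translate (Circle.exp θ₁) (heatKernel v) (Circle.exp θ) := by
    simpa [listVal, pathAvg_one] using
      wrap_pathAvg_listVal h1 hv hfdd (L := []) zero_lt_one θ₁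
  refine ⟨ae_pinnedLaw_exp_one h1 θ₁, fun L hL => ?_⟩
  obtain ⟨C, hC⟩ := exists_norm_listVal_le L
  rw [integral_pinnedLaw hv (continuous_listVal_expPath L) (fun c => hC _),
    wrap_pathAvg_listVal h1 hv hfdd hL, hden]

theorem exists_conditionalLaw {Ω : Type*} [MeasurableSpace Ω] {P : Measure Ω}
    [IsProbabilityMeasure P] {W : NNReal → Ω → ℝ} (hW : IsBrownianReal W P) {v : NNReal}
    (hv : v ≠ 0) (θ θ₁ : ℝ) {X : Ω → SkorokhodSpace Circle}
    (hX : ∀ᵐ ω ∂P, ∀ t, X ω t = Circle.exp (θ + √v * W (unitInterval.toNNReal t) ω)) :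
    ∃ ρ : ProbabilityMeasure C(unitInterval, ℝ),
      IsCircleBridge v (Circle.exp θ) (Circle.exp θ₁) ρ ∧
      IsConditionalLaw P X (fun ω => X ω 1) (Circle.exp θ₁)
        (ρ.map continuous_expPath.measurable.aemeasurable) := by
  obtain ⟨lam, V, hlam, h1, hVm, hV, hmap⟩ := exists_map_eq_tiltLaw hW θ v
  have hfdd (L : List (NNReal × C(Circle, ℂ))) :=
    integral_listVal_tiltLaw hW.toIsPreBrownianReal hVm hV hmap (L := L)
  have hXV : ∀ᵐ ω ∂P, X ω = expPath (V ω) := by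
    filter_upwards [hX, hV] with ω hω hω'
    refine Subtype.ext (funext fun t => ?_)
    rw [hω, ← hω']
    rfl
  have hmeas : Measurable expPath := continuous_expPath.measurable
  have hset (ε : ℝ) :
      MeasurableSet {c : C(unitInterval, ℝ) | dist (expPath c 1) (Circle.exp θ₁) < ε} :=
    ((isOpen_arc _ ε).preimage (continuous_eval_const (F := C(unitInterval, ℝ)) 1)).measurableSet
  refine ⟨⟨_, isProbabilityMeasure_pinnedLaw hv (θ₁ - θ)⟩, isCircleBridge_pinnedLaw h1 hv hfdd θ₁,
    IsConditionalLaw.of_map hVm hXV (hXV.mono fun ω hω => congrArg (fun x => x.1 1) hω) hmeas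
      hset ?_⟩
  rw [hmap]
  refine ⟨hmeas.aemeasurable, fun ε hε => tiltLaw_dist_lt_ne_zero h1 hv θ₁ hε, fun f => ?_⟩
  have hInt : ∫ x, f x ∂(pinnedLaw lam θ v (θ₁ - θ)).map expPath =
      ∫ c, f (expPath c) ∂pinnedLaw lam θ v (θ₁ - θ) :=
    integral_map hmeas.aemeasurable f.continuous.aestronglyMeasurable
  exact (tendsto_integral_cond_tiltLaw h1 hv θ₁
    (f.compContinuous ⟨_, continuous_expPath⟩)).mono_right (congrArg 𝓝 hInt.symm).le

/-! ### Convergence of the finite-dimensional distributions -/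

/-- The list of the test functions `H i` at the times `k i` for `i < m`. It is meant for
nondecreasing times with `k 0 = 0`, as the first increment is `k 0 - k 0`. -/
def incrementList {T : Type*} [Sub T] (k : ℕ → T) (H : ℕ → C(Circle, ℂ)) (m : ℕ) :
    List (T × C(Circle, ℂ)) :=
  (List.range m).map fun i => (k i - k (i - 1), H i)

section incrementList
variable {T : Type*} [Sub T]

lemma incrementList_succ (k : ℕ → T) (H : ℕ → C(Circle, ℂ)) (m : ℕ) :
    incrementList k H (m + 1) = incrementList k H m ++ [(k m - k (m - 1), H m)] := by
  simp [incrementList, List.range_succ]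

variable [AddCommMonoid T] [PartialOrder T] [OrderedSub T] [CanonicallyOrderedAdd T] {k : ℕ → T}
  (hk : Monotone k) (hk0 : k 0 = 0) (H : ℕ → C(Circle, ℂ)) (m : ℕ)
include hk hk0

lemma listTime_incrementList : listTime (incrementList k H m) = k (m - 1) := by
  induction m with
  | zero => exact hk0.symm
  | succ m ih =>
    rw [incrementList_succ, listTime, List.map_append, List.sum_append, ← listTime, ih]
    simpa using add_tsub_cancel_of_le (hk (Nat.sub_le m 1))

lemma listVal_incrementList (s : T → Circle) :
    listVal (incrementList k H m) s = ∏ i ∈ Finset.range m, H i (s (k i)) := by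
  induction m with
  | zero => simp [incrementList, listVal]
  | succ m ih =>
    rw [incrementList_succ, listVal_append, ih, listTime_incrementList hk hk0,
      add_tsub_cancel_of_le (hk (Nat.sub_le m 1)), Finset.prod_range_succ]

end incrementList

lemma monotone_nat_mul_div (n m : ℕ) : Monotone fun i => n * i / m := fun _ _ h =>
  Nat.div_le_div_right (Nat.mul_le_mul_left n h)

lemma monotone_natCast_div (m : ℕ) : Monotone fun i : ℕ => (i : NNReal) / m := fun _ _ h =>
  div_le_div_of_nonneg_right (Nat.cast_le.2 h) zero_le

lemma tendsto_nat_mul_div_div {m : ℕ} (hm : 0 < m) (i : ℕ) :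
    Tendsto (fun n : ℕ => ((n * i / m : ℕ) : ℝ) / n) atTop (𝓝 (i / m)) := by
  have hfloor := (tendsto_nat_floor_mul_div_atTop (R := ℝ) (a := i / m) (by positivity)).comp
    tendsto_natCast_atTop_atTop
  refine hfloor.congr fun n => ?_
  rw [Function.comp_apply, ← Nat.floor_div_eq_div (K := ℝ)]
  push_cast
  ring_nf

lemma tendsto_nat_mul_div_sub_div {m : ℕ} (hm : 0 < m) {i j : ℕ} (hij : i ≤ j) :
    Tendsto (fun n : ℕ => ((n * j / m - n * i / m : ℕ) : ℝ) / n) atTop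
      (𝓝 ((j / m - i / m : NNReal) : ℝ)) := by
  have hlim := (tendsto_nat_mul_div_div hm j).sub (tendsto_nat_mul_div_div hm i)
  rw [NNReal.coe_sub (monotone_natCast_div m hij)]
  simp only [NNReal.coe_div, NNReal.coe_natCast]
  refine hlim.congr fun n => ?_
  rw [Nat.cast_sub (monotone_nat_mul_div n m hij), sub_div]

lemma tendsto_transfer {ι κ T T₀ : Type*} {l : Filter ι}
    {A : ι → T → C(Circle, ℂ) →L[ℂ] C(Circle, ℂ)} {A₀ : T₀ → C(Circle, ℂ) →L[ℂ] C(Circle, ℂ)}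
    {d : ι → κ → T} {d₀ : κ → T₀}
    (hA : ∀ i f f₀, Tendsto f l (𝓝 f₀) →
      Tendsto (fun n => A n (d n i) (f n)) l (𝓝 (A₀ (d₀ i) f₀)))
    (H : κ → C(Circle, ℂ)) (L : List κ) {f : ι → C(Circle, ℂ)} {f₀ : C(Circle, ℂ)}
    (hf : Tendsto f l (𝓝 f₀)) :
    Tendsto (fun n => transfer (A n) (L.map fun i => (d n i, H i)) (f n)) l
      (𝓝 (transfer A₀ (L.map fun i => (d₀ i, H i)) f₀)) := by
  induction L with
  | nil => exact hf
  | cons i L ih => exact hA i _ _ (ih.const_mul (H i))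

section scaling
variable {b : ℝ} {β : ℕ → ℝ} (hb : 0 < b) (hβ : Tendsto (fun n : ℕ => β n / n) atTop (𝓝 b))
  {v : NNReal} (hv : (v : ℝ) = 1 / b)
include hb hβ hv

lemma tendsto_rotAvg_convPow {l : ℕ → ℕ} {s : NNReal}
    (hl : Tendsto (fun n : ℕ => (l n : ℝ) / n) atTop (𝓝 s)) {f : ℕ → C(Circle, ℂ)}
    {f₀ : C(Circle, ℂ)} (hf : Tendsto f atTop (𝓝 f₀)) :
    Tendsto (fun n => rotAvg (convPow (stepLaw (β n)) (l n)) (f n)) atTop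
      (𝓝 (rotAvg (gaussianReal 0 (s * v)) f₀)) := by
  refine tendsto_rotAvg _ (fun k => ?_) hf
  have hcoeff := (Complex.continuous_ofReal.tendsto _).comp
    (tendsto_stepCoeff_pow (tendsto_atTop_of_ratio hb hβ) (tendsto_ratio hb hβ hl) k)
  rw [charFun_gaussianReal_int, NNReal.coe_mul, hv, mul_one_div]
  simpa [Function.comp_def, charFun_convPow, charFun_stepLaw] using hcoeff

lemma tendsto_transfer_incrementList {m : ℕ} (hm : 0 < m) (H : ℕ → C(Circle, ℂ)) (q : ℕ)
    {f : ℕ → C(Circle, ℂ)} {f₀ : C(Circle, ℂ)} (hf : Tendsto f atTop (𝓝 f₀)) :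
    Tendsto (fun n => transfer (fun d => rotAvg (convPow (stepLaw (β n)) d))
        (incrementList (fun i => n * i / m) H q) (f n)) atTop
      (𝓝 (transfer (fun d => rotAvg (gaussianReal 0 (d * v)))
        (incrementList (fun i : ℕ => (i : NNReal) / m) H q) f₀)) :=
  tendsto_transfer (A := fun n d => rotAvg (convPow (stepLaw (β n)) d))
    (A₀ := fun d => rotAvg (gaussianReal 0 (d * v)))
    (fun i _ _ => tendsto_rotAvg_convPow hb hβ hv
      (tendsto_nat_mul_div_sub_div hm (Nat.sub_le i 1))) H _ hf

end scaling

lemma integral_prod_spins (β x y : ℝ) {n : ℕ} (hn : 0 < n) (m : ℕ) (H : ℕ → C(Circle, ℂ)) :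
    ∫ θ, ∏ i ∈ Finset.range (m + 1), H i (spins n θ (n * i / (m + 1))) ∂gibbsMeasure n β x y =
      transfer (fun d => rotAvg (convPow (stepLaw β) d))
          (incrementList (fun i => n * i / (m + 1)) H (m + 1))
          (translate (Circle.exp y) (chainKernel β (n - n * m / (m + 1)))) (Circle.exp x) /
        translate (Circle.exp y) (chainKernel β n) (Circle.exp x) := by
  have hmono := monotone_nat_mul_div n (m + 1)
  have hzero : n * 0 / (m + 1) = 0 := by simp
  have htime := listTime_incrementList hmono hzero H (m + 1)
  have hlt : listTime (incrementList (fun i => n * i / (m + 1)) H (m + 1)) < n := by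
    rw [htime, Nat.div_lt_iff_lt_mul m.succ_pos]
    exact Nat.mul_lt_mul_of_pos_left m.lt_succ_self hn
  simpa only [listVal_incrementList hmono hzero, htime, Nat.add_sub_cancel] using
    integral_listVal_gibbsMeasure β x y _ hlt

lemma IsCircleBridge.integral_prod {v : NNReal} {z₀ z₁ : Circle} {ρ : Measure C(unitInterval, ℝ)}
    (hρ : IsCircleBridge v z₀ z₁ ρ) (m : ℕ) (H : ℕ → C(Circle, ℂ)) :
    ∫ c, ∏ i ∈ Finset.range (m + 1), H i (extendPath (expPath c) (i / (m + 1 : ℕ))) ∂ρ =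
      transfer (fun d => rotAvg (gaussianReal 0 (d * v)))
          (incrementList (fun i : ℕ => (i : NNReal) / (m + 1 : ℕ)) H (m + 1))
          (translate z₁ (heatKernel ((1 - m / (m + 1 : ℕ) : NNReal) * v))) z₀ /
        translate z₁ (heatKernel v) z₀ := by
  have hmono := monotone_natCast_div (m + 1)
  have hzero : ((0 : ℕ) : NNReal) / (m + 1 : ℕ) = 0 := by simp
  have htime := listTime_incrementList hmono hzero H (m + 1)
  have hlt : listTime (incrementList (fun i : ℕ => (i : NNReal) / (m + 1 : ℕ)) H (m + 1)) < 1 := by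
    rw [htime, div_lt_one (by positivity)]
    exact_mod_cast m.lt_succ_self
  simpa only [listVal_incrementList hmono hzero, htime, Nat.add_sub_cancel] using
    hρ.integral_listVal _ hlt

theorem tendsto_integral_prod_spins {b : ℝ} {β : ℕ → ℝ} (hb : 0 < b)
    (hβ : Tendsto (fun n : ℕ => β n / n) atTop (𝓝 b)) {v : NNReal} (hv : (v : ℝ) = 1 / b)
    {x y : ℝ} {ρ : Measure C(unitInterval, ℝ)}
    (hρ : IsCircleBridge v (Circle.exp x) (Circle.exp y) ρ) (m : ℕ) (H : ℕ → C(Circle, ℂ)) :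
    Tendsto (fun n => ∫ θ, ∏ i ∈ Finset.range (m + 1), H i (spins n θ (n * i / (m + 1)))
        ∂gibbsMeasure n (β n) x y) atTop
      (𝓝 (∫ c, ∏ i ∈ Finset.range (m + 1),
        H i (extendPath (expPath c) (i / (m + 1 : ℕ))) ∂ρ)) := by
  have hv0 : v ≠ 0 := by
    rintro rfl
    exact (one_div_pos.2 hb).ne hv
  have hrest : Tendsto (fun n => ((n - n * m / (m + 1) : ℕ) : ℝ) / n) atTop
      (𝓝 ((1 - m / (m + 1 : ℕ) : NNReal) : ℝ)) := by
    simpa only [div_self (Nat.cast_ne_zero.2 m.succ_ne_zero : ((m + 1 : ℕ) : NNReal) ≠ 0),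
      Nat.mul_div_cancel _ m.succ_pos, Nat.succ_eq_add_one] using
      tendsto_nat_mul_div_sub_div m.succ_pos m.le_succ
  have hrest_pos : (m : NNReal) / (m + 1 : ℕ) < 1 := by
    rw [div_lt_one (by positivity)]
    exact_mod_cast m.lt_succ_self
  have heval {g : ℕ → C(Circle, ℂ)} {g₀ : C(Circle, ℂ)} (hg : Tendsto g atTop (𝓝 g₀)) :
      Tendsto (fun n => g n (Circle.exp x)) atTop (𝓝 (g₀ (Circle.exp x))) :=
    ((continuous_eval_const (F := C(Circle, ℂ)) (Circle.exp x)).tendsto _).comp hg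
  have htranslate {g : ℕ → C(Circle, ℂ)} {g₀ : C(Circle, ℂ)} (hg : Tendsto g atTop (𝓝 g₀)) :
      Tendsto (fun n => translate (Circle.exp y) (g n)) atTop (𝓝 (translate (Circle.exp y) g₀)) :=
    ((continuous_translate _).tendsto _).comp hg
  have hkernel := htranslate (tendsto_chainKernel_of_ratio hb hβ
    (by exact_mod_cast tsub_pos_of_lt hrest_pos) hrest)
  have hnum := heval (tendsto_transfer_incrementList hb hβ hv m.succ_pos H (m + 1) hkernel)
  have hden := heval (htranslate (tendsto_chainKernel_self hb hβ))
  rw [← hv] at hden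
  rw [div_eq_mul_one_div, ← hv] at hnum
  rw [hρ.integral_prod]
  refine (hnum.div hden (heatKernel_ne_zero hv0 _)).congr' ?_
  filter_upwards [eventually_gt_atTop 0] with n hn
  rw [integral_prod_spins _ _ _ hn]
  rfl

/-! ### Weak convergence of the chain -/

section lawFunctional
variable {Ω X : Type*} [TopologicalSpace Ω] [MeasurableSpace Ω] [OpensMeasurableSpace Ω]
  [TopologicalSpace X] [CompactSpace X]

lemma integrable_continuousMap_comp (μ : Measure Ω) [IsFiniteMeasure μ] (Y : C(Ω, X))
    (f : C(X, ℂ)) : Integrable (fun ω => f (Y ω)) μ :=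
  .of_bound (f.continuous.comp Y.continuous).aestronglyMeasurable ‖f‖
    (ae_of_all _ fun _ => f.norm_coe_le_norm _)

/-- The expectation functional `f ↦ E f(Y)` of a continuous random variable `Y` with values in a
compact space. -/
def lawFunctional (μ : Measure Ω) [IsProbabilityMeasure μ] (Y : C(Ω, X)) : C(X, ℂ) →L[ℂ] ℂ :=
  LinearMap.mkContinuous
    { toFun := fun f => ∫ ω, f (Y ω) ∂μ
      map_add' := fun f g => integral_add (integrable_continuousMap_comp μ Y f)
        (integrable_continuousMap_comp μ Y g)
      map_smul' := fun a f => integral_const_mul a _ } 1 fun f => by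
    rw [one_mul]
    exact (norm_integral_le_of_norm_le_const (C := ‖f‖)
      (ae_of_all _ fun _ => f.norm_coe_le_norm _)).trans (by simp)

lemma opNorm_lawFunctional_le (μ : Measure Ω) [IsProbabilityMeasure μ] (Y : C(Ω, X)) :
    ‖lawFunctional μ Y‖ ≤ 1 := LinearMap.mkContinuous_norm_le _ zero_le_one _

end lawFunctional

section productFunctions
variable {ι : Type*} [Fintype ι] {X : ι → Type*} [∀ i, TopologicalSpace (X i)]
  [∀ i, CompactSpace (X i)] [∀ i, T2Space (X i)]

/-- The functions on a product space that are products of functions of one coordinate. -/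
def productFunctions (X : ι → Type*) [∀ i, TopologicalSpace (X i)] :
    Submonoid C(∀ i, X i, ℂ) where
  carrier := {f | ∃ H : ∀ i, C(X i, ℂ), ∀ z, f z = ∏ i, H i (z i)}
  one_mem' := ⟨1, fun z => by simp⟩
  mul_mem' := by
    rintro f g ⟨H, hH⟩ ⟨K, hK⟩
    exact ⟨H * K, fun z => by simp [hH, hK, Finset.prod_mul_distrib]⟩

lemma topologicalClosure_span_productFunctions :
    (Submodule.span ℂ (productFunctions X : Set C(∀ i, X i, ℂ))).topologicalClosure = ⊤ := by
  refine topologicalClosure_span_eq_top_of_separatesPoints _ ?_ fun x y hxy => ?_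
  · rintro f ⟨H, hH⟩
    exact ⟨star H, fun z => by simp [hH]⟩
  · classical
    obtain ⟨i, hi⟩ := Function.ne_iff.1 hxy
    obtain ⟨h, h0, h1, -⟩ := exists_continuous_zero_one_of_isClosed (isClosed_singleton (x := x i))
      (isClosed_singleton (x := y i)) (Set.disjoint_singleton.2 hi)
    refine ⟨⟨fun z => (h (z i) : ℂ), by fun_prop⟩,
      ⟨Function.update 1 i ⟨fun u => (h u : ℂ), by fun_prop⟩, fun z => ?_⟩, ?_⟩
    · rw [Fintype.prod_eq_single i fun j hj => by simp [hj]]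
      simp
    · simp [h0 rfl, h1 rfl]

theorem tendsto_integral_of_tendsto_integral_prod {κ : Type*} {l : Filter κ} {Ω : κ → Type*}
    [∀ k, TopologicalSpace (Ω k)] [∀ k, MeasurableSpace (Ω k)] [∀ k, OpensMeasurableSpace (Ω k)]
    {Ω₀ : Type*} [TopologicalSpace Ω₀] [MeasurableSpace Ω₀] [OpensMeasurableSpace Ω₀]
    {μ : ∀ k, Measure (Ω k)} [∀ k, IsProbabilityMeasure (μ k)] {μ₀ : Measure Ω₀}
    [IsProbabilityMeasure μ₀] {Y : ∀ k, C(Ω k, ∀ i, X i)} {Y₀ : C(Ω₀, ∀ i, X i)}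
    (h : ∀ H : ∀ i, C(X i, ℂ), Tendsto (fun k => ∫ ω, ∏ i, H i (Y k ω i) ∂μ k) l
      (𝓝 (∫ ω, ∏ i, H i (Y₀ ω i) ∂μ₀))) (f : C(∀ i, X i, ℂ)) :
    Tendsto (fun k => ∫ ω, f (Y k ω) ∂μ k) l (𝓝 (∫ ω, f (Y₀ ω) ∂μ₀)) := by
  refine tendsto_clm_apply_of_topologicalClosure_span_eq_top (T₀ := lawFunctional μ₀ Y₀)
    (fun k => opNorm_lawFunctional_le (μ k) (Y k)) topologicalClosure_span_productFunctions ?_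
    tendsto_const_nhds
  rintro g ⟨H, hH⟩
  change Tendsto (fun k => ∫ ω, g (Y k ω) ∂μ k) l (𝓝 (∫ ω, g (Y₀ ω) ∂μ₀))
  simpa only [hH] using h H

end productFunctions

/-- The spins of the chain at the vertices `⌊n j / m⌋`, for `0 ≤ j ≤ m`. -/
def gridSpins (n m : ℕ) : C(Fin (n + 1) → ℝ, Fin (m + 1) → Circle) where
  toFun θ j := spins n θ (n * j / m)
  continuous_toFun := by fun_prop

/-- The values of a path on the circle at the times `j / m`, for `0 ≤ j ≤ m`. -/
def gridValues (m : ℕ) : C(C(unitInterval, ℝ), Fin (m + 1) → Circle) where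
  toFun c j := extendPath (expPath c) ((j : ℕ) / m)
  continuous_toFun := continuous_pi fun _ =>
    Circle.exp.continuous.comp (continuous_eval_const (F := C(unitInterval, ℝ)) _)

lemma ae_spins_last {n : ℕ} (hn : 0 < n) (β x y : ℝ) :
    ∀ᵐ θ ∂gibbsMeasure n β x y, spins n θ n = Circle.exp y := by
  have hsite : siteMeasure n x y (Fin.last n) = Measure.dirac y := by
    rw [siteMeasure, if_neg fun h => hn.ne' (congrArg Fin.val h), if_pos rfl]
  have hlast : ∀ᵐ u ∂siteMeasure n x y (Fin.last n), u = y := by simp [hsite, ae_dirac_eq]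
  refine (withDensity_absolutelyContinuous _ _).ae_le ?_
  filter_upwards [Measure.tendsto_eval_ae_ae.eventually hlast] with θ hθ
  rw [spins, dif_pos n.lt_succ_self, ← hθ]
  rfl

lemma ae_gridSpins_last {n m : ℕ} (hn : 0 < n) (hm : 0 < m) (β x y : ℝ) :
    ∀ᵐ θ ∂gibbsMeasure n β x y, gridSpins n m θ (Fin.last m) = Circle.exp y := by
  filter_upwards [ae_spins_last hn β x y] with θ hθ
  rw [← hθ]
  exact congrArg (spins n θ) (Nat.mul_div_cancel n hm)

lemma gridValues_last {m : ℕ} (hm : 0 < m) (c : C(unitInterval, ℝ)) :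
    gridValues m c (Fin.last m) = expPath c 1 := by
  have h : ((Fin.last m : ℕ) : NNReal) / m = 1 := div_self (Nat.cast_ne_zero.2 hm.ne')
  exact (congrArg (extendPath (expPath c)) h).trans (extendPath_apply _ le_rfl)

section chain
variable {b : ℝ} {β : ℕ → ℝ} (hb : 0 < b) (hβ : Tendsto (fun n : ℕ => β n / n) atTop (𝓝 b))
  {v : NNReal} (hv : (v : ℝ) = 1 / b) {x y : ℝ} {ρ : Measure C(unitInterval, ℝ)}
  [IsProbabilityMeasure ρ] (hρ : IsCircleBridge v (Circle.exp x) (Circle.exp y) ρ)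
include hb hβ hv hρ

theorem tendsto_integral_gridSpins {m : ℕ} (hm : 0 < m) (f : C(Fin (m + 1) → Circle, ℂ)) :
    Tendsto (fun n => ∫ θ, f (gridSpins n m θ) ∂gibbsMeasure n (β n) x y) atTop
      (𝓝 (∫ c, f (gridValues m c) ∂ρ)) := by
  refine tendsto_integral_of_tendsto_integral_prod (fun H => ?_) f
  obtain ⟨m, rfl⟩ : ∃ k, m = k + 1 := Nat.exists_eq_add_one_of_ne_zero hm.ne'
  let K (i : ℕ) : C(Circle, ℂ) := if h : i < m + 2 then H ⟨i, h⟩ else 1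
  have hK (i : Fin (m + 1)) : K i = H i.castSucc := dif_pos (i.2.trans (Nat.lt_succ_self _))
  have hbridge : ∫ c, ∏ i, H i (gridValues (m + 1) c i) ∂ρ =
      (∫ c, ∏ i ∈ Finset.range (m + 1), K i (extendPath (expPath c) (i / (m + 1 : ℕ))) ∂ρ) *
        H (Fin.last _) (Circle.exp y) := by
    rw [← integral_mul_const]
    refine integral_congr_ae ?_
    filter_upwards [hρ.ae_expPath_one] with c hc
    rw [Fin.prod_univ_castSucc, Finset.prod_range, gridValues_last hm, hc]
    simp only [hK]
    rfl
  rw [hbridge]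
  refine ((tendsto_integral_prod_spins hb hβ hv hρ m K).mul_const _).congr' ?_
  filter_upwards [eventually_gt_atTop 0] with n hn
  rw [← integral_mul_const]
  refine integral_congr_ae ?_
  filter_upwards [ae_gridSpins_last hn hm (β n) x y] with θ hθ
  rw [Fin.prod_univ_castSucc, Finset.prod_range, hθ]
  simp only [hK]
  rfl

end chain

section distribution
variable {ι E Ω₀ : Type*} {l : Filter ι} {Ω : ι → Type*} [∀ i, MeasurableSpace (Ω i)]
  [MeasurableSpace Ω₀] {μ : ∀ i, Measure (Ω i)} [∀ i, IsProbabilityMeasure (μ i)] {μ₀ : Measure Ω₀}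
  [IsProbabilityMeasure μ₀] [MeasurableSpace E] {X : ∀ i, Ω i → E} {Z : Ω₀ → E}

section topological
variable [TopologicalSpace E] [OpensMeasurableSpace E]

lemma tendstoInDistribution_iff_forall_integral_tendsto (hX : ∀ i, AEMeasurable (X i) (μ i))
    (hZ : AEMeasurable Z μ₀) :
    TendstoInDistribution X l Z μ μ₀ ↔ ∀ f : BoundedContinuousFunction E ℝ,
      Tendsto (fun i => ∫ ω, f (X i ω) ∂μ i) l (𝓝 (∫ ω, f (Z ω) ∂μ₀)) := by
  have hmap (f : BoundedContinuousFunction E ℝ) :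
      ∫ z, f z ∂μ₀.map Z = ∫ ω, f (Z ω) ∂μ₀ :=
    integral_map hZ f.continuous.measurable.aestronglyMeasurable
  have hmap' (f : BoundedContinuousFunction E ℝ) (i : ι) :
      ∫ z, f z ∂(μ i).map (X i) = ∫ ω, f (X i ω) ∂μ i :=
    integral_map (hX i) f.continuous.measurable.aestronglyMeasurable
  simp only [← hmap, ← hmap']
  exact ⟨fun h => ProbabilityMeasure.tendsto_iff_forall_integral_tendsto.1 h.tendsto,
    fun h => ⟨hX, hZ, ProbabilityMeasure.tendsto_iff_forall_integral_tendsto.2 h⟩⟩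

end topological

variable [PseudoEMetricSpace E] [OpensMeasurableSpace E]

lemma tendstoInDistribution_of_forall_lipschitz [l.IsCountablyGenerated]
    (hX : ∀ i, AEMeasurable (X i) (μ i)) (hZ : AEMeasurable Z μ₀)
    (h : ∀ (f : BoundedContinuousFunction E ℝ) (K : NNReal), LipschitzWith K f →
      Tendsto (fun i => ∫ ω, f (X i ω) ∂μ i) l (𝓝 (∫ ω, f (Z ω) ∂μ₀))) :
    TendstoInDistribution X l Z μ μ₀ := by
  refine ⟨hX, hZ, tendsto_iff_forall_lipschitz_integral_tendsto.2 ?_⟩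
  rintro f ⟨C, hC⟩ ⟨K, hK⟩
  have hmap : ∫ z, f z ∂μ₀.map Z = ∫ ω, f (Z ω) ∂μ₀ :=
    integral_map hZ hK.continuous.measurable.aestronglyMeasurable
  have hmap' (i : ι) : ∫ z, f z ∂(μ i).map (X i) = ∫ ω, f (X i ω) ∂μ i :=
    integral_map (hX i) hK.continuous.measurable.aestronglyMeasurable
  simp only [ProbabilityMeasure.coe_mk, hmap, hmap']
  exact h (.mkOfBound ⟨f, hK.continuous⟩ C hC) K hK

lemma edist_integral_le {S : Type*} [MeasurableSpace S] {μ : Measure S} [IsFiniteMeasure μ]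
    {f : BoundedContinuousFunction E ℝ} {K : NNReal} (hK : LipschitzWith K f) {A B : S → E}
    (hA : AEMeasurable A μ) (hB : AEMeasurable B μ) :
    edist (∫ ω, f (A ω) ∂μ) (∫ ω, f (B ω) ∂μ) ≤ K * ∫⁻ ω, edist (A ω) (B ω) ∂μ := by
  have hInt {A : S → E} (hA : AEMeasurable A μ) : Integrable (fun ω => f (A ω)) μ :=
    .of_bound (f.continuous.measurable.comp_aemeasurable hA).aestronglyMeasurable ‖f‖
      (ae_of_all _ fun _ => f.norm_coe_le_norm _)
  rw [edist_eq_enorm_sub, ← integral_sub (hInt hA) (hInt hB),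
    ← lintegral_const_mul' _ _ ENNReal.coe_ne_top]
  refine (enorm_integral_le_lintegral_enorm _).trans (lintegral_mono fun ω => ?_)
  rw [← edist_eq_enorm_sub]
  exact hK _ _

end distribution

lemma tendsto_of_forall_eventually_edist_le {ι κ R : Type*} [PseudoEMetricSpace R] {l : Filter ι}
    {l' : Filter κ} [l'.NeBot] {F : ι → R} {G : κ → ι → R} {g : κ → R} {a : R}
    (hG : ∀ᶠ m in l', Tendsto (G m) l (𝓝 (g m))) (hg : Tendsto g l' (𝓝 a))
    (hF : ∀ ε > 0, ∀ᶠ m in l', ∀ᶠ n in l, edist (F n) (G m n) ≤ ε) : Tendsto F l (𝓝 a) := by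
  refine Metric.nhds_basis_closedEBall.tendsto_right_iff.2 fun ε hε => ?_
  have hε3 : 0 < ε / 3 := ENNReal.div_pos hε.ne' (by simp)
  obtain ⟨m, hGm, hgm, hFm⟩ := (hG.and ((hg.eventually
    (Metric.closedEBall_mem_nhds a hε3)).and (hF _ hε3))).exists
  filter_upwards [hFm, hGm.eventually (Metric.closedEBall_mem_nhds _ hε3)] with n hn hn'
  calc edist (F n) a ≤ edist (F n) (G m n) + edist (G m n) (g m) + edist (g m) a :=
        edist_triangle4 _ _ _ _
    _ ≤ ε / 3 + ε / 3 + ε / 3 := add_le_add (add_le_add hn hn') hgm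
    _ = ε := ENNReal.add_thirds ε

section approximation
variable {ι κ E Ω₀ : Type*} {l : Filter ι} [l.IsCountablyGenerated] {l' : Filter κ} [l'.NeBot]
  {Ω : ι → Type*} [∀ i, MeasurableSpace (Ω i)] [MeasurableSpace Ω₀] {μ : ∀ i, Measure (Ω i)}
  [∀ i, IsProbabilityMeasure (μ i)] {μ₀ : Measure Ω₀} [IsProbabilityMeasure μ₀]
  [MeasurableSpace E] [PseudoEMetricSpace E] [OpensMeasurableSpace E] {X : ∀ i, Ω i → E}
  {Y : κ → ∀ i, Ω i → E} {Z : Ω₀ → E} {Z' : κ → Ω₀ → E}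

theorem tendstoInDistribution_of_approx (hX : ∀ i, AEMeasurable (X i) (μ i))
    (hZ : AEMeasurable Z μ₀) (hY : ∀ᶠ m in l', TendstoInDistribution (Y m) l (Z' m) μ μ₀)
    (hZZ' : Tendsto (fun m => ∫⁻ ω, edist (Z ω) (Z' m ω) ∂μ₀) l' (𝓝 0))
    (hXY : ∀ ε > 0, ∀ᶠ m in l', ∀ᶠ i in l, ∫⁻ ω, edist (X i ω) (Y m i ω) ∂μ i ≤ ε) :
    TendstoInDistribution X l Z μ μ₀ := by
  refine tendstoInDistribution_of_forall_lipschitz hX hZ fun f K hK => ?_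
  refine tendsto_of_forall_eventually_edist_le (l' := l')
    (G := fun m i => ∫ ω, f (Y m i ω) ∂μ i) (g := fun m => ∫ ω, f (Z' m ω) ∂μ₀) ?_ ?_ ?_
  · filter_upwards [hY] with m hm
    exact (tendstoInDistribution_iff_forall_integral_tendsto hm.forall_aemeasurable
      hm.aemeasurable_limit).1 hm f
  · have hlip : ∀ᶠ m in l', edist (∫ ω, f (Z' m ω) ∂μ₀) (∫ ω, f (Z ω) ∂μ₀) ≤
        K * ∫⁻ ω, edist (Z ω) (Z' m ω) ∂μ₀ := by
      filter_upwards [hY] with m hm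
      rw [edist_comm]
      exact edist_integral_le hK hZ hm.aemeasurable_limit
    refine tendsto_iff_edist_tendsto_0.2
      (tendsto_of_tendsto_of_tendsto_of_le_of_le' tendsto_const_nhds ?_
        (.of_forall fun _ => zero_le) hlip)
    simpa using ENNReal.Tendsto.const_mul hZZ' (Or.inr ENNReal.coe_ne_top)
  · intro ε hε
    have hε' : 0 < ε / K := ENNReal.div_pos hε.ne' ENNReal.coe_ne_top
    filter_upwards [hY, hXY _ hε'] with m hm hXYm
    filter_upwards [hXYm] with i hi
    calc edist (∫ ω, f (X i ω) ∂μ i) (∫ ω, f (Y m i ω) ∂μ i)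
        ≤ K * ∫⁻ ω, edist (X i ω) (Y m i ω) ∂μ i :=
          edist_integral_le hK (hX i) (hm.forall_aemeasurable i)
      _ ≤ K * (ε / K) := by gcongr
      _ ≤ ε := ENNReal.mul_div_le

end approximation

lemma lintegral_pow_le_lintegral_pow {Ω : Type*} [MeasurableSpace Ω] {μ : Measure Ω}
    [IsProbabilityMeasure μ] {f : Ω → ENNReal} (hf : AEMeasurable f μ) {k : ℕ} (hk : 0 < k) :
    (∫⁻ ω, f ω ∂μ) ^ k ≤ ∫⁻ ω, f ω ^ k ∂μ := by
  have hk' : (1 : ℝ) ≤ k := by exact_mod_cast hk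
  have h := eLpNorm'_le_eLpNorm'_of_exponent_le one_pos hk' μ hf.aestronglyMeasurable
  simp only [eLpNorm'_eq_lintegral_enorm, enorm_eq_self, ENNReal.rpow_one, div_one,
    ENNReal.rpow_natCast] at h
  simpa only [one_div, ENNReal.rpow_inv_natCast_pow hk.ne'] using pow_le_pow_left' h k

lemma lipschitzWith_stepPath {E : Type*} [PseudoEMetricSpace E] (m : ℕ) :
    LipschitzWith 1 (stepPath m : (Fin (m + 1) → E) → SkorokhodSpace E) := fun g g' => by
  rw [ENNReal.coe_one, one_mul]
  exact (edist_le_iSup _ _).trans (iSup_le fun t => edist_le_pi_edist g g' _)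

lemma continuous_stepPath_gridSpins (n m : ℕ) :
    Continuous fun θ => stepPath m (gridSpins n m θ) :=
  (lipschitzWith_stepPath m).continuous.comp (gridSpins n m).continuous

lemma continuous_stepPath_gridValues (m : ℕ) : Continuous fun c => stepPath m (gridValues m c) :=
  (lipschitzWith_stepPath m).continuous.comp (gridValues m).continuous

lemma continuous_spinPath (n : ℕ) : Continuous (spinPath n) :=
  (lipschitzWith_stepPath n).continuous.comp
    (by fun_prop : Continuous fun (θ : Fin (n + 1) → ℝ) j => Circle.exp (θ j))

lemma edist_floor_div_le {m : ℕ} (hm : 0 < m) (t : unitInterval) :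
    edist t (Set.projIcc 0 1 zero_le_one (⌊(m : ℝ) * t⌋₊ / m)) ≤ (m : ENNReal)⁻¹ := by
  have hm' : (0 : ℝ) < m := Nat.cast_pos.2 hm
  have hle : (⌊(m : ℝ) * t⌋₊ : ℝ) / m ≤ t := by
    rw [div_le_iff₀' hm']
    exact Nat.floor_le (mul_nonneg hm'.le t.2.1)
  have hlt : (t : ℝ) ≤ ⌊(m : ℝ) * t⌋₊ / m + (m : ℝ)⁻¹ := by
    rw [inv_eq_one_div, ← add_div, le_div_iff₀' hm']
    exact (Nat.lt_floor_add_one _).le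
  rw [Set.projIcc_of_mem zero_le_one ⟨by positivity, hle.trans t.2.2⟩, edist_dist,
    Subtype.dist_eq, Real.dist_eq, abs_of_nonneg (sub_nonneg.2 hle), ← ENNReal.ofReal_natCast,
    ← ENNReal.ofReal_inv_of_pos hm']
  exact ENNReal.ofReal_le_ofReal (sub_le_iff_le_add'.2 hlt)

lemma tendsto_edist_expPath_gridValues (c : C(unitInterval, ℝ)) :
    Tendsto (fun m : ℕ => edist (expPath c) (stepPath m (gridValues m c))) atTop (𝓝 0) := by
  have huc : UniformContinuous fun t => Circle.exp (c t) :=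
    CompactSpace.uniformContinuous_of_continuous (by fun_prop)
  refine ENNReal.tendsto_nhds_zero.2 fun ε hε => ?_
  obtain ⟨δ, hδ, hosc⟩ := EMetric.uniformContinuous_iff.1 huc ε hε
  filter_upwards [ENNReal.tendsto_inv_nat_nhds_zero.eventually (gt_mem_nhds hδ),
    eventually_gt_atTop 0] with m hmδ hm
  exact (edist_le_iSup _ _).trans
    (iSup_le fun t => (hosc ((edist_floor_div_le hm t).trans_lt hmδ)).le)

lemma edist_skorokhod_circle_le (x y : SkorokhodSpace Circle) : edist x y ≤ 2 := by
  refine (edist_le_iSup x y).trans (iSup_le fun t => ?_)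
  have hdist : dist (x t) (y t) ≤ 2 := by
    change dist (x t : ℂ) (y t) ≤ 2
    have h := dist_le_norm_add_norm (x t : ℂ) (y t)
    rw [Circle.norm_coe, Circle.norm_coe] at h
    linarith
  rw [edist_dist]
  simpa using ENNReal.ofReal_le_ofReal hdist

lemma tendsto_lintegral_edist_expPath_gridValues (ρ : Measure C(unitInterval, ℝ))
    [IsFiniteMeasure ρ] :
    Tendsto (fun m : ℕ => ∫⁻ c, edist (expPath c) (stepPath m (gridValues m c)) ∂ρ) atTop
      (𝓝 0) := by
  rw [← lintegral_zero (μ := ρ)]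
  refine tendsto_lintegral_of_dominated_convergence (fun _ => 2) (fun m => ?_)
    (fun m => ae_of_all _ fun c => edist_skorokhod_circle_le _ _)
    (by simp [ENNReal.mul_eq_top, measure_ne_top])
    (ae_of_all _ tendsto_edist_expPath_gridValues)
  exact (continuous_expPath.edist (continuous_stepPath_gridValues m)).measurable

section chain
variable {b : ℝ} {β : ℕ → ℝ} (hb : 0 < b) (hβ : Tendsto (fun n : ℕ => β n / n) atTop (𝓝 b))
include hb hβ

lemma eventually_lintegral_edist_gridSpins_le (x y : ℝ) {ε : ENNReal} (hε : 0 < ε) :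
    ∀ᶠ m : ℕ in atTop, ∀ᶠ n : ℕ in atTop,
      ∫⁻ θ, edist (spinPath n θ) (stepPath m (gridSpins n m θ)) ∂gibbsMeasure n (β n) x y ≤ ε := by
  obtain ⟨C, hC⟩ := exists_lintegral_edist_stepPath_pow_four_le hb hβ x y
  have hlim : Tendsto (fun m : ℕ => C / (m : ENNReal)) atTop (𝓝 0) := by
    simpa only [div_eq_mul_inv, mul_zero] using
      ENNReal.Tendsto.const_mul ENNReal.tendsto_inv_nat_nhds_zero (Or.inr ENNReal.coe_ne_top)
  filter_upwards [hlim.eventually (gt_mem_nhds (ENNReal.pow_pos hε 4)), eventually_gt_atTop 0]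
    with m hm hm0
  filter_upwards [hC m hm0] with n hn
  have hmeas := ((continuous_spinPath n).edist (continuous_stepPath_gridSpins n m)).measurable
  exact (ENNReal.pow_le_pow_left_iff four_ne_zero).1
    ((lintegral_pow_le_lintegral_pow hmeas.aemeasurable four_pos).trans (hn.trans hm.le))

variable {v : NNReal} (hv : (v : ℝ) = 1 / b) {x y : ℝ}
include hv

lemma tendstoInDistribution_stepPath_gridSpins {ρ : Measure C(unitInterval, ℝ)}
    [IsProbabilityMeasure ρ] (hρ : IsCircleBridge v (Circle.exp x) (Circle.exp y) ρ) {m : ℕ}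
    (hm : 0 < m) :
    TendstoInDistribution (fun n θ => stepPath m (gridSpins n m θ)) atTop
      (fun c => stepPath m (gridValues m c)) (fun n => gibbsMeasure n (β n) x y) ρ := by
  refine (tendstoInDistribution_iff_forall_integral_tendsto
    (fun n => (continuous_stepPath_gridSpins n m).measurable.aemeasurable)
    (continuous_stepPath_gridValues m).measurable.aemeasurable).2 fun f => ?_
  have hf : Continuous fun g : Fin (m + 1) → Circle => (f (stepPath m g) : ℂ) :=
    Complex.continuous_ofReal.comp (f.continuous.comp (lipschitzWith_stepPath m).continuous)
  have h := tendsto_integral_gridSpins hb hβ hv hρ hm ⟨_, hf⟩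
  simp only [ContinuousMap.coe_mk, integral_complex_ofReal] at h
  exact tendsto_ofReal_iff.1 h

theorem tendstoInDistribution_spinPath {ρ : ProbabilityMeasure C(unitInterval, ℝ)}
    (hρ : IsCircleBridge v (Circle.exp x) (Circle.exp y) ρ) :
    TendstoInDistribution (fun n => spinPath n) atTop id (fun n => gibbsMeasure n (β n) x y)
      (ρ.map continuous_expPath.measurable.aemeasurable : Measure (SkorokhodSpace Circle)) := by
  have h : TendstoInDistribution (fun n => spinPath n) atTop expPath
      (fun n => gibbsMeasure n (β n) x y) (ρ : Measure C(unitInterval, ℝ)) :=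
    tendstoInDistribution_of_approx (fun n => (continuous_spinPath n).measurable.aemeasurable)
      continuous_expPath.measurable.aemeasurable
      ((eventually_gt_atTop 0).mono fun _ hm =>
        tendstoInDistribution_stepPath_gridSpins hb hβ hv hρ hm)
      (tendsto_lintegral_edist_expPath_gridValues _)
      fun ε hε => eventually_lintegral_edist_gridSpins_le hb hβ x y hε
  refine ⟨h.forall_aemeasurable, aemeasurable_id, h.tendsto.mono_right (congrArg 𝓝 ?_).le⟩
  exact Subtype.ext Measure.map_id.symm

end chain

end XYChain

end

theorem mainTheorem9 (b : ℝ) (hb : 0 < b) (β : ℕ → ℝ)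
    (hβ : Tendsto (fun n : ℕ => β n / n) atTop (𝓝 b)) :
    -- `S^n_{[nt]}` converges in distribution, for the Skorokhod topology, to `exp (i B(t) / √b)`,
    -- where `B` is a Brownian motion conditioned on its values modulo `2π√b` at times 0 and 1
    (∀ θ₀ ∈ Set.Ioc (-Real.pi) Real.pi, ∀ θ₁ ∈ Set.Ioc (-Real.pi) Real.pi,
      ∀ (Ω : Type*) [MeasurableSpace Ω] (P : Measure Ω) [IsProbabilityMeasure P]
        (W : NNReal → Ω → ℝ) (_ : IsBrownianReal W P)
        (x₀ : ℝ) (_ : Circle.exp (x₀ / √b) = Circle.exp θ₀)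
        (X : Ω → XYChain.SkorokhodSpace Circle)
        (_ : ∀ᵐ ω ∂P, ∀ t : unitInterval,
          X ω t = Circle.exp ((x₀ + W (unitInterval.toNNReal t) ω) / √b)),
        ∃ ν : ProbabilityMeasure (XYChain.SkorokhodSpace Circle),
          XYChain.IsConditionalLaw P X (fun ω => X ω 1) (Circle.exp θ₁) ν ∧
          TendstoInDistribution (fun n => XYChain.spinPath n) atTop id
            (fun n => XYChain.gibbsMeasure n (β n) θ₀ θ₁) (ν : Measure _)) ∧
    -- convergence of the ratios of partition functions
    (∀ θ₀ ∈ Set.Ioc (-Real.pi) Real.pi, ∀ θ₁ ∈ Set.Ioc (-Real.pi) Real.pi,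
      ∀ θ₀' ∈ Set.Ioc (-Real.pi) Real.pi, ∀ θ₁' ∈ Set.Ioc (-Real.pi) Real.pi,
        Tendsto
          (fun n : ℕ => XYChain.partitionFunction n (β n) θ₀ θ₁ /
            XYChain.partitionFunction n (β n) θ₀' θ₁')
          atTop
          (𝓝 ((∑' m : ℤ, Real.exp (-(b / 2) * (θ₁ - θ₀ + 2 * Real.pi * m) ^ 2)) /
            ∑' m : ℤ, Real.exp (-(b / 2) * (θ₁' - θ₀' + 2 * Real.pi * m) ^ 2)))) := by
  refine ⟨fun θ₀ _ θ₁ _ Ω _ P _ W hW x₀ hx₀ X hX => ?_, fun θ₀ _ θ₁ _ θ₀' _ θ₁' _ =>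
    XYChain.tendsto_partitionFunction_ratio hb hβ θ₀ θ₁ θ₀' θ₁'⟩
  let v : NNReal := ⟨1 / b, by positivity⟩
  have hvb : (v : ℝ) = 1 / b := rfl
  have hv : v ≠ 0 := NNReal.coe_ne_zero.1 (one_div_pos.2 hb).ne'
  have hX' : ∀ᵐ ω ∂P, ∀ t : unitInterval,
      X ω t = Circle.exp (x₀ / √b + √v * W (unitInterval.toNNReal t) ω) := by
    filter_upwards [hX] with ω h t
    rw [h, hvb, Real.sqrt_div zero_le_one, Real.sqrt_one]
    congr 1
    ring
  obtain ⟨ρ, hρ, hcond⟩ := XYChain.exists_conditionalLaw hW hv (x₀ / √b) θ₁ hX'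
  rw [hx₀] at hρ
  exact ⟨_, hcond, XYChain.tendstoInDistribution_spinPath hb hβ hvb hρ⟩
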